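/- **Setting.** An instance of Neighborhood-Aware Graph Labeling (NAGL) consists of a finite simple graph $G=(V,E)$ with $n=|V|\ge 1$ vertices, a finite label set $\mathcal L$ with $L=|\mathcal L|\ge 1$, and for every $v\in V$ a reward function $f_v:\mathcal L^{N[v]}\to\mathbb R$ on the labelings of the closed neighborhood $N[v]$. For $x\in\mathcal L^V$ put $F(x)=\sum_{v\in V} f_v(x_{N[v]})$; a labeling is optimal if it maximizes $F$. The squared graph $G^2$ joins two distinct vertices iff their distance in $G$ is at most $2$. A rooted nice tree decomposition of $G^2$ is a tree decomposition $(T,\{X_i\}_{i\in I})$ of $G^2$ with a root $r$ such that $X_r=\emptyset$ and every node $i$ is of one of the types leaf ($i$ has no children, $X_i=\emptyset$), introduce (one child $j$, $X_i=X_j\cup\{a\}$ with $a\notin X_j$), forget (one child $j$, $X_i=X_j\setminus\{a\}$ with $a\in X_j$), join (two children $j_1,j_2$, $X_i=X_{j_1}=X_{j_2}$). Its width is $t=\max_i|X_i|-1$, its height $h$ is the largest distance of a node from $r$. **Machine model.** Programs run on a unit-cost random access machine with words, real registers and real memory cells, which are zero at the start. Reals can only be copied, added and compared (and set to $0$). All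 words are smaller than $(|I|\cdot L^{t+1})^{C}$, i.e. have $O(\log(|I|\cdot L^{t+1}))$ bits. The input ($n$, $L$, $|I|$, $r$ and, as increasing lists, the sets $N[v]$, the bags, and the sets of children) is read-only. The functions $f_v$ are given by an evaluation oracle: one query costs the number of its arguments plus one. Space is the number of working memory cells (words and reals, without the read-only input and the finitely many registers). **Theorem (CFDP).** There are two fixed programs and a constant $C$ such that the following holds for every instance of NAGL and every rooted nice tree decomposition of $G^2$ of width $t$ and height $h$. 1. *Correctness of the dynamic program.* There is a map $\beta:V\to I$ with $N[v]\subseteq X_{\beta(v)}$ for all $v$. For every such $\beta$ put $\Phi_i(\ell)=\sum_{v:\beta(v)=i} f_v(\ell_{N[v]})$. Then there are unique tables $\mathrm{DP}_i:\mathcal L^{X_i}\to\mathbb R$ with $$\mathrm{DP}_i(\ell)=\begin{cases}0 & i\text{ leaf},\\ \mathrm{DP}_j(\ell_{X_j})+\Phi_i(\ell) & i\text{ introduce node with child } j,\\ \max_{c\in\mathcal L}\mathrm{DP}_j(\ell\cup\{a\mapsto c\})+\Phi_i(\ell) & i\text{ forgets } a,\text{ with child } j,\\ \mathrm{DP}_{j_1}(\ell)+\mathrm{DP}_{j_2}(\ell)+\Phi_i(\ell)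 & i\text{ join node with children } j_1,j_2.\end{cases}$$ Moreover $\mathrm{DP}_r(\emptyset)=\max_{x\in\mathcal L^V}F(x)$. There is a labeling $x$ that follows the backpointers, that is, at every forget node with child $j$ and forgotten vertex $a$ the label $c=x_a$ attains $\max_{c}\mathrm{DP}_j(x_{X_j\setminus\{a\}}\cup\{a\mapsto c\})$; and every such labeling is optimal. 2. *Optimal labeling.* The first program halts and outputs an optimal labeling $x^\star\in\mathcal L^V$, with at most $C\cdot|I|\cdot L^{t+1}$ cells in each of the two memories (words and reals), i.e. in space $O(|I|\cdot L^{t+1})$. 3. *Optimal value only.* The second program halts and outputs $\max_x F(x)$, with at most $C\cdot h\cdot L^{t+1}$ cells in each of the two memories, i.e. in working space $O(h\cdot L^{t+1})$. 4. *Running time.* If $|I|\le c\cdot n\cdot\max(t,1)$ for a natural number $c$, then each of the two programs takes at most $C\cdot c\cdot n\cdot\max(t,1)\cdot L^{t+1}$ steps. In particular, for decompositions with $|I|=O(n\cdot t)$ nodes and $t\ge 1$, the running time is $O(n\cdot t\cdot L^{t+1})$. -/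

import Mathlib

/-! ## Graphs, nice tree decompositions -/

namespace SimpleGraph

/-- The squared graph: distinct vertices are adjacent iff their distance in `G` is at most two
(`edist` is infinite between different components). -/
def square {V : Type*} (G : SimpleGraph V) : SimpleGraph V where
  Adj u v := u ≠ v ∧ G.edist u v ≤ 2
  symm := ⟨fun _ _ h => ⟨h.1.symm, by rw [SimpleGraph.edist_comm]; exact h.2⟩⟩
  loopless := ⟨fun _ h => h.1 rfl⟩

open Classical in
/-- The closed neighbourhood `N[v]`. -/
noncomputable def closedNbhd {V : Type*} [Fintype V] (G : SimpleGraph V) (v : V) : Finset V :=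
  Finset.univ.filter fun u => u = v ∨ G.Adj v u

end SimpleGraph

/-- A tree decomposition `(T, {X_i})` of `H`. -/
structure TreeDecomposition {V : Type*} (H : SimpleGraph V) (I : Type*) where
  tree : SimpleGraph I
  isTree : tree.IsTree
  bag : I → Finset V
  exists_mem_bag : ∀ v, ∃ i, v ∈ bag i
  exists_edge_subset_bag : ∀ u v, H.Adj u v → ∃ i, u ∈ bag i ∧ v ∈ bag i
  connected_nodes : ∀ v, (tree.induce {i | v ∈ bag i}).Connected

namespace TreeDecomposition

variable {V I : Type*} {H : SimpleGraph V} [Fintype I]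

/-- The width `max_i |X_i| - 1` (the maximum is positive as soon as `V` is nonempty). -/
def width (D : TreeDecomposition H I) : ℕ :=
  (Finset.univ.sup fun i => (D.bag i).card) - 1

open Classical in
/-- The children of the node `i` when the tree is rooted at `r`: the neighbours of `i` that are
farther away from the root. -/
noncomputable def children (D : TreeDecomposition H I) (r i : I) : Finset I :=
  Finset.univ.filter fun j => D.tree.Adj i j ∧ D.tree.dist r j = D.tree.dist r i + 1

/-- The height of the tree rooted at `r`: the largest distance of a node from the root. -/
noncomputable def height (D : TreeDecomposition H I) (r : I) : ℕ :=
  Finset.univ.sup fun i => D.tree.dist r i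

/-- `i` is a leaf node. -/
def IsLeaf (D : TreeDecomposition H I) (r i : I) : Prop :=
  D.children r i = ∅ ∧ D.bag i = ∅

/-- `i` is an introduce node with child `j`, introducing `a`. -/
def IsIntroduce (D : TreeDecomposition H I) (r i j : I) (a : V) : Prop :=
  D.children r i = {j} ∧ a ∉ D.bag j ∧ (D.bag i : Set V) = (D.bag j : Set V) ∪ {a}

/-- `i` is a forget node with child `j`, forgetting `a`. -/
def IsForget (D : TreeDecomposition H I) (r i j : I) (a : V) : Prop :=
  D.children r i = {j} ∧ a ∈ D.bag j ∧ (D.bag i : Set V) = (D.bag j : Set V) \ {a}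

/-- `i` is a join node with the two distinct children `j₁`, `j₂`. -/
def IsJoin (D : TreeDecomposition H I) (r i j₁ j₂ : I) : Prop :=
  j₁ ≠ j₂ ∧ (D.children r i : Set I) = {j₁, j₂} ∧ D.bag i = D.bag j₁ ∧ D.bag i = D.bag j₂

end TreeDecomposition

/-- A rooted nice tree decomposition. The four node types exclude each other because they differ in
the number of children or in the size of the bag compared with the child's bag. -/
structure NiceTreeDecomposition {V : Type*} (H : SimpleGraph V) (I : Type*) [Fintype I] extends
    TreeDecomposition H I where
  root : I
  bag_root : bag root = ∅
  nodeType : ∀ i,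
    toTreeDecomposition.IsLeaf root i ∨
    (∃ j a, toTreeDecomposition.IsIntroduce root i j a) ∨
    (∃ j a, toTreeDecomposition.IsForget root i j a) ∨
    (∃ j₁ j₂, toTreeDecomposition.IsJoin root i j₁ j₂)

/-! ## Neighborhood-aware graph labeling -/

/-- An instance of NAGL with vertex set `V` and label set `Λ`: a graph and, for every vertex `v`,
a reward function of the labels on the closed neighbourhood of `v`. -/
structure NAGL (V Λ : Type*) [Fintype V] where
  graph : SimpleGraph V
  reward : (v : V) → (graph.closedNbhd v → Λ) → ℝ

namespace NAGL

variable {V Λ I : Type*} [Fintype V] [Fintype I]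

/-- The objective `F(x) = ∑ v, f_v (x_{N[v]})`. -/
noncomputable def objective (N : NAGL V Λ) (x : V → Λ) : ℝ :=
  ∑ v, N.reward v ((N.graph.closedNbhd v).restrict x)

/-- `x` maximizes the objective. -/
def IsOptimal (N : NAGL V Λ) (x : V → Λ) : Prop :=
  ∀ y, N.objective y ≤ N.objective x

/-- `val` is the optimal value of the instance. -/
def IsOptimalValue (N : NAGL V Λ) (val : ℝ) : Prop :=
  IsGreatest (Set.range N.objective) val

/-- `β` assigns every reward term to a node whose bag contains the closed neighbourhood. -/
def IsAssignment (N : NAGL V Λ) (D : NiceTreeDecomposition N.graph.square I) (β : V → I) : Prop :=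
  ∀ v, N.graph.closedNbhd v ⊆ D.bag (β v)

open Classical in
/-- `Φ_i`: the sum of the reward terms assigned to the node `i`. If `β` is an assignment, this
depends only on the restriction of `x` to the bag of `i`. -/
noncomputable def localReward (N : NAGL V Λ) (β : V → I) (i : I) (x : V → Λ) : ℝ :=
  ∑ v ∈ Finset.univ.filter (fun v => β v = i), N.reward v ((N.graph.closedNbhd v).restrict x)

open Classical in
/-- `DP` satisfies the recurrence of the dynamic program CFDP. A labeling of the bag of `i` is
written as the restriction of a labeling `x` of all vertices; at a forget node,
`Function.update x a c` restricted to the bag of the child is `ℓ ∪ {a ↦ c}`. -/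
def IsTable (N : NAGL V Λ) (D : NiceTreeDecomposition N.graph.square I) (β : V → I)
    (DP : (i : I) → (D.bag i → Λ) → ℝ) : Prop :=
  ∀ (i : I) (x : V → Λ),
    (D.IsLeaf D.root i → DP i ((D.bag i).restrict x) = 0) ∧
    (∀ j a, D.IsIntroduce D.root i j a →
      DP i ((D.bag i).restrict x) = DP j ((D.bag j).restrict x) + N.localReward β i x) ∧
    (∀ j a, D.IsForget D.root i j a →
      DP i ((D.bag i).restrict x) =
        (⨆ c : Λ, DP j ((D.bag j).restrict (Function.update x a c))) + N.localReward β i x) ∧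
    (∀ j₁ j₂, D.IsJoin D.root i j₁ j₂ →
      DP i ((D.bag i).restrict x) =
        DP j₁ ((D.bag j₁).restrict x) + DP j₂ ((D.bag j₂).restrict x) + N.localReward β i x)

open Classical in
/-- The labeling `x` follows the backpointers of the tables `DP`: at every forget node the label
of the forgotten vertex attains the maximum of the recurrence. -/
def FollowsBackpointers (N : NAGL V Λ) (D : NiceTreeDecomposition N.graph.square I)
    (DP : (i : I) → (D.bag i → Λ) → ℝ) (x : V → Λ) : Prop :=
  ∀ i j a, D.IsForget D.root i j a → ∀ c : Λ,
    DP j ((D.bag j).restrict (Function.update x a c)) ≤ DP j ((D.bag j).restrict x)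

end NAGL

/-! ## The machine model

A random access machine with words (natural numbers), reals, read-only input tables and a reward
oracle. Programs are finite and structured. Reals can only be copied, added, and compared.
The two bounds in `Environment` make the model honest: a program that accesses an address
`≥ space`, or that produces a word `≥ wordBound`, is stuck. -/

namespace RAM

/-- Names of the read-only input tables. -/
inductive Table
  | numVertices | numLabels | numNodes | rootNode
  | nbrCount | nbr
  | bagCount | bagElem
  | childCount | child

/-- Word expressions. `read tab i j` is the entry `(i, j)` of an input table, `load a` the content
of the word memory at address `a`; `lt` and `eq` have value `1` or `0`. -/
inductive Expr
  | const (c : ℕ)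
  | reg (x : ℕ)
  | load (a : Expr)
  | read (tab : Table) (i j : Expr)
  | add (e₁ e₂ : Expr)
  | sub (e₁ e₂ : Expr)
  | mul (e₁ e₂ : Expr)
  | div (e₁ e₂ : Expr)
  | mod (e₁ e₂ : Expr)
  | lt (e₁ e₂ : Expr)
  | eq (e₁ e₂ : Expr)

/-- Real expressions. -/
inductive RExpr
  | zero
  | reg (x : ℕ)
  | load (a : Expr)
  | add (r₁ r₂ : RExpr)

/-- Programs. `compare x r₁ r₂` sets the word register `x` to `1` if `r₁ ≤ r₂` and to `0`
otherwise; `query x v a l` calls the oracle on `v` and the `l` words stored from address `a` on, and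
puts the answer into the real register `x`; conditions hold when their value is nonzero. -/
inductive Cmd
  | skip
  | assign (x : ℕ) (e : Expr)
  | store (a e : Expr)
  | rassign (x : ℕ) (r : RExpr)
  | rstore (a : Expr) (r : RExpr)
  | compare (x : ℕ) (r₁ r₂ : RExpr)
  | query (x : ℕ) (v a l : Expr)
  | seq (c₁ c₂ : Cmd)
  | branch (e : Expr) (c₁ c₂ : Cmd)
  | loop (e : Expr) (c : Cmd)

/-- Contents of the registers and of the working memory. -/
structure State where
  reg : ℕ → ℕ
  mem : ℕ → ℕ
  rreg : ℕ → ℝ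
  rmem : ℕ → ℝ

/-- Everything is zero at the start. -/
def State.init : State := ⟨fun _ => 0, fun _ => 0, fun _ => 0, fun _ => 0⟩

/-- What a program runs against: the input tables, the oracle (`oracle v w r`: on vertex `v` and
label list `w` the answer is `r`), the number of available cells in each of the two memories,
and the bound on the words. -/
structure Environment where
  table : Table → ℕ → ℕ → ℕ
  oracle : ℕ → List ℕ → ℝ → Prop
  space : ℕ
  wordBound : ℕ

namespace Expr

/-- The value of a word expression. -/
def eval (E : Environment) (s : State) : Expr → ℕ
  | const c => c
  | reg x => s.reg x
  | load a => s.mem (a.eval E s)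
  | read tab i j => E.table tab (i.eval E s) (j.eval E s)
  | add e₁ e₂ => e₁.eval E s + e₂.eval E s
  | sub e₁ e₂ => e₁.eval E s - e₂.eval E s
  | mul e₁ e₂ => e₁.eval E s * e₂.eval E s
  | div e₁ e₂ => e₁.eval E s / e₂.eval E s
  | mod e₁ e₂ => e₁.eval E s % e₂.eval E s
  | lt e₁ e₂ => if e₁.eval E s < e₂.eval E s then 1 else 0
  | eq e₁ e₂ => if e₁.eval E s = e₂.eval E s then 1 else 0

/-- Evaluation respects the bounds: all addresses are below `space` and the values of all
subexpressions are below `wordBound`. -/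
def Safe (E : Environment) (s : State) : Expr → Prop
  | const c => c < E.wordBound
  | reg x => s.reg x < E.wordBound
  | load a => a.Safe E s ∧ a.eval E s < E.space ∧ s.mem (a.eval E s) < E.wordBound
  | read tab i j => i.Safe E s ∧ j.Safe E s ∧ (read tab i j).eval E s < E.wordBound
  | add e₁ e₂ => e₁.Safe E s ∧ e₂.Safe E s ∧ (add e₁ e₂).eval E s < E.wordBound
  | sub e₁ e₂ => e₁.Safe E s ∧ e₂.Safe E s ∧ (sub e₁ e₂).eval E s < E.wordBound
  | mul e₁ e₂ => e₁.Safe E s ∧ e₂.Safe E s ∧ (mul e₁ e₂).eval E s < E.wordBound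
  | div e₁ e₂ => e₁.Safe E s ∧ e₂.Safe E s ∧ (div e₁ e₂).eval E s < E.wordBound
  | mod e₁ e₂ => e₁.Safe E s ∧ e₂.Safe E s ∧ (mod e₁ e₂).eval E s < E.wordBound
  | lt e₁ e₂ => e₁.Safe E s ∧ e₂.Safe E s ∧ (lt e₁ e₂).eval E s < E.wordBound
  | eq e₁ e₂ => e₁.Safe E s ∧ e₂.Safe E s ∧ (eq e₁ e₂).eval E s < E.wordBound

/-- The number of elementary operations in a word expression. -/
def cost : Expr → ℕ
  | const _ => 1
  | reg _ => 1
  | load a => a.cost + 1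
  | read _ i j => i.cost + j.cost + 1
  | add e₁ e₂ => e₁.cost + e₂.cost + 1
  | sub e₁ e₂ => e₁.cost + e₂.cost + 1
  | mul e₁ e₂ => e₁.cost + e₂.cost + 1
  | div e₁ e₂ => e₁.cost + e₂.cost + 1
  | mod e₁ e₂ => e₁.cost + e₂.cost + 1
  | lt e₁ e₂ => e₁.cost + e₂.cost + 1
  | eq e₁ e₂ => e₁.cost + e₂.cost + 1

end Expr

namespace RExpr

/-- The value of a real expression. -/
def eval (E : Environment) (s : State) : RExpr → ℝ
  | zero => 0
  | reg x => s.rreg x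
  | load a => s.rmem (a.eval E s)
  | add r₁ r₂ => r₁.eval E s + r₂.eval E s

/-- Evaluation respects the bounds. -/
def Safe (E : Environment) (s : State) : RExpr → Prop
  | zero => True
  | reg _ => True
  | load a => a.Safe E s ∧ a.eval E s < E.space
  | add r₁ r₂ => r₁.Safe E s ∧ r₂.Safe E s

/-- The number of elementary operations in a real expression. -/
def cost : RExpr → ℕ
  | zero => 1
  | reg _ => 1
  | load a => a.cost + 1
  | add r₁ r₂ => r₁.cost + r₂.cost + 1

end RExpr

open Classical in
/-- `Exec E c s s' k`: started in state `s`, the program `c` halts in state `s'` after `k` steps, and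
never exceeds the space bound or the word bound of `E` on the way. -/
inductive Exec (E : Environment) : Cmd → State → State → ℕ → Prop
  | skip (s : State) : Exec E .skip s s 1
  | assign (s : State) (x : ℕ) (e : Expr) (he : e.Safe E s) :
      Exec E (.assign x e) s { s with reg := Function.update s.reg x (e.eval E s) } (e.cost + 1)
  | store (s : State) (a e : Expr) (ha : a.Safe E s) (he : e.Safe E s)
      (hs : a.eval E s < E.space) :
      Exec E (.store a e) s { s with mem := Function.update s.mem (a.eval E s) (e.eval E s) }
        (a.cost + e.cost + 1)
  | rassign (s : State) (x : ℕ) (r : RExpr) (hr : r.Safe E s) :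
      Exec E (.rassign x r) s { s with rreg := Function.update s.rreg x (r.eval E s) }
        (r.cost + 1)
  | rstore (s : State) (a : Expr) (r : RExpr) (ha : a.Safe E s) (hr : r.Safe E s)
      (hs : a.eval E s < E.space) :
      Exec E (.rstore a r) s { s with rmem := Function.update s.rmem (a.eval E s) (r.eval E s) }
        (a.cost + r.cost + 1)
  | compare (s : State) (x : ℕ) (r₁ r₂ : RExpr) (h₁ : r₁.Safe E s) (h₂ : r₂.Safe E s) :
      Exec E (.compare x r₁ r₂) s
        { s with reg := Function.update s.reg x (if r₁.eval E s ≤ r₂.eval E s then 1 else 0) }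
        (r₁.cost + r₂.cost + 1)
  | query (s : State) (x : ℕ) (v a l : Expr) (r : ℝ)
      (hv : v.Safe E s) (ha : a.Safe E s) (hl : l.Safe E s)
      (hs : ∀ k < l.eval E s, a.eval E s + k < E.space)
      (hr : E.oracle (v.eval E s)
        ((List.range (l.eval E s)).map fun k => s.mem (a.eval E s + k)) r) :
      Exec E (.query x v a l) s { s with rreg := Function.update s.rreg x r }
        (v.cost + a.cost + l.cost + l.eval E s + 1)
  | seq (s₁ s₂ s₃ : State) (c₁ c₂ : Cmd) (k₁ k₂ : ℕ) (h₁ : Exec E c₁ s₁ s₂ k₁)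
      (h₂ : Exec E c₂ s₂ s₃ k₂) :
      Exec E (.seq c₁ c₂) s₁ s₃ (k₁ + k₂)
  | branchTrue (s s' : State) (e : Expr) (c₁ c₂ : Cmd) (k : ℕ) (he : e.Safe E s)
      (hne : e.eval E s ≠ 0) (h : Exec E c₁ s s' k) :
      Exec E (.branch e c₁ c₂) s s' (e.cost + 1 + k)
  | branchFalse (s s' : State) (e : Expr) (c₁ c₂ : Cmd) (k : ℕ) (he : e.Safe E s)
      (heq : e.eval E s = 0) (h : Exec E c₂ s s' k) :
      Exec E (.branch e c₁ c₂) s s' (e.cost + 1 + k)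
  | loopDone (s : State) (e : Expr) (c : Cmd) (he : e.Safe E s) (heq : e.eval E s = 0) :
      Exec E (.loop e c) s s (e.cost + 1)
  | loopStep (s₁ s₂ s₃ : State) (e : Expr) (c : Cmd) (k₁ k₂ : ℕ) (he : e.Safe E s₁)
      (hne : e.eval E s₁ ≠ 0) (h₁ : Exec E c s₁ s₂ k₁) (h₂ : Exec E (.loop e c) s₂ s₃ k₂) :
      Exec E (.loop e c) s₁ s₃ (e.cost + 1 + k₁ + k₂)

end RAM

/-! ## Encoding of the input

Vertices, labels and nodes are `0, …, n - 1`, `0, …, L - 1` and `0, …, m - 1`;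
a finite set is given by the increasing list of its elements. -/

namespace NAGL

/-- The increasing list of the elements of `A i` (empty if `i` is out of range). -/
def row {p q : ℕ} (A : Fin p → Finset (Fin q)) (i : ℕ) : List ℕ :=
  if h : i < p then ((A ⟨i, h⟩).sort (· ≤ ·)).map Fin.val else []

/-- The input tables: the sizes, the root, and for each vertex its closed neighbourhood, for each
node its bag and its children. Entries out of range are `0`. -/
noncomputable def inputTable {n L m : ℕ} (N : NAGL (Fin n) (Fin L))
    (D : NiceTreeDecomposition N.graph.square (Fin m)) : RAM.Table → ℕ → ℕ → ℕ
  | .numVertices, _, _ => n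
  | .numLabels, _, _ => L
  | .numNodes, _, _ => m
  | .rootNode, _, _ => D.root
  | .nbrCount, v, _ => (row N.graph.closedNbhd v).length
  | .nbr, v, k => (row N.graph.closedNbhd v).getD k 0
  | .bagCount, i, _ => (row D.bag i).length
  | .bagElem, i, k => (row D.bag i).getD k 0
  | .childCount, i, _ => (row (D.children D.root) i).length
  | .child, i, k => (row (D.children D.root) i).getD k 0

/-- The evaluation oracle: on a vertex `v` and the list `w` of the labels of the vertices of `N[v]`,
in increasing order of these vertices, the answer is the value of `f_v`. It gives no answer on other
lists. -/
def oracle {n L : ℕ} (N : NAGL (Fin n) (Fin L)) (v : ℕ) (w : List ℕ) (r : ℝ) : Prop :=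
  ∃ (hv : v < n) (a : N.graph.closedNbhd ⟨v, hv⟩ → Fin L),
    w = ((N.graph.closedNbhd ⟨v, hv⟩).sort (· ≤ ·)).attach.map
      (fun u => (a ⟨u.1, (Finset.mem_sort _).1 u.2⟩ : ℕ)) ∧
    r = N.reward ⟨v, hv⟩ a

/-- The machine for the instance `N` with the decomposition `D`, working space `S` and words
below `W`. -/
noncomputable def environment {n L m : ℕ} (N : NAGL (Fin n) (Fin L))
    (D : NiceTreeDecomposition N.graph.square (Fin m)) (S W : ℕ) : RAM.Environment where
  table := N.inputTable D
  oracle := N.oracle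
  space := S
  wordBound := W

end NAGL

/-! Correctness. In `G.square` every closed neighbourhood is a clique, and by the Helly property of
subtrees a clique lies in a single bag, so every reward term can be assigned to a node. The number
`table i x` is the best reward that can be collected below `i` when the labels on the bag of `i` are
those of `x`. All bags containing a vertex lie below the node that forgets it, so maximizing one
label at a time at the forget nodes loses nothing: the rewards collected below `i` never exceed the
table entry (`sum_localReward_le_table`), and they equal it when `x` attains every maximum
(`sum_localReward_eq_table`). At the root the bag is empty, and this comparison is optimality. A
labeling that follows all backpointers is built from the root downwards, because a label chosen at a
forget node cannot affect the maxima taken at nodes that are not below it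
(`FollowsOn.insert_update`).

Time. The programs use one particular assignment: `v` goes to the node `j` whose bag contains `N[v]`
and whose parent forgets a member of `N[v]`. This node exists and is unique, so membership is tested
locally and no assignment is stored (`IsForgetAssignment.eq_iff`). With `t` the width, the tests
cost `O((t+2)^3)` per node, merging a table into the parent's costs `O(L^(t+1))` per node, and
adding a reward term costs `O((t+2) L^(t+1))` once per vertex. For `L ≥ 2` the cubic term is
dominated by `L^(t+1)`, and the total is `O(|I| L^(t+1) + n max(t,1) L^(t+1))` (`sum_nodeCost_le`).
A single label is treated by a separate branch of the programs.

Space. A labeling of a bag is a numeral in base `L`, one digit per vertex in increasing order;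
between a node and its child one digit is inserted, deleted, or nothing changes (`Nat.redigit`,
`exists_isLink`). A depth-first traversal with an explicit stack clears a table when its node is
pushed, adds to it the contribution of each child, and completes it with the node's own rewards when
the node is popped (`iterates_traverse`). If tables are placed by node number, all of them survive,
and a second traversal reads off a labeling (`iterates_label`). If they are placed by depth, `O(h)`
slots suffice, and the `O(t)` scratch words fit because `t + 1 ≤ h` (`width_lt_height`).

The programs are verified with triples that carry time bounds: `Runs` for a program and `Iterates`
for a segment of the iterations of a loop. The latter allows the single traversal loop to be
analysed by induction on the tree. -/

set_option linter.unusedSectionVars false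

/-! ### Rooted nice tree decompositions: parents, descendants, forget nodes, Helly property. -/

namespace NiceTreeDecomposition

variable {V I : Type*} [Fintype I] {H : SimpleGraph V} (D : NiceTreeDecomposition H I)

/-- The depth of a node in the rooted tree. -/
noncomputable def depth (i : I) : ℕ := D.tree.dist D.root i

theorem mem_children {i j : I} :
    j ∈ D.children D.root i ↔ D.tree.Adj i j ∧ D.depth j = D.depth i + 1 := by
  simp [TreeDecomposition.children, depth]

theorem depth_child {i j : I} (h : j ∈ D.children D.root i) : D.depth j = D.depth i + 1 :=
  (D.mem_children.1 h).2

theorem depth_root : D.depth D.root = 0 := by simp [depth]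

theorem depth_le_height (i : I) : D.depth i ≤ D.height D.root :=
  Finset.le_sup (f := fun i => D.tree.dist D.root i) (Finset.mem_univ i)

/-- A shortest walk to a parent, prolonged by the edge to `j`, is again shortest and hence a path.
Paths in a tree are unique, so their penultimate vertices agree. -/
theorem parent_unique {i i' j : I} (h : j ∈ D.children D.root i)
    (h' : j ∈ D.children D.root i') : i = i' := by
  rw [mem_children] at h h'
  have key : ∀ k, D.tree.Adj k j → D.depth j = D.depth k + 1 →
      ∃ p : D.tree.Walk D.root j, p.IsPath ∧ p.penultimate = k := by
    intro k hk hd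
    obtain ⟨p, hp, hl⟩ := D.isTree.connected.exists_path_of_dist D.root k
    refine ⟨p.concat hk, ?_, by simp⟩
    apply SimpleGraph.Walk.isPath_of_length_eq_dist
    rw [SimpleGraph.Walk.length_concat, hl]
    exact hd.symm
  obtain ⟨p, hp, h1⟩ := key i h.1 h.2
  obtain ⟨q, hq, h2⟩ := key i' h'.1 h'.2
  have := D.isTree.existsUnique_path D.root j
  rw [← h1, ← h2, this.unique hp hq]

theorem child_or_child_of_adj {i j : I} (h : D.tree.Adj i j) :
    j ∈ D.children D.root i ∨ i ∈ D.children D.root j := by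
  rw [mem_children, mem_children]
  rcases D.isTree.dist_eq_dist_add_one_of_adj D.root h with h' | h'
  · exact .inr ⟨h.symm, h'⟩
  · exact .inl ⟨h, h'⟩

/-- The parent is the second node on a shortest path from `j` to the root. -/
theorem exists_parent {j : I} (h : j ≠ D.root) : ∃ i, j ∈ D.children D.root i := by
  obtain ⟨p, hp, hl⟩ := D.isTree.connected.exists_path_of_dist j D.root
  cases p with
  | nil => exact absurd rfl h
  | @cons _ k _ hk p =>
    refine ⟨k, D.mem_children.2 ⟨hk.symm, ?_⟩⟩
    have h1 : D.depth k ≤ p.length := by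
      rw [depth, SimpleGraph.dist_comm]; exact SimpleGraph.dist_le p
    have h2 : D.depth j = p.length + 1 := by
      rw [depth, SimpleGraph.dist_comm, ← hl]; simp
    rcases D.child_or_child_of_adj hk with h3 | h3 <;> have := D.depth_child h3 <;> omega

theorem depth_lt_card (i : I) : D.depth i < Fintype.card I := by
  obtain ⟨p, hp, hl⟩ := D.isTree.connected.exists_path_of_dist D.root i
  rw [depth, ← hl]
  exact hp.length_lt

theorem height_lt_card : D.height D.root < Fintype.card I := by
  rw [TreeDecomposition.height, Finset.sup_lt_iff]
  · exact fun i _ => D.depth_lt_card i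
  · exact Fintype.card_pos_iff.2 ⟨D.root⟩

/-- Bottom-up induction. -/
theorem children_induction {P : I → Prop} (h : ∀ i, (∀ j ∈ D.children D.root i, P j) → P i)
    (i : I) : P i := by
  induction hk : D.height D.root - D.depth i using Nat.strong_induction_on generalizing i with
  | _ k ih =>
    refine h i fun j hj => ih _ ?_ j rfl
    have := D.depth_child hj
    have := D.depth_le_height j
    omega

open Classical in
/-- The nodes of the subtree rooted at `i`. -/
noncomputable def desc (i : I) : Finset I :=
  Finset.univ.filter fun k => Relation.ReflTransGen (fun i j => j ∈ D.children D.root i) i k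

theorem mem_desc {i k : I} :
    k ∈ D.desc i ↔ Relation.ReflTransGen (fun i j => j ∈ D.children D.root i) i k := by
  simp [desc]

theorem self_mem_desc (i : I) : i ∈ D.desc i := D.mem_desc.2 .refl

theorem desc_trans {i j k : I} (h : j ∈ D.desc i) (h' : k ∈ D.desc j) : k ∈ D.desc i :=
  D.mem_desc.2 ((D.mem_desc.1 h).trans (D.mem_desc.1 h'))

theorem child_mem_desc {i j : I} (h : j ∈ D.children D.root i) : j ∈ D.desc i :=
  D.mem_desc.2 (.single h)

theorem desc_root : D.desc D.root = Finset.univ := by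
  ext i
  simp only [Finset.mem_univ, iff_true]
  induction hk : D.depth i generalizing i with
  | zero =>
    by_cases h : i = D.root
    · rw [h]; exact D.self_mem_desc _
    · obtain ⟨j, hj⟩ := D.exists_parent h
      have := D.depth_child hj; omega
  | succ k ih =>
    have h : i ≠ D.root := by rintro rfl; simp [depth_root] at hk
    obtain ⟨j, hj⟩ := D.exists_parent h
    have := D.depth_child hj
    exact D.desc_trans (ih j (by omega)) (D.child_mem_desc hj)

theorem depth_le_of_mem_desc {i k : I} (h : k ∈ D.desc i) : D.depth i ≤ D.depth k := by
  rw [mem_desc] at h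
  induction h with
  | refl => rfl
  | tail _ h ih => have := D.depth_child h; omega

theorem mem_desc_iff {i k : I} :
    k ∈ D.desc i ↔ k = i ∨ ∃ j ∈ D.children D.root i, k ∈ D.desc j := by
  constructor
  · intro h
    rcases Relation.ReflTransGen.cases_head (D.mem_desc.1 h) with h | ⟨j, hj, h⟩
    · exact .inl h.symm
    · exact .inr ⟨j, hj, D.mem_desc.2 h⟩
  · rintro (rfl | ⟨j, hj, h⟩)
    · exact D.self_mem_desc _
    · exact D.desc_trans (D.child_mem_desc hj) h

theorem not_mem_desc_child {i j : I} (h : j ∈ D.children D.root i) : i ∉ D.desc j := fun h' => by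
  have := D.depth_child h; have := D.depth_le_of_mem_desc h'; omega

theorem depth_lt_of_mem_desc {i k : I} (h : k ∈ D.desc i) (hne : k ≠ i) :
    D.depth i < D.depth k := by
  obtain ⟨j, hj, h⟩ := (D.mem_desc_iff.1 h).resolve_left hne
  have := D.depth_child hj; have := D.depth_le_of_mem_desc h; omega

/-- Two ancestors of a node are comparable. -/
theorem desc_total {i j k : I} (hi : k ∈ D.desc i) (hj : k ∈ D.desc j) :
    j ∈ D.desc i ∨ i ∈ D.desc j := by
  rw [mem_desc] at hi
  induction hi with
  | refl => exact .inr hj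
  | @tail b c _ hbc ih =>
    rcases Relation.ReflTransGen.cases_tail (D.mem_desc.1 hj) with h | ⟨b', hb', h⟩
    · subst h
      left
      exact D.mem_desc.2 (.tail ‹_› hbc)
    · rw [D.parent_unique h hbc] at hb'
      exact ih (D.mem_desc.2 hb')

/-- Two ancestors of a common node are comparable, but siblings have the same depth. -/
theorem desc_disjoint {i j j' : I} (h : j ∈ D.children D.root i) (h' : j' ∈ D.children D.root i)
    (hne : j ≠ j') : Disjoint (D.desc j) (D.desc j') := by
  rw [Finset.disjoint_left]
  intro k hk hk'
  have e1 := D.depth_child h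
  have e2 := D.depth_child h'
  rcases D.desc_total hk hk' with h | h
  · have := D.depth_lt_of_mem_desc h hne.symm; omega
  · have := D.depth_lt_of_mem_desc h hne; omega

/-- This recursion carries both the sums of rewards and the cost accounting of the traversals. -/
theorem sum_desc {M : Type*} [AddCommMonoid M] (w : I → M) (i : I) :
    ∑ k ∈ D.desc i, w k = w i + ∑ j ∈ D.children D.root i, ∑ k ∈ D.desc j, w k := by
  classical
  have : D.desc i = insert i ((D.children D.root i).biUnion D.desc) := by
    ext k; simp [D.mem_desc_iff (i := i)]
  rw [this, Finset.sum_insert, Finset.sum_biUnion]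
  · intro j hj j' hj' hne
    exact D.desc_disjoint hj hj' hne
  · simp only [Finset.mem_biUnion, not_exists, not_and]
    exact fun j hj => D.not_mem_desc_child hj

/-- If a vertex lies in a bag below `j` and in a bag that is not below `j`, then it lies in the bags
of `j` and of the parent of `j`. -/
theorem mem_bag_of_crossing {i j k k' : I} {a : V} (hj : j ∈ D.children D.root i)
    (hk : k ∈ D.desc j) (hk' : k' ∉ D.desc j) (ha : a ∈ D.bag k) (ha' : a ∈ D.bag k') :
    a ∈ D.bag j ∧ a ∈ D.bag i := by
  -- A walk inside the connected set of nodes containing `a` must leave the subtree of `j`, and the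
  -- only edge leaving it joins `j` to its parent.
  obtain ⟨p⟩ := (D.connected_nodes a).preconnected ⟨k, ha⟩ ⟨k', ha'⟩
  obtain ⟨d, -, h1, h2⟩ := p.exists_boundary_dart {x | x.1 ∈ D.desc j} hk hk'
  obtain ⟨⟨⟨u, hu⟩, ⟨w, hw⟩⟩, hadj⟩ := d
  simp only [Set.mem_ofPred_eq] at h1 h2 hu hw
  have hadj' : D.tree.Adj u w := hadj
  rcases D.child_or_child_of_adj hadj' with h | h
  · exact absurd (D.desc_trans h1 (D.child_mem_desc h)) h2
  · rcases Relation.ReflTransGen.cases_tail (D.mem_desc.1 h1) with h3 | ⟨b, hb, h3⟩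
    · subst h3
      rw [D.parent_unique hj h]
      exact ⟨hu, hw⟩
    · rw [D.parent_unique h3 h] at hb
      exact absurd (D.mem_desc.2 hb) h2

theorem child_of_children_eq {i j : I} (h : D.children D.root i = {j}) :
    j ∈ D.children D.root i := by rw [h]; exact Finset.mem_singleton_self j

theorem isForget_child {i j : I} {a : V} (h : D.IsForget D.root i j a) :
    j ∈ D.children D.root i := D.child_of_children_eq h.1

theorem isForget_mem_iff {i j : I} {a v : V} (h : D.IsForget D.root i j a) :
    v ∈ D.bag i ↔ v ∈ D.bag j ∧ v ≠ a := by
  have := Set.ext_iff.1 h.2.2 v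
  simpa using this

theorem isIntroduce_mem_iff {i j : I} {a v : V} (h : D.IsIntroduce D.root i j a) :
    v ∈ D.bag i ↔ v ∈ D.bag j ∨ v = a := by
  have := Set.ext_iff.1 h.2.2 v
  simpa [or_comm] using this

/-- Below a forget node of `a` are all bags that contain `a`. -/
theorem mem_desc_of_isForget {i j k : I} {a : V} (h : D.IsForget D.root i j a)
    (hk : a ∈ D.bag k) : k ∈ D.desc j := by
  by_contra hk'
  have := (D.mem_bag_of_crossing (D.isForget_child h) (D.self_mem_desc j) hk' h.2.1 hk).2
  exact ((D.isForget_mem_iff h).1 this).2 rfl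

/-- The child determines its parent, and a second forgotten vertex would still lie in the parent's
bag. -/
theorem isForget_vertex_unique {i j i' j' : I} {a a' : V} (h : D.IsForget D.root i j a)
    (h' : D.IsForget D.root i' j' a') (hj : j = j') : a = a' := by
  subst hj
  have := D.parent_unique (D.isForget_child h) (D.isForget_child h')
  subst this
  by_contra hne
  exact ((D.isForget_mem_iff h').1 ((D.isForget_mem_iff h).2 ⟨h'.2.1, Ne.symm hne⟩)).2 rfl

/-- The ways in which a node relates to one of its children. -/
theorem child_cases {i j : I} (hj : j ∈ D.children D.root i) :
    (∃ a, D.IsIntroduce D.root i j a) ∨ (∃ a, D.IsForget D.root i j a) ∨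
      (D.bag i = D.bag j ∧ ∃ j₁ j₂, D.IsJoin D.root i j₁ j₂) := by
  rcases D.nodeType i with h | ⟨j', a, h⟩ | ⟨j', a, h⟩ | ⟨j₁, j₂, h⟩
  · rw [h.1] at hj; simp at hj
  · have := hj; rw [h.1, Finset.mem_singleton] at this; subst this; exact .inl ⟨a, h⟩
  · have := hj; rw [h.1, Finset.mem_singleton] at this; subst this; exact .inr (.inl ⟨a, h⟩)
  · have : j ∈ (D.children D.root i : Set I) := hj
    rw [h.2.1] at this
    refine .inr (.inr ⟨?_, j₁, j₂, h⟩)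
    rcases this with rfl | rfl
    · exact h.2.2.1
    · exact h.2.2.2

/-- Every vertex is forgotten. -/
theorem exists_isForget (a : V) : ∃ i j, D.IsForget D.root i j a := by
  classical
  obtain ⟨k, hk⟩ := D.exists_mem_bag a
  -- The topmost node whose bag contains `a` is not the root, and its parent must forget `a`.
  obtain ⟨j, hj, hmin⟩ := Finset.exists_min_image (Finset.univ.filter fun k => a ∈ D.bag k) D.depth
    ⟨k, by simpa using hk⟩
  simp only [Finset.mem_filter, Finset.mem_univ, true_and] at hj hmin
  have hr : j ≠ D.root := by
    rintro rfl; rw [D.bag_root] at hj; simp at hj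
  obtain ⟨i, hi⟩ := D.exists_parent hr
  have hd := D.depth_child hi
  have hai : a ∉ D.bag i := fun h => by have := hmin i h; omega
  refine ⟨i, j, ?_⟩
  rcases D.child_cases hi with ⟨b, h⟩ | ⟨b, h⟩ | h
  · exact absurd ((D.isIntroduce_mem_iff h).2 (.inl hj)) hai
  · have : a = b := by
      by_contra hne; exact hai ((D.isForget_mem_iff h).2 ⟨hj, hne⟩)
    rwa [this]
  · rw [h.1] at hai; exact absurd hj hai

/-- Helly property: a clique is contained in the bag of the child of a node that forgets one of its
vertices. -/
theorem exists_isForget_clique {S : Finset V} (hS : S.Nonempty)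
    (hc : ∀ u ∈ S, ∀ v ∈ S, u ≠ v → H.Adj u v) :
    ∃ i j a, D.IsForget D.root i j a ∧ a ∈ S ∧ S ⊆ D.bag j := by
  choose f g hfg using D.exists_isForget
  -- Take the vertex of the clique that is forgotten deepest in the tree. If some `w` were missing
  -- from the bag of `g a`, the bag shared by `a` and `w` would lie below `g a`; then all bags of
  -- `w` would lie strictly below, and `w` would be forgotten deeper.
  obtain ⟨a, ha, hmax⟩ := Finset.exists_max_image S (fun a => D.depth (g a)) hS
  refine ⟨f a, g a, a, hfg a, ha, fun w hw => ?_⟩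
  by_contra hw'
  have hne : a ≠ w := by rintro rfl; exact hw' (hfg a).2.1
  obtain ⟨k, hk, hk'⟩ := D.exists_edge_subset_bag a w (hc a ha w hw hne)
  have h1 := D.mem_desc_of_isForget (hfg a) hk
  have h2 : g w ∈ D.desc (g a) := by
    by_contra h
    exact hw' (D.mem_bag_of_crossing (D.isForget_child (hfg a)) h1 h hk' (hfg w).2.1).1
  have h3 : g w ≠ g a := fun h => hw' (h ▸ (hfg w).2.1)
  have := D.depth_lt_of_mem_desc h2 h3
  have := hmax w hw
  omega

/-- Each of the two nodes has the vertex forgotten above the other in its bag, so each would be a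
descendant of the other. -/
theorem isForget_clique_unique {S : Finset V} {i j i' j' : I} {a a' : V}
    (h : D.IsForget D.root i j a) (ha : a ∈ S) (hS : S ⊆ D.bag j)
    (h' : D.IsForget D.root i' j' a') (ha' : a' ∈ S) (hS' : S ⊆ D.bag j') : j = j' := by
  by_contra hne
  have h1 := D.depth_lt_of_mem_desc (D.mem_desc_of_isForget h (hS' ha)) (Ne.symm hne)
  have h2 := D.depth_lt_of_mem_desc (D.mem_desc_of_isForget h' (hS ha')) hne
  omega

/-- The root bag is empty and a step from parent to child adds at most one vertex. -/
theorem card_bag_le_depth (i : I) : (D.bag i).card ≤ D.depth i := by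
  classical
  induction hk : D.depth i generalizing i with
  | zero =>
    by_cases h : i = D.root
    · simp [h, D.bag_root]
    · obtain ⟨j, hj⟩ := D.exists_parent h
      have := D.depth_child hj; omega
  | succ k ih =>
    have h : i ≠ D.root := by rintro rfl; simp [depth_root] at hk
    obtain ⟨j, hj⟩ := D.exists_parent h
    have := D.depth_child hj
    have hj' := ih j (by omega)
    rcases D.child_cases hj with ⟨b, h⟩ | ⟨b, h⟩ | h
    · exact (Finset.card_le_card fun v hv => (D.isIntroduce_mem_iff h).2 (.inl hv)).trans (by omega)
    · have : D.bag i ⊆ insert b (D.bag j) := fun v hv => by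
        by_cases hvb : v = b
        · simp [hvb]
        · exact Finset.mem_insert_of_mem ((D.isForget_mem_iff h).2 ⟨hv, hvb⟩)
      exact (Finset.card_le_card this).trans ((Finset.card_insert_le _ _).trans (by omega))
    · rw [← h.1]; omega

theorem card_bag_le_width (i : I) : (D.bag i).card ≤ D.width + 1 := by
  have : (D.bag i).card ≤ Finset.univ.sup fun i => (D.bag i).card :=
    Finset.le_sup (f := fun i => (D.bag i).card) (Finset.mem_univ i)
  rw [TreeDecomposition.width]; omega

/-- A vertex is needed because the subtraction in the width is truncated. -/
theorem width_add_one [Nonempty V] : D.width + 1 = Finset.univ.sup fun i => (D.bag i).card := by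
  obtain ⟨i, hi⟩ := D.exists_mem_bag (Classical.arbitrary V)
  have h1 : 0 < (D.bag i).card := Finset.card_pos.2 ⟨_, hi⟩
  have : (D.bag i).card ≤ Finset.univ.sup fun i => (D.bag i).card :=
    Finset.le_sup (f := fun i => (D.bag i).card) (Finset.mem_univ i)
  rw [TreeDecomposition.width]; omega

/-- This lets the scratch space of size `O(t)` be charged to the `O(h)` cells of the stack. -/
theorem width_lt_height [Nonempty V] : D.width + 1 ≤ D.height D.root := by
  rw [D.width_add_one]
  exact Finset.sup_le fun i _ => (D.card_bag_le_depth i).trans (D.depth_le_height i)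

/-- Distinct vertices are forgotten above distinct nodes. Hence the labeling itself fits into the
space allowed by the number of nodes. -/
theorem card_vertices_le {V I : Type*} [Fintype V] [Fintype I] {H : SimpleGraph V}
    (D : NiceTreeDecomposition H I) : Fintype.card V ≤ Fintype.card I := by
  choose f g hfg using D.exists_isForget
  exact Fintype.card_le_of_injective g fun a b h => D.isForget_vertex_unique (hfg a) (hfg b) h

theorem card_children_le (i : I) : (D.children D.root i).card ≤ 2 := by
  classical
  rcases D.nodeType i with h | ⟨j', a, h⟩ | ⟨j', a, h⟩ | ⟨j₁, j₂, h⟩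
  · simp [h.1]
  · simp [h.1]
  · simp [h.1]
  · have : D.children D.root i = {j₁, j₂} := by
      apply Finset.coe_injective; rw [h.2.1]; simp
    rw [this]; exact Finset.card_le_two

end NiceTreeDecomposition

/-! ### Correctness of the dynamic program. -/

namespace NAGL

variable {V Λ I : Type*} [Fintype V] [Fintype I] (N : NAGL V Λ)
  (D : NiceTreeDecomposition N.graph.square I) (β : V → I)

open Classical in
/-- The labeling that gives the label `c` to the vertices of the bag of `j` outside the bag of `i`,
and agrees with `x` elsewhere. -/
noncomputable def override (i j : I) (c : Λ) (x : V → Λ) : V → Λ :=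
  fun v => if v ∈ D.bag j ∧ v ∉ D.bag i then c else x v

/-- The table of the dynamic program, as a function of a labeling of all vertices. -/
noncomputable def table (i : I) (x : V → Λ) : ℝ :=
  (∑ j ∈ (D.children D.root i).attach, ⨆ c, table j.1 (N.override D i j.1 c x)) +
    N.localReward β i x
termination_by D.height D.root - D.depth i
decreasing_by
  have := D.depth_child j.2
  have := D.depth_le_height j.1
  omega

/-- What the child `j` contributes to the table of `i`. -/
noncomputable def contribution (i j : I) (x : V → Λ) : ℝ :=
  ⨆ c, N.table D β j (N.override D i j c x)

/-- One formula covers all node types. A leaf has no children. At introduce and join nodes the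
child's bag is contained in the bag of `i`, so `override` does nothing and the supremum is over a
constant. At a forget node it is the maximum over the forgotten label. -/
theorem table_eq (i : I) (x : V → Λ) :
    N.table D β i x = (∑ j ∈ D.children D.root i, N.contribution D β i j x) +
      N.localReward β i x := by
  rw [table, Finset.sum_attach (D.children D.root i) fun j => ⨆ c, N.table D β j
    (N.override D i j c x)]
  rfl

theorem override_of_subset {i j : I} (h : D.bag j ⊆ D.bag i) (c : Λ) (x : V → Λ) :
    N.override D i j c x = x := by
  funext v
  simp only [override]
  rw [if_neg fun h' => h'.2 (h h'.1)]

open Classical in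
theorem override_of_isForget {i j : I} {a : V} (h : D.IsForget D.root i j a) (c : Λ) (x : V → Λ) :
    N.override D i j c x = Function.update x a c := by
  funext v
  simp only [override, Function.update_apply, D.isForget_mem_iff h]
  have := h.2.1
  by_cases hv : v = a
  · subst hv; simp [this]
  · simp [hv]

theorem localReward_congr (hβ : N.IsAssignment D β) {i : I} {x y : V → Λ}
    (h : ∀ v ∈ D.bag i, x v = y v) : N.localReward β i x = N.localReward β i y := by
  classical
  refine Finset.sum_congr rfl fun v hv => ?_
  rw [Finset.mem_filter] at hv
  congr 1
  funext u
  exact h _ (hv.2 ▸ hβ v u.2)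

/-- A vertex of the child's bag either lies in the bag of `i`, where `x` and `y` agree, or receives
the label `c` from both overrides. -/
theorem table_congr (hβ : N.IsAssignment D β) {i : I} {x y : V → Λ}
    (h : ∀ v ∈ D.bag i, x v = y v) : N.table D β i x = N.table D β i y := by
  induction i using D.children_induction generalizing x y with
  | _ i ih =>
    rw [table_eq, table_eq, N.localReward_congr D β hβ h]
    congr 1
    refine Finset.sum_congr rfl fun j hj => ?_
    simp only [contribution]
    congr 1
    funext c
    refine ih j hj fun v hv => ?_
    simp only [override]
    by_cases hvi : v ∈ D.bag i
    · simp [hvi, h v hvi]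
    · simp [hv, hvi]

/-- No term can be assigned to an empty bag, since `v ∈ N[v]`. This serves the leaves and also the
root. -/
theorem localReward_leaf (hβ : N.IsAssignment D β) {i : I} (h : D.bag i = ∅) (x : V → Λ) :
    N.localReward β i x = 0 := by
  classical
  refine Finset.sum_eq_zero fun v hv => ?_
  rw [Finset.mem_filter] at hv
  have := hβ v
  rw [hv.2, h] at this
  have h2 := this (show v ∈ N.graph.closedNbhd v by simp [SimpleGraph.closedNbhd])
  simp at h2

open Classical in
/-- A labeling of all vertices with prescribed labels on `S`. -/
noncomputable def extend [Nonempty Λ] (S : Finset V) (ℓ : S → Λ) : V → Λ :=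
  fun v => if h : v ∈ S then ℓ ⟨v, h⟩ else Classical.arbitrary Λ

theorem restrict_extend [Nonempty Λ] (S : Finset V) (ℓ : S → Λ) : S.restrict (extend S ℓ) = ℓ := by
  funext v
  simp [extend]

/-- The tables of the dynamic program. -/
noncomputable def dpTable [Nonempty Λ] (i : I) (ℓ : D.bag i → Λ) : ℝ :=
  N.table D β i (extend (D.bag i) ℓ)

variable [Nonempty Λ]

theorem dpTable_restrict (hβ : N.IsAssignment D β) (i : I) (x : V → Λ) :
    N.dpTable D β i ((D.bag i).restrict x) = N.table D β i x := by
  refine N.table_congr D β hβ fun v hv => ?_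
  simp [extend, hv]

theorem contribution_of_subset {i j : I} (h : D.bag j ⊆ D.bag i) (x : V → Λ) :
    N.contribution D β i j x = N.table D β j x := by
  simp only [contribution, N.override_of_subset D h, ciSup_const]

theorem isTable_dpTable (hβ : N.IsAssignment D β) : N.IsTable D β (N.dpTable D β) := by
  intro i x
  simp only [N.dpTable_restrict D β hβ]
  refine ⟨fun h => ?_, fun j a h => ?_, fun j a h => ?_, fun j₁ j₂ h => ?_⟩
  · rw [table_eq, h.1, N.localReward_leaf D β hβ h.2]; simp
  · rw [table_eq, h.1, Finset.sum_singleton, contribution_of_subset]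
    exact fun v hv => (D.isIntroduce_mem_iff h).2 (.inl hv)
  · rw [table_eq, h.1, Finset.sum_singleton, contribution]
    simp only [N.override_of_isForget D h]
  · classical
    have : D.children D.root i = {j₁, j₂} := by
      apply Finset.coe_injective; rw [h.2.1]; simp
    rw [table_eq, this, Finset.sum_pair h.1, contribution_of_subset, contribution_of_subset]
    · rw [h.2.2.2]
    · rw [h.2.2.1]

/-- Every labeling of a bag is the restriction of a labeling of all vertices, so the recurrence
determines every entry from the children. -/
theorem isTable_unique {DP DP' : (i : I) → (D.bag i → Λ) → ℝ} (h : N.IsTable D β DP)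
    (h' : N.IsTable D β DP') : DP' = DP := by
  funext i
  induction i using D.children_induction with
  | _ i ih =>
    funext ℓ
    rw [← restrict_extend (D.bag i) ℓ]
    obtain ⟨h1, h2, h3, h4⟩ := h i (extend (D.bag i) ℓ)
    obtain ⟨h1', h2', h3', h4'⟩ := h' i (extend (D.bag i) ℓ)
    rcases D.nodeType i with ht | ⟨j, a, ht⟩ | ⟨j, a, ht⟩ | ⟨j₁, j₂, ht⟩
    · rw [h1 ht, h1' ht]
    · rw [h2 j a ht, h2' j a ht, ih j (D.child_of_children_eq ht.1)]
    · rw [h3 j a ht, h3' j a ht, ih j (D.child_of_children_eq ht.1)]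
    · have hj : ∀ j, j = j₁ ∨ j = j₂ → j ∈ D.children D.root i := fun j hj => by
        have : j ∈ (D.children D.root i : Set I) := by rw [ht.2.1]; exact hj
        exact this
      rw [h4 _ _ ht, h4' _ _ ht, ih _ (hj _ (.inl rfl)), ih _ (hj _ (.inr rfl))]

theorem sum_localReward (x : V → Λ) : ∑ i, N.localReward β i x = N.objective x := by
  classical
  simp only [localReward, objective]
  exact Finset.sum_fiberwise _ _ _

theorem table_override_le_contribution [Finite Λ] (i j : I) (c : Λ) (x : V → Λ) :
    N.table D β j (N.override D i j c x) ≤ N.contribution D β i j x :=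
  le_ciSup (f := fun c => N.table D β j (N.override D i j c x)) (Set.finite_range _).bddAbove c

/-- The label that `x` itself gives to the forgotten vertex is among the candidates of the maximum.
-/
theorem exists_override_eq {i j : I} (hj : j ∈ D.children D.root i) (x : V → Λ) :
    ∃ c, N.override D i j c x = x := by
  classical
  rcases D.child_cases hj with ⟨b, h⟩ | ⟨b, h⟩ | h
  · exact ⟨Classical.arbitrary Λ, N.override_of_subset D
      (fun v hv => (D.isIntroduce_mem_iff h).2 (.inl hv)) _ _⟩
  · exact ⟨x b, by rw [N.override_of_isForget D h]; simp⟩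
  · exact ⟨Classical.arbitrary Λ, N.override_of_subset D (by rw [h.1]) _ _⟩

/-- The upper bound: no labeling collects more below `i` than the table promises, because the labels
of `x` compete in every maximum. -/
theorem sum_localReward_le_table [Finite Λ] (i : I) (x : V → Λ) :
    ∑ k ∈ D.desc i, N.localReward β k x ≤ N.table D β i x := by
  induction i using D.children_induction with
  | _ i ih =>
    rw [D.sum_desc, table_eq, add_comm]
    gcongr with j hj
    obtain ⟨c, hc⟩ := N.exists_override_eq D hj x
    refine (ih j hj).trans ?_
    conv_lhs => rw [← hc]
    exact N.table_override_le_contribution D β i j c x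

open Classical in
/-- At every forget node of the set `P`, the labeling `x` follows the backpointers. -/
def FollowsOn (P : Set I) (x : V → Λ) : Prop :=
  ∀ i ∈ P, ∀ j a, D.IsForget D.root i j a → ∀ c : Λ,
    N.table D β j (Function.update x a c) ≤ N.table D β j x

/-- When the labels of `x` attain every maximum, all inequalities in the upper bound become
equalities. -/
theorem sum_localReward_eq_table [Finite Λ] {x : V → Λ} (hx : N.FollowsOn D β Set.univ x) (i : I) :
    ∑ k ∈ D.desc i, N.localReward β k x = N.table D β i x := by
  induction i using D.children_induction with
  | _ i ih =>
    rw [D.sum_desc, table_eq, add_comm]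
    congr 1
    refine Finset.sum_congr rfl fun j hj => ?_
    rw [ih j hj]
    apply le_antisymm
    · obtain ⟨c, hc⟩ := N.exists_override_eq D hj x
      conv_lhs => rw [← hc]
      exact N.table_override_le_contribution D β i j c x
    · refine ciSup_le fun c => ?_
      rcases D.child_cases hj with ⟨b, h⟩ | ⟨b, h⟩ | h
      · rw [N.override_of_subset D (fun v hv => (D.isIntroduce_mem_iff h).2 (.inl hv))]
      · rw [N.override_of_isForget D h]
        exact hx i (Set.mem_univ i) j b h c
      · rw [N.override_of_subset D (by rw [h.1])]

theorem objective_le_table_root [Finite Λ] (x : V → Λ) :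
    N.objective x ≤ N.table D β D.root x := by
  rw [← N.sum_localReward β, ← D.desc_root]
  exact N.sum_localReward_le_table D β D.root x

theorem objective_eq_table_root [Finite Λ] {x : V → Λ} (hx : N.FollowsOn D β Set.univ x) :
    N.objective x = N.table D β D.root x := by
  rw [← N.sum_localReward β, ← D.desc_root]
  exact N.sum_localReward_eq_table D β hx D.root

theorem table_root_congr (hβ : N.IsAssignment D β) (x y : V → Λ) :
    N.table D β D.root x = N.table D β D.root y :=
  N.table_congr D β hβ fun v hv => by rw [D.bag_root] at hv; simp at hv

/-- The root table is a constant that bounds every objective value and is attained by `x`. -/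
theorem isOptimal_of_followsOn [Finite Λ] (hβ : N.IsAssignment D β) {x : V → Λ}
    (hx : N.FollowsOn D β Set.univ x) : N.IsOptimal x := fun y => by
  rw [N.objective_eq_table_root D β hx, N.table_root_congr D β hβ x y]
  exact N.objective_le_table_root D β y

open Classical in
/-- Backpointers can be followed one node after the other, as long as no node comes after one of its
descendants. -/
theorem FollowsOn.insert_update (hβ : N.IsAssignment D β) {P : Set I} {x : V → Λ}
    (hx : N.FollowsOn D β P x) {i j : I} {a : V} (h : D.IsForget D.root i j a)
    (hP : ∀ k ∈ P, k ∈ D.desc i → k = i) {c : Λ}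
    (hc : ∀ c', N.table D β j (Function.update x a c') ≤ N.table D β j (Function.update x a c)) :
    N.FollowsOn D β (insert i P) (Function.update x a c) := by
  intro i' hi' j' a' h' c'
  by_cases e : i' = i
  · subst e
    have := h.1
    rw [h'.1, Finset.singleton_inj] at this
    subst this
    have := D.isForget_vertex_unique h h' rfl
    subst this
    rw [Function.update_idem]
    exact hc c'
  · have hi'P : i' ∈ P := hi'.resolve_left e
    -- All bags with `a` lie below `j`. If `j'` were one of them, its parent `i'` would be `i` or a
    -- descendant of `i`, against `hP`. So changing the label of `a` leaves the comparison at `i'`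
    -- untouched.
    have ha : a ∉ D.bag j' := fun ha => by
      have h1 := D.mem_desc_of_isForget h ha
      have h2 : i' ∉ D.desc i := fun h2 => e (hP i' hi'P h2)
      have h3 : j' ∈ D.desc i := D.desc_trans (D.child_mem_desc (D.isForget_child h)) h1
      rcases Relation.ReflTransGen.cases_tail (D.mem_desc.1 h1) with h4 | ⟨b, hb, h4⟩
      · subst h4
        exact e (D.parent_unique (D.isForget_child h') (D.isForget_child h))
      · rw [D.parent_unique h4 (D.isForget_child h')] at hb
        exact h2 (D.desc_trans (D.child_mem_desc (D.isForget_child h)) (D.mem_desc.2 hb))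
    have e1 : N.table D β j' (Function.update x a c) = N.table D β j' x :=
      N.table_congr D β hβ fun v hv => by
        rw [Function.update_of_ne]; rintro rfl; exact ha hv
    have e2 : N.table D β j' (Function.update (Function.update x a c) a' c') =
        N.table D β j' (Function.update x a' c') :=
      N.table_congr D β hβ fun v hv => by
        have : v ≠ a := by rintro rfl; exact ha hv
        simp [Function.update_apply, this]
    rw [e1, e2]
    exact hx i' hi'P j' a' h' c'

theorem FollowsOn.insert_of_not_isForget {P : Set I} {x : V → Λ}
    (hx : N.FollowsOn D β P x) {i : I} (h : ∀ j a, ¬ D.IsForget D.root i j a) :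
    N.FollowsOn D β (insert i P) x := by
  rintro i' (rfl | hi') j' a' h' c'
  · exact absurd h' (h _ _)
  · exact hx i' hi' j' a' h' c'

theorem exists_followsOn [Finite Λ] (hβ : N.IsAssignment D β) :
    ∃ x, N.FollowsOn D β Set.univ x := by
  classical
  suffices ∀ P : Finset I, ∃ x, N.FollowsOn D β P x by simpa using this Finset.univ
  intro P
  -- Nodes are inserted in order of nondecreasing depth, so that none comes after a proper
  -- descendant.
  refine Finset.induction_on_max_value D.depth P
    ⟨fun _ => Classical.arbitrary Λ, fun i hi => by simp at hi⟩ fun i P hi hmax ih => ?_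
  obtain ⟨x, hx⟩ := ih
  rw [Finset.coe_insert]
  by_cases h : ∃ j a, D.IsForget D.root i j a
  · obtain ⟨j, a, h⟩ := h
    obtain ⟨c, hc⟩ := Finite.exists_max fun c => N.table D β j (Function.update x a c)
    refine ⟨_, hx.insert_update N D β hβ h (fun k hk hk' => ?_) hc⟩
    by_contra hne
    have := D.depth_lt_of_mem_desc hk' hne
    have := hmax k hk
    omega
  · push Not at h
    exact ⟨x, hx.insert_of_not_isForget N D β h⟩

theorem followsBackpointers_iff (hβ : N.IsAssignment D β) (x : V → Λ) :
    N.FollowsBackpointers D (N.dpTable D β) x ↔ N.FollowsOn D β Set.univ x := by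
  simp only [FollowsBackpointers, FollowsOn, N.dpTable_restrict D β hβ, Set.mem_univ, true_imp_iff]

theorem isOptimalValue_table_root [Finite Λ] (hβ : N.IsAssignment D β) (x : V → Λ) :
    N.IsOptimalValue (N.table D β D.root x) := by
  obtain ⟨y, hy⟩ := N.exists_followsOn D β hβ
  refine ⟨⟨y, ?_⟩, ?_⟩
  · rw [N.objective_eq_table_root D β hy]; exact N.table_root_congr D β hβ _ _
  · rintro _ ⟨z, rfl⟩
    rw [N.table_root_congr D β hβ x z]; exact N.objective_le_table_root D β z

theorem dynamicProgram_correct [Finite Λ] (hβ : N.IsAssignment D β) :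
    ∃ DP : (i : I) → (D.bag i → Λ) → ℝ,
      N.IsTable D β DP ∧
      (∀ DP' : (i : I) → (D.bag i → Λ) → ℝ, N.IsTable D β DP' → DP' = DP) ∧
      (∀ ℓ : D.bag D.root → Λ, N.IsOptimalValue (DP D.root ℓ)) ∧
      (∃ x : V → Λ, N.FollowsBackpointers D DP x) ∧
      (∀ x : V → Λ, N.FollowsBackpointers D DP x → N.IsOptimal x) := by
  refine ⟨N.dpTable D β, N.isTable_dpTable D β hβ, fun DP' h =>
    N.isTable_unique D β (N.isTable_dpTable D β hβ) h, fun ℓ => ?_, ?_, fun x hx => ?_⟩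
  · exact N.isOptimalValue_table_root D β hβ _
  · simp only [N.followsBackpointers_iff D β hβ]
    exact N.exists_followsOn D β hβ
  · exact N.isOptimal_of_followsOn D β hβ ((N.followsBackpointers_iff D β hβ x).1 hx)

end NAGL

/-! ### The canonical assignment of reward terms. -/

namespace NAGL

variable {V Λ I : Type*} [Fintype V] [Fintype I] (N : NAGL V Λ)
  (D : NiceTreeDecomposition N.graph.square I)

theorem self_mem_closedNbhd (G : SimpleGraph V) (v : V) : v ∈ G.closedNbhd v := by
  simp [SimpleGraph.closedNbhd]

/-- Two members of `N[v]` are at distance at most two through `v`; this is why the squared graph is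
decomposed. -/
theorem square_adj_of_mem_closedNbhd {G : SimpleGraph V} {v u w : V} (hu : u ∈ G.closedNbhd v)
    (hw : w ∈ G.closedNbhd v) (hne : u ≠ w) : G.square.Adj u w := by
  simp only [SimpleGraph.closedNbhd, Finset.mem_filter, Finset.mem_univ, true_and] at hu hw
  refine ⟨hne, ?_⟩
  have key : ∀ y, y = v ∨ G.Adj v y → G.edist v y ≤ 1 := by
    rintro y (rfl | hy)
    · simp
    · exact (SimpleGraph.edist_eq_one_iff_adj.2 hy).le
  calc G.edist u w ≤ G.edist u v + G.edist v w := SimpleGraph.edist_triangle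
    _ ≤ 1 + 1 := by
      gcongr
      · rw [SimpleGraph.edist_comm]; exact key u hu
      · exact key w hw
    _ = 2 := by norm_num

/-- Every reward term is assigned to the child of a node that forgets a vertex of its scope. -/
def IsForgetAssignment (β : V → I) : Prop :=
  N.IsAssignment D β ∧ ∀ v, ∃ i a, D.IsForget D.root i (β v) a ∧ a ∈ N.graph.closedNbhd v

theorem exists_isForgetAssignment : ∃ β, N.IsForgetAssignment D β := by
  have key : ∀ v, ∃ j, N.graph.closedNbhd v ⊆ D.bag j ∧
      ∃ i a, D.IsForget D.root i j a ∧ a ∈ N.graph.closedNbhd v := fun v => by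
    obtain ⟨i, j, a, h, ha, hS⟩ := D.exists_isForget_clique
      ⟨v, self_mem_closedNbhd N.graph v⟩ fun u hu w hw => square_adj_of_mem_closedNbhd hu hw
    exact ⟨j, hS, i, a, h, ha⟩
  choose β h1 h2 using key
  exact ⟨β, h1, h2⟩

variable {N D} in
-- The right-hand side mentions only `j`, the vertex forgotten above it and `N[v]`, so a program can
-- decide it from the input tables.
theorem IsForgetAssignment.eq_iff {β : V → I} (hβ : N.IsForgetAssignment D β) {i j : I} {a v : V}
    (h : D.IsForget D.root i j a) :
    β v = j ↔ N.graph.closedNbhd v ⊆ D.bag j ∧ a ∈ N.graph.closedNbhd v := by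
  obtain ⟨i', a', h', ha'⟩ := hβ.2 v
  constructor
  · intro e
    rw [← D.isForget_vertex_unique h' h e, ← e]
    exact ⟨hβ.1 v, ha'⟩
  · rintro ⟨h1, h2⟩
    exact D.isForget_clique_unique h' ha' (hβ.1 v) h h2 h1

variable {N D} in
theorem IsForgetAssignment.localReward_eq_zero {β : V → I} (hβ : N.IsForgetAssignment D β) {j : I}
    (h : ∀ i a, ¬ D.IsForget D.root i j a) (x : V → Λ) : N.localReward β j x = 0 := by
  classical
  refine Finset.sum_eq_zero fun v hv => ?_
  rw [Finset.mem_filter] at hv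
  obtain ⟨i', a', h', -⟩ := hβ.2 v
  exact absurd (hv.2 ▸ h') (h _ _)

end NAGL

/-! ### A program logic with time bounds. -/

namespace RAM

/-- The state with the word register `x` set to `v`. -/
def State.setReg (s : State) (x v : ℕ) : State := { s with reg := Function.update s.reg x v }

open Classical in
/-- The state with the word cell `a` set to `v`. -/
noncomputable def State.setMem (s : State) (a v : ℕ) : State :=
  { s with mem := Function.update s.mem a v }

/-- The state with the real register `x` set to `v`. -/
def State.setRReg (s : State) (x : ℕ) (v : ℝ) : State :=
  { s with rreg := Function.update s.rreg x v }

open Classical in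
/-- The state with the real cell `a` set to `v`. -/
noncomputable def State.setRMem (s : State) (a : ℕ) (v : ℝ) : State :=
  { s with rmem := Function.update s.rmem a v }

namespace State

variable (s : State) (x y v : ℕ) (r : ℝ)

@[simp] theorem setReg_reg : (s.setReg x v).reg y = if y = x then v else s.reg y := by
  simp [setReg, Function.update_apply]
@[simp] theorem setReg_mem : (s.setReg x v).mem = s.mem := rfl
@[simp] theorem setReg_rreg : (s.setReg x v).rreg = s.rreg := rfl
@[simp] theorem setReg_rmem : (s.setReg x v).rmem = s.rmem := rfl
@[simp] theorem setMem_mem : (s.setMem x v).mem y = if y = x then v else s.mem y := by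
  simp [setMem, Function.update_apply]
@[simp] theorem setMem_reg : (s.setMem x v).reg = s.reg := rfl
@[simp] theorem setMem_rreg : (s.setMem x v).rreg = s.rreg := rfl
@[simp] theorem setMem_rmem : (s.setMem x v).rmem = s.rmem := rfl
@[simp] theorem setRReg_rreg : (s.setRReg x r).rreg y = if y = x then r else s.rreg y := by
  simp [setRReg, Function.update_apply]
@[simp] theorem setRReg_reg : (s.setRReg x r).reg = s.reg := rfl
@[simp] theorem setRReg_mem : (s.setRReg x r).mem = s.mem := rfl
@[simp] theorem setRReg_rmem : (s.setRReg x r).rmem = s.rmem := rfl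
@[simp] theorem setRMem_rmem : (s.setRMem x r).rmem y = if y = x then r else s.rmem y := by
  simp [setRMem, Function.update_apply]
@[simp] theorem setRMem_reg : (s.setRMem x r).reg = s.reg := rfl
@[simp] theorem setRMem_mem : (s.setRMem x r).mem = s.mem := rfl
@[simp] theorem setRMem_rreg : (s.setRMem x r).rreg = s.rreg := rfl

end State

/-- The states have the same word registers below `ℓ`. -/
def State.Agree (ℓ : ℕ) (s s' : State) : Prop := ∀ r < ℓ, s'.reg r = s.reg r

namespace State

variable {ℓ : ℕ} {s s' : State} {x : ℕ}

@[simp] theorem agree_refl : Agree ℓ s s := fun _ _ => rfl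
theorem Agree.trans {s'' : State} (h : Agree ℓ s s') (h' : Agree ℓ s' s'') : Agree ℓ s s'' :=
  fun r hr => (h' r hr).trans (h r hr)
theorem Agree.mono (h : Agree ℓ s s') {k : ℕ} (hk : k ≤ ℓ) : Agree k s s' :=
  fun r hr => h r (hr.trans_le hk)
@[simp] theorem agree_setReg (hx : ℓ ≤ x) {v : ℕ} : Agree ℓ s (s'.setReg x v) ↔ Agree ℓ s s' := by
  refine forall₂_congr fun r hr => ?_
  rw [setReg_reg, if_neg (by omega)]
@[simp] theorem agree_setMem {v : ℕ} : Agree ℓ s (s'.setMem x v) ↔ Agree ℓ s s' := Iff.rfl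
@[simp] theorem agree_setRReg {v : ℝ} : Agree ℓ s (s'.setRReg x v) ↔ Agree ℓ s s' := Iff.rfl
@[simp] theorem agree_setRMem {v : ℝ} : Agree ℓ s (s'.setRMem x v) ↔ Agree ℓ s s' := Iff.rfl

end State

/-- All words of the state are below the word bound, which is large enough for the constants and the
input tables. -/
structure Bounded (E : Environment) (s : State) : Prop where
  const_lt : 4 < E.wordBound
  table_lt : ∀ tab i j, E.table tab i j < E.wordBound
  reg_lt : ∀ x, s.reg x < E.wordBound
  mem_lt : ∀ a, s.mem a < E.wordBound

/-- The part of `Expr.Safe` that does not follow from `Bounded`. -/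
def Expr.Fits (E : Environment) (s : State) : Expr → Prop
  | const c => c ≤ 4
  | reg _ => True
  | load a => a.Fits E s ∧ a.eval E s < E.space
  | read _ i j => i.Fits E s ∧ j.Fits E s
  | add e₁ e₂ => e₁.Fits E s ∧ e₂.Fits E s ∧ e₁.eval E s + e₂.eval E s < E.wordBound
  | sub e₁ e₂ => e₁.Fits E s ∧ e₂.Fits E s
  | mul e₁ e₂ => e₁.Fits E s ∧ e₂.Fits E s ∧ e₁.eval E s * e₂.eval E s < E.wordBound
  | div e₁ e₂ => e₁.Fits E s ∧ e₂.Fits E s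
  | mod e₁ e₂ => e₁.Fits E s ∧ e₂.Fits E s
  | lt e₁ e₂ => e₁.Fits E s ∧ e₂.Fits E s
  | eq e₁ e₂ => e₁.Fits E s ∧ e₂.Fits E s

/-- The part of `RExpr.Safe` that does not follow from `Bounded`. -/
def RExpr.Fits (E : Environment) (s : State) : RExpr → Prop
  | zero => True
  | reg _ => True
  | load a => a.Fits E s ∧ a.eval E s < E.space
  | add r₁ r₂ => r₁.Fits E s ∧ r₂.Fits E s

variable {E : Environment} {s : State}

theorem Expr.Safe.eval_lt {e : Expr} (h : e.Safe E s) : e.eval E s < E.wordBound := by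
  cases e with
  | const c => exact h
  | reg x => exact h
  | load a => exact h.2.2
  | read tab i j => exact h.2.2
  | _ e₁ e₂ => exact h.2.2

/-- Only sums, products, constants and addresses can violate a bound. The other operations yield a
stored word, an input entry, a truth value, or at most their first operand. -/
theorem Expr.Fits.safe (hb : Bounded E s) {e : Expr} (h : e.Fits E s) : e.Safe E s := by
  induction e with
  | const c => exact lt_of_le_of_lt h hb.const_lt
  | reg x => exact hb.reg_lt x
  | load a ih => exact ⟨ih h.1, h.2, hb.mem_lt _⟩
  | read tab i j ih₁ ih₂ => exact ⟨ih₁ h.1, ih₂ h.2, hb.table_lt _ _ _⟩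
  | add e₁ e₂ ih₁ ih₂ => exact ⟨ih₁ h.1, ih₂ h.2.1, h.2.2⟩
  | mul e₁ e₂ ih₁ ih₂ => exact ⟨ih₁ h.1, ih₂ h.2.1, h.2.2⟩
  | sub e₁ e₂ ih₁ ih₂ =>
    exact ⟨ih₁ h.1, ih₂ h.2, (Nat.sub_le _ _).trans_lt (ih₁ h.1).eval_lt⟩
  | div e₁ e₂ ih₁ ih₂ =>
    exact ⟨ih₁ h.1, ih₂ h.2, (Nat.div_le_self _ _).trans_lt (ih₁ h.1).eval_lt⟩
  | mod e₁ e₂ ih₁ ih₂ =>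
    exact ⟨ih₁ h.1, ih₂ h.2, (Nat.mod_le _ _).trans_lt (ih₁ h.1).eval_lt⟩
  | lt e₁ e₂ ih₁ ih₂ =>
    refine ⟨ih₁ h.1, ih₂ h.2, ?_⟩
    have := hb.const_lt
    simp only [eval]; split_ifs <;> omega
  | eq e₁ e₂ ih₁ ih₂ =>
    refine ⟨ih₁ h.1, ih₂ h.2, ?_⟩
    have := hb.const_lt
    simp only [eval]; split_ifs <;> omega

theorem Expr.Fits.eval_lt (hb : Bounded E s) {e : Expr} (h : e.Fits E s) :
    e.eval E s < E.wordBound := (h.safe hb).eval_lt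

theorem RExpr.Fits.safe (hb : Bounded E s) {r : RExpr} (h : r.Fits E s) : r.Safe E s := by
  induction r with
  | zero => trivial
  | reg x => trivial
  | load a => exact ⟨h.1.safe hb, h.2⟩
  | add r₁ r₂ ih₁ ih₂ => exact ⟨ih₁ h.1, ih₂ h.2⟩

theorem Bounded.setReg (hb : Bounded E s) {v : ℕ} (hv : v < E.wordBound) (x : ℕ) :
    Bounded E (s.setReg x v) :=
  ⟨hb.1, hb.2, fun y => by rw [State.setReg_reg]; split_ifs; exacts [hv, hb.3 y], hb.4⟩

theorem Bounded.setMem (hb : Bounded E s) {v : ℕ} (hv : v < E.wordBound) (a : ℕ) :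
    Bounded E (s.setMem a v) :=
  ⟨hb.1, hb.2, hb.3, fun y => by rw [State.setMem_mem]; split_ifs; exacts [hv, hb.4 y]⟩

theorem Bounded.setRReg (hb : Bounded E s) (x : ℕ) (r : ℝ) : Bounded E (s.setRReg x r) :=
  ⟨hb.1, hb.2, hb.3, hb.4⟩

theorem Bounded.setRMem (hb : Bounded E s) (x : ℕ) (r : ℝ) : Bounded E (s.setRMem x r) :=
  ⟨hb.1, hb.2, hb.3, hb.4⟩

/-- Started in the bounded state `s`, the program halts after at most `K` steps in a bounded state that
satisfies `Q`. -/
def Runs (E : Environment) (c : Cmd) (s : State) (K : ℕ) (Q : State → Prop) : Prop :=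
  Bounded E s → ∃ s' k, Exec E c s s' k ∧ k ≤ K ∧ Bounded E s' ∧ Q s'

/-- Started in the bounded state `s`, some iterations of a loop lead, after at most `K` steps, to a
bounded state that satisfies `Q`. -/
def Iterates (E : Environment) (e : Expr) (c : Cmd) (s : State) (K : ℕ) (Q : State → Prop) : Prop :=
  Bounded E s → ∃ s' k, (∀ s'' k', Exec E (.loop e c) s' s'' k' →
    Exec E (.loop e c) s s'' (k + k')) ∧ k ≤ K ∧ Bounded E s' ∧ Q s'

variable {c c₁ c₂ : Cmd} {K K₁ K₂ : ℕ} {P Q : State → Prop}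

namespace Runs

theorem conseq (h : Runs E c s K P) (hPQ : ∀ s', Bounded E s' → P s' → Q s') : Runs E c s K Q :=
  fun hb => by
    obtain ⟨s', k, h1, h2, h3, h4⟩ := h hb
    exact ⟨s', k, h1, h2, h3, hPQ s' h3 h4⟩

theorem mono (h : Runs E c s K P) {K' : ℕ} (hK : K ≤ K') : Runs E c s K' P := fun hb => by
  obtain ⟨s', k, h1, h2, h3, h4⟩ := h hb
  exact ⟨s', k, h1, h2.trans hK, h3, h4⟩

theorem of_bounded (h : Bounded E s → Runs E c s K P) : Runs E c s K P := fun hb => h hb hb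

theorem skip (h : Q s) : Runs E .skip s 1 Q := fun hb => ⟨s, 1, .skip s, le_rfl, hb, h⟩

theorem assign {x : ℕ} {e : Expr} (he : e.Fits E s) (h : Q (s.setReg x (e.eval E s))) :
    Runs E (.assign x e) s (e.cost + 1) Q := fun hb =>
  ⟨_, _, .assign s x e (he.safe hb), le_rfl, hb.setReg (he.eval_lt hb) x, h⟩

theorem store {a e : Expr} (ha : a.Fits E s) (he : e.Fits E s) (hs : a.eval E s < E.space)
    (h : Q (s.setMem (a.eval E s) (e.eval E s))) :
    Runs E (.store a e) s (a.cost + e.cost + 1) Q := fun hb =>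
  ⟨_, _, .store s a e (ha.safe hb) (he.safe hb) hs, le_rfl, hb.setMem (he.eval_lt hb) _, h⟩

theorem rassign {x : ℕ} {r : RExpr} (hr : r.Fits E s) (h : Q (s.setRReg x (r.eval E s))) :
    Runs E (.rassign x r) s (r.cost + 1) Q := fun hb =>
  ⟨_, _, .rassign s x r (hr.safe hb), le_rfl, hb.setRReg _ _, h⟩

theorem rstore {a : Expr} {r : RExpr} (ha : a.Fits E s) (hr : r.Fits E s)
    (hs : a.eval E s < E.space) (h : Q (s.setRMem (a.eval E s) (r.eval E s))) :
    Runs E (.rstore a r) s (a.cost + r.cost + 1) Q := fun hb =>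
  ⟨_, _, .rstore s a r (ha.safe hb) (hr.safe hb) hs, le_rfl, hb.setRMem _ _, h⟩

open Classical in
theorem compare {x : ℕ} {r₁ r₂ : RExpr} (h₁ : r₁.Fits E s) (h₂ : r₂.Fits E s)
    (h : Q (s.setReg x (if r₁.eval E s ≤ r₂.eval E s then 1 else 0))) :
    Runs E (.compare x r₁ r₂) s (r₁.cost + r₂.cost + 1) Q := fun hb =>
  ⟨_, _, .compare s x r₁ r₂ (h₁.safe hb) (h₂.safe hb), le_rfl,
    hb.setReg (by have := hb.const_lt; split_ifs <;> omega) _, h⟩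

/-- The true cost depends on the number of arguments in the current state; `b` replaces it by a
bound that does not. -/
theorem query {x : ℕ} {v a l : Expr} {r : ℝ} (hv : v.Fits E s) (ha : a.Fits E s)
    (hl : l.Fits E s) (hs : ∀ k < l.eval E s, a.eval E s + k < E.space)
    (hr : E.oracle (v.eval E s)
      ((List.range (l.eval E s)).map fun k => s.mem (a.eval E s + k)) r)
    {b : ℕ} (hlb : l.eval E s ≤ b)
    (h : Q (s.setRReg x r)) :
    Runs E (.query x v a l) s (v.cost + a.cost + l.cost + b + 1) Q := fun hb =>
  ⟨_, _, .query s x v a l r (hv.safe hb) (ha.safe hb) (hl.safe hb) hs hr, by omega,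
    hb.setRReg _ _, h⟩

/-- The postcondition of the first program is the specification of the second, so intermediate
states need not be described. -/
theorem seq (h : Runs E c₁ s K₁ fun s' => Runs E c₂ s' K₂ Q) :
    Runs E (.seq c₁ c₂) s (K₁ + K₂) Q := fun hb => by
  obtain ⟨s₁, k₁, h1, h2, h3, h4⟩ := h hb
  obtain ⟨s₂, k₂, h5, h6, h7, h8⟩ := h4 h3
  exact ⟨s₂, _, .seq _ _ _ _ _ _ _ h1 h5, Nat.add_le_add h2 h6, h7, h8⟩

theorem branch {e : Expr} (he : e.Fits E s) (h₁ : e.eval E s ≠ 0 → Runs E c₁ s K₁ Q)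
    (h₂ : e.eval E s = 0 → Runs E c₂ s K₂ Q) :
    Runs E (.branch e c₁ c₂) s (e.cost + 1 + max K₁ K₂) Q := fun hb => by
  by_cases h : e.eval E s = 0
  · obtain ⟨s', k, h3, h4, h5, h6⟩ := h₂ h hb
    exact ⟨s', _, .branchFalse _ _ _ _ _ _ (he.safe hb) h h3, by omega, h5, h6⟩
  · obtain ⟨s', k, h3, h4, h5, h6⟩ := h₁ h hb
    exact ⟨s', _, .branchTrue _ _ _ _ _ _ (he.safe hb) h h3, by omega, h5, h6⟩

end Runs

namespace Iterates

variable {e : Expr}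

theorem refl (h : Q s) : Iterates E e c s 0 Q := fun hb =>
  ⟨s, 0, fun s'' k' h' => by simpa using h', le_rfl, hb, h⟩

theorem step (he : e.Fits E s) (hne : e.eval E s ≠ 0) (h : Runs E c s K Q) :
    Iterates E e c s (e.cost + 1 + K) Q := fun hb => by
  obtain ⟨s', k, h1, h2, h3, h4⟩ := h hb
  exact ⟨s', _, fun s'' k' h' => .loopStep _ _ _ _ _ _ _ (he.safe hb) hne h1 h',
    Nat.add_le_add_left h2 _, h3, h4⟩

/-- The iterations of one loop can thus be cut into segments that match the subtrees of the
decomposition. -/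
theorem bind (h : Iterates E e c s K₁ fun s' => Iterates E e c s' K₂ Q) :
    Iterates E e c s (K₁ + K₂) Q := fun hb => by
  obtain ⟨s₁, k₁, h1, h2, h3, h4⟩ := h hb
  obtain ⟨s₂, k₂, h5, h6, h7, h8⟩ := h4 h3
  exact ⟨s₂, k₁ + k₂, fun s'' k' h' => by rw [add_assoc]; exact h1 _ _ (h5 _ _ h'),
    Nat.add_le_add h2 h6, h7, h8⟩

theorem mono (h : Iterates E e c s K Q) {K' : ℕ} (hK : K ≤ K') : Iterates E e c s K' Q :=
  fun hb => by
    obtain ⟨s', k, h1, h2, h3, h4⟩ := h hb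
    exact ⟨s', k, h1, h2.trans hK, h3, h4⟩

theorem conseq (h : Iterates E e c s K P) (hPQ : ∀ s', Bounded E s' → P s' → Q s') :
    Iterates E e c s K Q := fun hb => by
  obtain ⟨s', k, h1, h2, h3, h4⟩ := h hb
  exact ⟨s', k, h1, h2, h3, hPQ s' h3 h4⟩

theorem runs_loop
    (h : Iterates E e c s K fun s' => e.Fits E s' ∧ e.eval E s' = 0 ∧ Q s') :
    Runs E (.loop e c) s (K + (e.cost + 1)) Q := fun hb => by
  obtain ⟨s', k, h1, h2, h3, h4, h5, h6⟩ := h hb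
  exact ⟨s', _, h1 _ _ (.loopDone _ _ _ (h4.safe h3) h5), by omega, h3, h6⟩

/-- Counted iteration with an invariant. -/
theorem count (K : ℕ → ℕ) {Inv : ℕ → State → Prop} {b : ℕ} (h0 : Inv 0 s)
    (hstep : ∀ k s', k < b → Inv k s' → e.Fits E s' ∧ e.eval E s' ≠ 0 ∧
      Runs E c s' (K k) (Inv (k + 1))) :
    Iterates E e c s (∑ k ∈ Finset.range b, (e.cost + 1 + K k)) (Inv b) := by
  induction b with
  | zero => exact refl h0
  | succ b ih =>
    rw [Finset.sum_range_succ]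
    refine bind (conseq (ih fun k s' hk h => hstep k s' (by omega) h) fun s' _ hs' => ?_)
    obtain ⟨h1, h2, h3⟩ := hstep b s' (by omega) hs'
    exact step h1 h2 h3

end Iterates

namespace Runs

theorem loop_sum (K : ℕ → ℕ) {e : Expr} {Inv : ℕ → State → Prop} {b : ℕ} (h0 : Inv 0 s)
    (hstep : ∀ k s', k < b → Inv k s' → e.Fits E s' ∧ e.eval E s' ≠ 0 ∧
      Runs E c s' (K k) (Inv (k + 1)))
    (hend : ∀ s', Inv b s' → e.Fits E s' ∧ e.eval E s' = 0 ∧ Q s') :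
    Runs E (.loop e c) s (∑ k ∈ Finset.range b, (e.cost + 1 + K k) + (e.cost + 1)) Q :=
  Iterates.runs_loop ((Iterates.count K h0 hstep).conseq fun s' _ h => hend s' h)

theorem loop (K : ℕ) {e : Expr} {Inv : ℕ → State → Prop} {b : ℕ} (h0 : Inv 0 s)
    (hstep : ∀ k s', k < b → Inv k s' → e.Fits E s' ∧ e.eval E s' ≠ 0 ∧
      Runs E c s' K (Inv (k + 1)))
    (hend : ∀ s', Inv b s' → e.Fits E s' ∧ e.eval E s' = 0 ∧ Q s') :
    Runs E (.loop e c) s (b * (e.cost + 1 + K) + (e.cost + 1)) Q := by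
  simpa using loop_sum (fun _ => K) h0 hstep hend

end Runs

/-- The loop that runs `c` for the values `0, …, e - 1` of the register `x`. -/
def Cmd.forLoop (x : ℕ) (e : Expr) (c : Cmd) : Cmd :=
  .seq (.assign x (.const 0))
    (.loop (.lt (.reg x) e) (.seq c (.assign x (.add (.reg x) (.const 1)))))

/-- The cost may vary with the round, which is needed to charge expensive rounds to the reward terms
they add. The bound `e` is evaluated anew in every round, so the invariant must fix its value. The
constant 7 is 3 for the test and 4 for the increment. -/
theorem Runs.forLoop_sum (K : ℕ → ℕ) {x : ℕ} {e : Expr} {Inv : ℕ → State → Prop} {b : ℕ}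
    (h0 : Inv 0 (s.setReg x 0))
    (he : ∀ k s', Inv k s' → e.Fits E s' ∧ e.eval E s' = b)
    (hstep : ∀ k s', k < b → s'.reg x = k → Inv k s' →
      Runs E c s' (K k) fun s'' => s''.reg x = k ∧ Inv (k + 1) (s''.setReg x (k + 1)))
    (hend : ∀ s', s'.reg x = b → Inv b s' → Q s') :
    Runs E (.forLoop x e c) s (∑ k ∈ Finset.range b, (e.cost + 7 + K k) + (e.cost + 5)) Q := by
  have key : Runs E (.forLoop x e c) s
      (2 + (∑ k ∈ Finset.range b, (e.cost + 2 + 1 + (K k + 4)) + (e.cost + 2 + 1))) Q := by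
    refine Runs.seq (Runs.assign (by simp [Expr.Fits]) ?_)
    have hc : (Expr.lt (.reg x) e).cost = e.cost + 2 := by simp [Expr.cost]; omega
    rw [← hc]
    refine Runs.loop_sum _ (Inv := fun k s' => s'.reg x = k ∧ Inv k s') ⟨by simp [Expr.eval], h0⟩
      ?_ ?_
    · rintro k s' hk ⟨hx, hI⟩
      obtain ⟨h1, h2⟩ := he k s' hI
      refine ⟨⟨trivial, h1⟩, by simp [Expr.eval, h2, hx, hk], ?_⟩
      refine Runs.of_bounded fun hb => Runs.seq ((hstep k s' hk hx hI).conseq ?_)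
      rintro s'' hb'' ⟨h3, h4⟩
      have := h1.eval_lt hb
      have hf : (Expr.add (.reg x) (.const 1)).Fits E s'' :=
        ⟨trivial, by simp [Expr.Fits], by simp only [Expr.eval, h3]; omega⟩
      refine Runs.assign hf ?_
      simp only [Expr.eval, h3]
      exact ⟨by simp, h4⟩
    · rintro s' ⟨hx, hI⟩
      obtain ⟨h1, h2⟩ := he b s' hI
      exact ⟨⟨trivial, h1⟩, by simp [Expr.eval, h2, hx], hend s' hx hI⟩
  refine key.mono ?_
  have : ∀ k, e.cost + 2 + 1 + (K k + 4) = e.cost + 7 + K k := fun k => by ring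
  simp only [this]; omega

theorem Runs.forLoop (K : ℕ) {x : ℕ} {e : Expr} {Inv : ℕ → State → Prop} {b : ℕ}
    (h0 : Inv 0 (s.setReg x 0))
    (he : ∀ k s', Inv k s' → e.Fits E s' ∧ e.eval E s' = b)
    (hstep : ∀ k s', k < b → s'.reg x = k → Inv k s' →
      Runs E c s' K fun s'' => s''.reg x = k ∧ Inv (k + 1) (s''.setReg x (k + 1)))
    (hend : ∀ s', s'.reg x = b → Inv b s' → Q s') :
    Runs E (.forLoop x e c) s (b * (e.cost + 7 + K) + (e.cost + 5)) Q := by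
  simpa using Runs.forLoop_sum (fun _ => K) h0 he hstep hend

end RAM

/-! ## Positions in increasing lists and mixed digits -/

namespace Finset

/-- The number of elements of `X` below `v`. -/
def position {q : ℕ} (X : Finset (Fin q)) (v : Fin q) : ℕ := (X.filter (· < v)).card

/-- The entry `k` of the increasing list of the elements of `X`, and `0` if there is none. -/
def entry {q : ℕ} (X : Finset (Fin q)) (k : ℕ) : ℕ :=
  ((X.sort (· ≤ ·)).map Fin.val).getD k 0

variable {q : ℕ} {X : Finset (Fin q)}

theorem entry_eq_orderEmbOfFin {k : ℕ} (hk : k < X.card) :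
    X.entry k = X.orderEmbOfFin rfl ⟨k, hk⟩ := by
  rw [entry, Finset.orderEmbOfFin_apply, List.getD_eq_getElem _ _ (by simpa using hk)]
  simp

theorem position_orderEmbOfFin (k : Fin X.card) : X.position (X.orderEmbOfFin rfl k) = k := by
  have : X.filter (· < X.orderEmbOfFin rfl k) =
      (Finset.Iio k).map (X.orderEmbOfFin rfl).toEmbedding := by
    ext v
    simp only [Finset.mem_filter, Finset.mem_map, Finset.mem_Iio, RelEmbedding.coe_toEmbedding]
    constructor
    · rintro ⟨hv, hlt⟩
      have : v ∈ Set.range (X.orderEmbOfFin rfl) := by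
        rw [Finset.range_orderEmbOfFin]; exact hv
      obtain ⟨k', rfl⟩ := this
      exact ⟨k', (OrderEmbedding.lt_iff_lt _).1 hlt, rfl⟩
    · rintro ⟨k', hk', rfl⟩
      exact ⟨Finset.orderEmbOfFin_mem _ _ _, (OrderEmbedding.lt_iff_lt _).2 hk'⟩
  rw [position, this, Finset.card_map, Fin.card_Iio]

theorem exists_entry_eq {k : ℕ} (hk : k < X.card) :
    ∃ v ∈ X, X.entry k = v ∧ X.position v = k :=
  ⟨_, Finset.orderEmbOfFin_mem _ rfl ⟨k, hk⟩, entry_eq_orderEmbOfFin hk,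
    position_orderEmbOfFin ⟨k, hk⟩⟩

theorem position_lt_card {v : Fin q} (hv : v ∈ X) : X.position v < X.card :=
  Finset.card_lt_card ⟨Finset.filter_subset _ _, fun h => by
    have := h hv; simp at this⟩

theorem position_le_card (v : Fin q) : X.position v ≤ X.card :=
  Finset.card_le_card (Finset.filter_subset _ _)

theorem entry_position {v : Fin q} (hv : v ∈ X) : X.entry (X.position v) = v := by
  have : v ∈ Set.range (X.orderEmbOfFin rfl) := by
    rw [Finset.range_orderEmbOfFin]; exact hv
  obtain ⟨k, rfl⟩ := this
  rw [position_orderEmbOfFin, entry_eq_orderEmbOfFin k.2]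

theorem position_lt_position_iff {u v : Fin q} (hu : u ∈ X) :
    X.position u < X.position v ↔ u < v := by
  constructor
  · intro h
    by_contra hle
    refine absurd h (not_lt.2 (Finset.card_le_card fun w hw => ?_))
    rw [Finset.mem_filter] at hw ⊢
    exact ⟨hw.1, hw.2.trans_le (not_lt.1 hle)⟩
  · intro h
    refine Finset.card_lt_card ⟨fun w hw => ?_, fun h' => ?_⟩
    · rw [Finset.mem_filter] at hw ⊢
      exact ⟨hw.1, hw.2.trans h⟩
    · have := h' (Finset.mem_filter.2 ⟨hu, h⟩); simp at this

theorem position_insert_self {a : Fin q} : (insert a X).position a = X.position a := by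
  rw [position, Finset.filter_insert, if_neg (lt_irrefl a)]; rfl

theorem position_insert {a u : Fin q} (ha : a ∉ X) (hu : u ∈ X) :
    (insert a X).position u =
      if X.position u < X.position a then X.position u else X.position u + 1 := by
  have hne : u ≠ a := by rintro rfl; exact ha hu
  have key := position_lt_position_iff (v := a) hu
  rw [position, Finset.filter_insert]
  split_ifs with h1 h2 h2 <;> rw [key] at h2
  · exact absurd h1 h2.asymm
  · rw [Finset.card_insert_of_notMem (by simp [ha])]; rfl
  · rfl
  · exact absurd (lt_of_le_of_ne (not_lt.1 h1) hne) h2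

/-- Inserting `a` only changes the list from the position of `a` on. Hence the place where the bags
of a node and its child differ is the first position at which their lists differ. -/
theorem entry_insert_of_lt {a : Fin q} (ha : a ∉ X) {k : ℕ} (hk : k < X.position a) :
    (insert a X).entry k = X.entry k := by
  have hk' : k < X.card := hk.trans_le (position_le_card a)
  obtain ⟨v, hv, h1, h2⟩ := exists_entry_eq hk'
  rw [h1]
  have := position_insert ha hv
  rw [if_pos (by omega), h2] at this
  rw [← this, entry_position (Finset.mem_insert_of_mem hv)]

theorem entry_insert_position {a : Fin q} :
    (insert a X).entry (X.position a) = a := by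
  rw [← position_insert_self, entry_position (Finset.mem_insert_self a X)]

theorem entry_position_ne {a : Fin q} (ha : a ∉ X) (h : X.position a < X.card) :
    X.entry (X.position a) ≠ a := by
  obtain ⟨v, hv, h1, -⟩ := exists_entry_eq h
  rw [h1]
  intro h'
  rw [Fin.val_injective h'] at hv
  exact ha hv

/-- This is the induction step for loops that run through a set in increasing order. -/
theorem position_lt_succ_iff {u v : Fin q} (hu : u ∈ X) (hv : v ∈ X) :
    X.position u < X.position v + 1 ↔ X.position u < X.position v ∨ u = v := by
  rw [Nat.lt_succ_iff_lt_or_eq]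
  refine or_congr_right ⟨fun h => ?_, fun h => by rw [h]⟩
  apply Fin.val_injective
  rw [← entry_position hu, ← entry_position hv, h]

end Finset

/-- In the numeral with low part `lo` of `p` digits and high part `hi`, a digit comes from one part
or the other. -/
theorem Nat.mul_pow_add_div_mod {L p lo : ℕ} (hL : 0 < L) (hlo : lo < L ^ p) (hi s : ℕ) :
    (hi * L ^ p + lo) / L ^ s % L =
      if s < p then lo / L ^ s % L else hi / L ^ (s - p) % L := by
  split_ifs with h
  · obtain ⟨d, rfl⟩ := Nat.exists_eq_add_of_lt h
    have : hi * L ^ (s + d + 1) + lo = L ^ s * (L * (hi * L ^ d)) + lo := by ring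
    rw [this, Nat.mul_add_div (by positivity), Nat.mul_add_mod]
  · obtain ⟨d, rfl⟩ := Nat.exists_eq_add_of_le (not_lt.1 h)
    rw [pow_add, ← Nat.div_div_eq_div_mul, mul_comm hi, Nat.mul_add_div (by positivity),
      Nat.div_eq_of_lt hlo, add_zero]
    simp

theorem Nat.div_pow_mod_eq {L : ℕ} (hL : 0 < L) (p idx s : ℕ) :
    idx / L ^ s % L =
      if s < p then idx % L ^ p / L ^ s % L else idx / L ^ p / L ^ (s - p) % L := by
  rw [← Nat.mul_pow_add_div_mod hL (Nat.mod_lt _ (by positivity)), Nat.div_add_mod']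

/-- The index in which the digit `c` of base `R` replaces the digit of base `Q / P` at place `P`. -/
def Nat.redigit (P Q R idx c : ℕ) : ℕ := (idx / Q * R + c) * P + idx % P

theorem Nat.redigit_lt_of_insert {L p q idx c : ℕ} (hp : p ≤ q) (hidx : idx < L ^ q) (hc : c < L) :
    Nat.redigit (L ^ p) (L ^ p) L idx c < L ^ (q + 1) := by
  obtain ⟨d, rfl⟩ := Nat.exists_eq_add_of_le hp
  have hL : 0 < L := by omega
  have h1 : idx / L ^ p < L ^ d := by
    rw [Nat.div_lt_iff_lt_mul (by positivity), mul_comm, ← pow_add]; exact hidx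
  have h2 : idx % L ^ p < L ^ p := Nat.mod_lt _ (by positivity)
  have h3 : idx / L ^ p * L + c + 1 ≤ L ^ d * L := by nlinarith
  calc (idx / L ^ p * L + c) * L ^ p + idx % L ^ p
      < (idx / L ^ p * L + c + 1) * L ^ p := by nlinarith
    _ ≤ L ^ d * L * L ^ p := Nat.mul_le_mul_right _ h3
    _ = L ^ (p + d + 1) := by ring

theorem Nat.redigit_lt_of_erase {L p q idx : ℕ} (hL : 0 < L) (hp : p ≤ q)
    (hidx : idx < L ^ (q + 1)) : Nat.redigit (L ^ p) (L ^ p * L) 1 idx 0 < L ^ q := by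
  obtain ⟨d, rfl⟩ := Nat.exists_eq_add_of_le hp
  have h1 : idx / (L ^ p * L) < L ^ d := by
    rw [Nat.div_lt_iff_lt_mul (by positivity)]
    calc idx < _ := hidx
      _ = _ := by ring
  have h2 : idx % L ^ p < L ^ p := Nat.mod_lt _ (by positivity)
  calc (idx / (L ^ p * L) * 1 + 0) * L ^ p + idx % L ^ p
      < (idx / (L ^ p * L) + 1) * L ^ p := by nlinarith
    _ ≤ L ^ d * L ^ p := Nat.mul_le_mul_right _ h1
    _ = L ^ (p + d) := by ring

theorem Nat.redigit_self (P idx : ℕ) : Nat.redigit P P 1 idx 0 = idx := by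
  simp [Nat.redigit, Nat.div_add_mod']

/-! ### Labelings of bags as numerals in base `L`, and the passage from a node to its child. -/

namespace NAGL

/-- The labeling whose labels on `X` are the digits of `idx` in base `L`. -/
def decode {n L : ℕ} [NeZero L] (X : Finset (Fin n)) (idx : ℕ) : Fin n → Fin L :=
  fun v => Fin.ofNat L (idx / L ^ X.position v)

variable {n L m : ℕ} [NeZero L]

theorem decode_val (X : Finset (Fin n)) (idx : ℕ) (v : Fin n) :
    (decode (L := L) X idx v : ℕ) = idx / L ^ X.position v % L := rfl

theorem decode_redigit_of_insert {X : Finset (Fin n)} {a : Fin n} (ha : a ∉ X) (idx : ℕ)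
    (c : Fin L) {u : Fin n} (hu : u ∈ insert a X) :
    decode (insert a X) (Nat.redigit (L ^ X.position a) (L ^ X.position a) L idx c) u =
      Function.update (decode X idx) a c u := by
  have hL : 0 < L := c.pos
  have hlo : idx % L ^ X.position a < L ^ X.position a := Nat.mod_lt _ (by positivity)
  -- Appending the digit `c` to the high part shifts its old digits by one place.
  have happ : ∀ s, (idx / L ^ X.position a * L + c) / L ^ (s + 1) % L =
      idx / L ^ X.position a / L ^ s % L := fun s => by
    have := Nat.mul_pow_add_div_mod (p := 1) hL (lo := c) (by simp) (idx / L ^ X.position a) (s + 1)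
    simpa using this
  apply Fin.ext
  rw [decode_val, Nat.redigit, Nat.mul_pow_add_div_mod hL hlo]
  rcases Finset.mem_insert.1 hu with rfl | hu
  · rw [Finset.position_insert_self]
    simp [Nat.mod_eq_of_lt]
  · have hne : u ≠ a := by rintro rfl; exact ha ‹_›
    rw [Function.update_of_ne hne, decode_val, Nat.div_pow_mod_eq hL (X.position a) idx,
      Finset.position_insert ha hu]
    by_cases h : X.position u < X.position a
    · simp [h]
    · have e : X.position u + 1 - X.position a = X.position u - X.position a + 1 := by omega
      rw [if_neg h, if_neg h, if_neg (by omega), e, happ]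

theorem decode_redigit_of_erase {X : Finset (Fin n)} {a : Fin n} (ha : a ∉ X) (idx : ℕ)
    {u : Fin n} (hu : u ∈ X) :
    decode (L := L) X (Nat.redigit (L ^ X.position a) (L ^ X.position a * L) 1 idx 0) u =
      decode (insert a X) idx u := by
  have hL : 0 < L := Nat.pos_of_neZero L
  have hlo : idx % L ^ X.position a < L ^ X.position a := Nat.mod_lt _ (by positivity)
  apply Fin.ext
  rw [decode_val, decode_val, Nat.redigit, Nat.mul_pow_add_div_mod hL hlo,
    Finset.position_insert ha hu]
  by_cases h : X.position u < X.position a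
  · rw [if_pos h, if_pos h, Nat.div_pow_mod_eq hL (X.position a) idx, if_pos h]
  · obtain ⟨d, hd⟩ := Nat.exists_eq_add_of_le (not_lt.1 h)
    rw [if_neg h, if_neg h, hd, mul_one, add_zero, Nat.add_sub_cancel_left,
      Nat.div_div_eq_div_mul]
    congr 2
    ring

variable {N : NAGL (Fin n) (Fin L)} {D : NiceTreeDecomposition N.graph.square (Fin m)}

/-- How the indices of the table of the node `i` relate to those of its child `j`. -/
structure IsLink (N : NAGL (Fin n) (Fin L)) (D : NiceTreeDecomposition N.graph.square (Fin m))
    (i j : Fin m) (p Q R : ℕ) : Prop where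
  le_left : p ≤ (D.bag i).card
  le_right : p ≤ (D.bag j).card
  entry_eq : ∀ k < p, (D.bag i).entry k = (D.bag j).entry k
  entry_ne : p < (D.bag i).card → p < (D.bag j).card → (D.bag i).entry p ≠ (D.bag j).entry p
  radix_eq : R = if (D.bag i).card < (D.bag j).card then L else 1
  divisor_eq : Q = if (D.bag j).card < (D.bag i).card then L ^ p * L else L ^ p
  divisor_le : Q ≤ L ^ (D.width + 1)
  index_lt : ∀ idx < L ^ (D.width + 1) / R, ∀ c < R,
    Nat.redigit (L ^ p) Q R idx c < L ^ (D.width + 1)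
  le_div : L ^ (D.bag i).card ≤ L ^ (D.width + 1) / R
  child_index_lt : ∀ idx < L ^ (D.bag i).card, ∀ c < R,
    Nat.redigit (L ^ p) Q R idx c < L ^ (D.bag j).card
  decode_eq : ∀ idx < L ^ (D.bag i).card, ∀ c : Fin L, c < R → ∀ u ∈ D.bag j,
    decode (D.bag j) (Nat.redigit (L ^ p) Q R idx c) u =
      N.override D i j c (decode (D.bag i) idx) u
  radix_cases : R = L ∨ R = 1 ∧ D.bag j ⊆ D.bag i
  isForget : (D.bag i).card < (D.bag j).card → ∃ a, D.IsForget D.root i j a ∧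
    (D.bag j).entry p = a ∧ p < (D.bag j).card

theorem exists_isLink {i j : Fin m} (hj : j ∈ D.children D.root i) :
    ∃ p Q R, N.IsLink D i j p Q R := by
  have hL : 0 < L := Nat.pos_of_neZero L
  have hwi := D.card_bag_le_width i
  have hwj := D.card_bag_le_width j
  rcases D.child_cases hj with ⟨a, h⟩ | ⟨a, h⟩ | h
  · have hi : D.bag i = insert a (D.bag j) := by
      ext v; rw [D.isIntroduce_mem_iff h, Finset.mem_insert, or_comm]
    have ha := h.2.1
    have hc : (D.bag i).card = (D.bag j).card + 1 := by
      rw [hi, Finset.card_insert_of_notMem ha]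
    have hp := Finset.position_le_card (X := D.bag j) a
    have hsub : D.bag j ⊆ D.bag i := by rw [hi]; exact Finset.subset_insert _ _
    -- Introduce node: the child's index arises by deleting the digit of `a`, with the single choice
    -- `c = 0`.
    refine ⟨(D.bag j).position a, L ^ (D.bag j).position a * L, 1, ⟨by omega, hp, ?_, ?_, ?_, ?_,
      ?_, ?_, ?_, ?_, ?_, .inr ⟨rfl, hsub⟩, by omega⟩⟩
    · intro k hk
      rw [hi, Finset.entry_insert_of_lt ha hk]
    · intro _ h2
      rw [hi, Finset.entry_insert_position]
      exact (Finset.entry_position_ne ha h2).symm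
    · rw [if_neg (by omega)]
    · rw [if_pos (by omega)]
    · rw [← pow_succ]
      exact Nat.pow_le_pow_right hL (by omega)
    · intro idx hidx c hc'
      obtain rfl : c = 0 := by omega
      rw [Nat.div_one] at hidx
      exact (Nat.redigit_lt_of_erase hL (by omega) hidx).trans_le
        (Nat.pow_le_pow_right hL (by omega))
    · rw [Nat.div_one]; exact Nat.pow_le_pow_right hL hwi
    · intro idx hidx c hc'
      obtain rfl : c = 0 := by omega
      rw [hc] at hidx
      exact Nat.redigit_lt_of_erase hL hp hidx
    · intro idx hidx c hc' u hu
      have : (c : ℕ) = 0 := by omega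
      rw [N.override_of_subset D hsub, this, decode_redigit_of_erase ha idx hu, hi]
  · have hi : D.bag j = insert a (D.bag i) := by
      ext v
      rw [Finset.mem_insert, D.isForget_mem_iff h]
      have := h.2.1
      by_cases hv : v = a
      · subst hv; simpa
      · simp [hv]
    have ha : a ∉ D.bag i := fun h' => ((D.isForget_mem_iff h).1 h').2 rfl
    have hc : (D.bag j).card = (D.bag i).card + 1 := by
      rw [hi, Finset.card_insert_of_notMem ha]
    have hp := Finset.position_le_card (X := D.bag i) a
    have hdiv : L ^ (D.width + 1) / L = L ^ D.width := by
      rw [pow_succ, Nat.mul_div_cancel _ hL]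
    -- Forget node: the child's index arises by inserting the digit `c` of `a`, with `L` choices.
    refine ⟨(D.bag i).position a, L ^ (D.bag i).position a, L, ⟨hp, by omega, ?_, ?_, ?_, ?_,
      ?_, ?_, ?_, ?_, ?_, .inl rfl, fun _ => ⟨a, h, ?_, by omega⟩⟩⟩
    · intro k hk
      rw [hi, Finset.entry_insert_of_lt ha hk]
    · intro h1 _
      rw [hi, Finset.entry_insert_position]
      exact Finset.entry_position_ne ha h1
    · rw [if_pos (by omega)]
    · rw [if_neg (by omega)]
    · exact Nat.pow_le_pow_right hL (by omega)
    · intro idx hidx c hc'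
      rw [hdiv] at hidx
      exact Nat.redigit_lt_of_insert (by omega) hidx hc'
    · rw [hdiv]; exact Nat.pow_le_pow_right hL (by omega)
    · intro idx hidx c hc'
      rw [hc]
      exact Nat.redigit_lt_of_insert hp hidx hc'
    · intro idx hidx c hc' u hu
      rw [N.override_of_isForget D h]
      rw [hi] at hu ⊢
      rw [decode_redigit_of_insert ha idx c hu]
      congr
    · rw [hi, Finset.entry_insert_position]
  · have hi := h.1
    -- Join node: the lists never differ, the scan stops at their end, and the index is unchanged.
    refine ⟨(D.bag i).card, L ^ (D.bag i).card, 1, ⟨le_rfl, by rw [hi], fun k _ => by rw [hi],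
      fun h' => absurd h' (lt_irrefl _), by rw [hi]; simp, by rw [hi]; simp,
      Nat.pow_le_pow_right hL hwi, ?_, ?_, ?_, ?_, .inr ⟨rfl, by rw [hi]⟩,
      by rw [hi]; intro h'; exact absurd h' (lt_irrefl _)⟩⟩
    · intro idx hidx c hc'
      obtain rfl : c = 0 := by omega
      rw [Nat.div_one] at hidx
      rwa [Nat.redigit_self]
    · rw [Nat.div_one]; exact Nat.pow_le_pow_right hL hwi
    · intro idx hidx c hc'
      obtain rfl : c = 0 := by omega
      rwa [Nat.redigit_self, ← hi]
    · intro idx hidx c hc' u hu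
      have : (c : ℕ) = 0 := by omega
      rw [N.override_of_subset D (by rw [hi]), this, Nat.redigit_self, hi]

/-- The contribution of a child is the maximum over the `R` indices that `Nat.redigit` produces; for
`R = 1` this is a single entry. -/
theorem IsLink.contribution_spec {i j : Fin m} {p Q R : ℕ} (h : N.IsLink D i j p Q R)
    {β : Fin n → Fin m} (hβ : N.IsAssignment D β) {idx : ℕ} (hidx : idx < L ^ (D.bag i).card) :
    (∀ c < R, N.table D β j (decode (D.bag j) (Nat.redigit (L ^ p) Q R idx c)) ≤
        N.contribution D β i j (decode (D.bag i) idx)) ∧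
      ∃ c < R, N.table D β j (decode (D.bag j) (Nat.redigit (L ^ p) Q R idx c)) =
        N.contribution D β i j (decode (D.bag i) idx) := by
  have hL : 0 < L := Nat.pos_of_neZero L
  have hRL : R ≤ L := by rcases h.radix_cases with h | h <;> omega
  have hR : 0 < R := by rcases h.radix_cases with h | h <;> omega
  have key : ∀ c : Fin L, c < R →
      N.table D β j (decode (D.bag j) (Nat.redigit (L ^ p) Q R idx c)) =
        N.table D β j (N.override D i j c (decode (D.bag i) idx)) := fun c hc =>
    N.table_congr D β hβ (h.decode_eq idx hidx c hc)
  refine ⟨fun c hc => ?_, ?_⟩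
  · rw [key ⟨c, by omega⟩ hc]
    exact N.table_override_le_contribution D β i j _ _
  · obtain ⟨c, hc⟩ := exists_eq_ciSup_of_finite
      (f := fun c => N.table D β j (N.override D i j c (decode (D.bag i) idx)))
    rcases h.radix_cases with h' | ⟨h', hs⟩
    · exact ⟨c, by omega, (key c (by omega)).trans hc⟩
    · refine ⟨0, hR, ?_⟩
      rw [key ⟨0, hL⟩ hR, N.override_of_subset D hs, N.contribution_of_subset D β hs]

end NAGL

/-! ## Programs -/

namespace NAGL

open RAM

section Environment

variable {n L m : ℕ} (N : NAGL (Fin n) (Fin L)) (D : NiceTreeDecomposition N.graph.square (Fin m))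
  (S W : ℕ)

theorem row_fin {p q : ℕ} (A : Fin p → Finset (Fin q)) (i : Fin p) :
    row A i = ((A i).sort (· ≤ ·)).map Fin.val := by
  simp [row]

@[simp] theorem environment_space : (N.environment D S W).space = S := rfl
@[simp] theorem environment_wordBound : (N.environment D S W).wordBound = W := rfl
@[simp] theorem environment_oracle : (N.environment D S W).oracle = N.oracle := rfl
@[simp] theorem environment_numVertices (i j : ℕ) :
    (N.environment D S W).table .numVertices i j = n := rfl
@[simp] theorem environment_numLabels (i j : ℕ) :
    (N.environment D S W).table .numLabels i j = L := rfl
@[simp] theorem environment_numNodes (i j : ℕ) :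
    (N.environment D S W).table .numNodes i j = m := rfl
@[simp] theorem environment_rootNode (i j : ℕ) :
    (N.environment D S W).table .rootNode i j = D.root := rfl
@[simp] theorem environment_nbrCount (v : Fin n) (j : ℕ) :
    (N.environment D S W).table .nbrCount v j = (N.graph.closedNbhd v).card := by
  simp [environment, inputTable, row_fin]
@[simp] theorem environment_nbr (v : Fin n) (k : ℕ) :
    (N.environment D S W).table .nbr v k = (N.graph.closedNbhd v).entry k := by
  simp [environment, inputTable, row_fin, Finset.entry]
@[simp] theorem environment_bagCount (i : Fin m) (j : ℕ) :
    (N.environment D S W).table .bagCount i j = (D.bag i).card := by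
  simp [environment, inputTable, row_fin]
@[simp] theorem environment_bagElem (i : Fin m) (k : ℕ) :
    (N.environment D S W).table .bagElem i k = (D.bag i).entry k := by
  simp [environment, inputTable, row_fin, Finset.entry]
@[simp] theorem environment_childCount (i : Fin m) (j : ℕ) :
    (N.environment D S W).table .childCount i j = (D.children D.root i).card := by
  simp [environment, inputTable, row_fin]
@[simp] theorem environment_child (i : Fin m) (k : ℕ) :
    (N.environment D S W).table .child i k = (D.children D.root i).entry k := by
  simp [environment, inputTable, row_fin, Finset.entry]

/-- The resources on which the programs rely; `σ i` is the slot of the table of the node `i`. -/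
structure Room (base : ℕ) (σ : Fin m → ℕ) : Prop where
  two_le : 2 ≤ L
  pos : 0 < n
  four_lt : 4 < W
  space_le : S ≤ W
  -- The stack takes two words per level and the scratch area `2 (t + 1)` words, which is at most
  -- another `2 h`.
  frames : base + 4 * D.height D.root + 12 ≤ S
  pow_lt : L ^ (D.width + 1) < S
  slots : ∀ i, (σ i + 1) * L ^ (D.width + 1) ≤ S

end Environment

/-- The number of labels. -/
def labelsE : Expr := .read .numLabels (.const 0) (.const 0)

/-- The size of the bag of the node in register `i`. -/
def bagCountE (i : ℕ) : Expr := .read .bagCount (.reg i) (.const 0)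

/-- The entry in register `k` of the bag of the node in register `i`. -/
def bagElemE (i k : ℕ) : Expr := .read .bagElem (.reg i) (.reg k)

/-- Find the first position (register 12) at which the bags of the nodes in the registers 8 and 5
differ, and its place value (register 13). -/
def scanCmd : Cmd :=
  .seq (.assign 12 (.const 0)) <| .seq (.assign 13 (.const 1)) <|
    -- The product is a conjunction whose factors are all evaluated. Entries out of range read as
    -- `0`, and a vanishing factor then makes the comparison irrelevant.
    .loop (.mul (.mul (.lt (.reg 12) (bagCountE 8)) (.lt (.reg 12) (bagCountE 5)))
        (.eq (bagElemE 8 12) (bagElemE 5 12)))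
      (.seq (.assign 13 (.mul (.reg 13) labelsE)) (.assign 12 (.add (.reg 12) (.const 1))))

variable {n L m : ℕ} [NeZero L] {N : NAGL (Fin n) (Fin L)}
  {D : NiceTreeDecomposition N.graph.square (Fin m)} {S W base : ℕ} {σ : Fin m → ℕ} {s : State}

theorem Room.bounds (hr : N.Room D S W base σ) : L ^ (D.width + 1) < S ∧ S ≤ W ∧
    base + 4 * D.height D.root + 12 ≤ S ∧ 4 < W ∧ D.width + 1 ≤ D.height D.root ∧ 2 ≤ L :=
  have : Nonempty (Fin n) := ⟨⟨0, hr.pos⟩⟩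
  ⟨hr.pow_lt, hr.space_le, hr.frames, hr.four_lt, D.width_lt_height, hr.two_le⟩

theorem Room.pow_lt_of_le (hr : N.Room D S W base σ) {k : ℕ} (hk : k ≤ D.width + 1) :
    L ^ k < W := by
  obtain ⟨hS, hW, -⟩ := hr.bounds
  have : L ^ k ≤ L ^ (D.width + 1) := Nat.pow_le_pow_right (Nat.pos_of_neZero L) hk
  omega

theorem ite_mul_ite_eq (p q : Prop) [Decidable p] [Decidable q] :
    (if p then 1 else 0) * (if q then 1 else 0) = if p ∧ q then 1 else 0 := by
  split_ifs <;> simp_all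

theorem runs_scan (hr : N.Room D S W base σ) {i j : Fin m} {p Q R : ℕ}
    (hl : N.IsLink D i j p Q R) (h8 : s.reg 8 = i) (h5 : s.reg 5 = j) :
    Runs (N.environment D S W) scanCmd s (40 * (D.width + 2)) fun s' =>
      State.Agree 12 s s' ∧ s'.mem = s.mem ∧ s'.rmem = s.rmem ∧
        s'.reg 12 = p ∧ s'.reg 13 = L ^ p := by
  obtain ⟨hS, hW, hf, h4, hw, hL⟩ := hr.bounds
  have hbi := D.card_bag_le_width i
  have hbj := D.card_bag_le_width j
  have hpi := hl.le_left
  have hpj := hl.le_right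
  refine Runs.mono (Runs.seq (Runs.assign ?_ (Runs.seq (Runs.assign ?_
    (Runs.loop 12 (b := p) (Inv := fun k s' => State.Agree 12 s s' ∧ s'.mem = s.mem ∧
      s'.rmem = s.rmem ∧ s'.reg 12 = k ∧ s'.reg 13 = L ^ k) ?_ ?_ ?_))))) ?_
  · simp [Expr.Fits]
  · simp [Expr.Fits]
  · simp [Expr.eval]
  · rintro k s' hk ⟨i1, i2, i3, i4, i5⟩
    have e8 : s'.reg 8 = i := by rw [i1 8 (by omega), h8]
    have e5 : s'.reg 5 = j := by rw [i1 5 (by omega), h5]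
    refine ⟨?_, ?_, Runs.mono (Runs.seq (Runs.assign ?_ (Runs.assign ?_ ?_))) ?_⟩
    · simp only [Expr.Fits, Expr.eval, bagCountE, bagElemE, e8, e5, ite_mul_ite_eq]
      simp
      constructor <;> split_ifs <;> omega
    · have := hl.entry_eq k hk
      simp [Expr.eval, bagCountE, bagElemE, e8, e5, i4, this]
      omega
    · simp [Expr.Fits, Expr.eval, labelsE, i5]
      rw [← pow_succ]
      exact hr.pow_lt_of_le (by omega)
    · simp [Expr.Fits, Expr.eval, i4]
      omega
    · simp [Expr.eval, labelsE, i1, i2, i3, i4, i5, pow_succ]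
    · simp [Expr.cost, labelsE]
  · rintro s' ⟨i1, i2, i3, i4, i5⟩
    have e8 : s'.reg 8 = i := by rw [i1 8 (by omega), h8]
    have e5 : s'.reg 5 = j := by rw [i1 5 (by omega), h5]
    refine ⟨?_, ?_, i1, i2, i3, i4, i5⟩
    · simp only [Expr.Fits, Expr.eval, bagCountE, bagElemE, e8, e5, ite_mul_ite_eq]
      simp
      constructor <;> split_ifs <;> omega
    · have := hl.entry_ne
      simp [Expr.eval, bagCountE, bagElemE, e8, e5, i4]
      intro h1 h2
      by_contra h3
      exact this (by omega) h2 h1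
  · simp only [Expr.cost, bagCountE, bagElemE]
    have : p ≤ D.width + 1 := by omega
    omega

/-- Find the position (register 28) of the vertex in register 27 in the bag of the node in register 5,
and its place value (register 29). -/
def searchCmd : Cmd :=
  .seq (.assign 28 (.const 0)) <| .seq (.assign 29 (.const 1)) <|
    .loop (.mul (.lt (.reg 28) (bagCountE 5)) (.sub (.const 1) (.eq (bagElemE 5 28) (.reg 27))))
      (.seq (.assign 29 (.mul (.reg 29) labelsE)) (.assign 28 (.add (.reg 28) (.const 1))))

theorem runs_search (hr : N.Room D S W base σ) {j : Fin m} {u : Fin n} (h5 : s.reg 5 = j)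
    (h27 : s.reg 27 = u) :
    Runs (N.environment D S W) searchCmd s (40 * (D.width + 2)) fun s' =>
      State.Agree 28 s s' ∧ s'.mem = s.mem ∧ s'.rmem = s.rmem ∧
        (s'.reg 28 < (D.bag j).card ↔ u ∈ D.bag j) ∧
        (u ∈ D.bag j → s'.reg 29 = L ^ (D.bag j).position u) := by
  obtain ⟨hS, hW, hf, h4, hw, hL⟩ := hr.bounds
  have hbj := D.card_bag_le_width j
  -- The number `q` is where the search stops: the position of `u`, or the end of the list if `u` is
  -- absent.
  obtain ⟨q, hq, hq1, hq2, hq3⟩ : ∃ q ≤ (D.bag j).card, (u ∈ D.bag j → q = (D.bag j).position u) ∧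
      (u ∉ D.bag j → q = (D.bag j).card) ∧ ∀ k < q, (D.bag j).entry k ≠ u := by
    by_cases hu : u ∈ D.bag j
    · refine ⟨_, Finset.position_le_card u, fun _ => rfl, fun h => absurd hu h, fun k hk => ?_⟩
      obtain ⟨w, hw, h1, h2⟩ := Finset.exists_entry_eq (hk.trans (Finset.position_lt_card hu))
      rw [h1]
      intro h
      rw [Fin.val_injective h] at h2
      omega
    · refine ⟨_, le_rfl, fun h => absurd h hu, fun _ => rfl, fun k hk => ?_⟩
      obtain ⟨w, hw, h1, h2⟩ := Finset.exists_entry_eq hk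
      rw [h1]
      intro h
      rw [Fin.val_injective h] at hw
      exact hu hw
  refine Runs.mono (Runs.seq (Runs.assign ?_ (Runs.seq (Runs.assign ?_
    (Runs.loop 12 (b := q) (Inv := fun k s' => State.Agree 28 s s' ∧ s'.mem = s.mem ∧
      s'.rmem = s.rmem ∧ s'.reg 28 = k ∧ s'.reg 29 = L ^ k) ?_ ?_ ?_))))) ?_
  · simp [Expr.Fits]
  · simp [Expr.Fits]
  · simp [Expr.eval]
  · rintro k s' hk ⟨i1, i2, i3, i4, i5⟩
    have e27 : s'.reg 27 = u := by rw [i1 27 (by omega), h27]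
    have e5 : s'.reg 5 = j := by rw [i1 5 (by omega), h5]
    refine ⟨?_, ?_, Runs.mono (Runs.seq (Runs.assign ?_ (Runs.assign ?_ ?_))) ?_⟩
    · simp [Expr.Fits, Expr.eval, bagCountE, bagElemE, e27, e5]
      split_ifs <;> omega
    · simp [Expr.eval, bagCountE, bagElemE, e27, e5, i4, hq3 k hk]
      omega
    · simp [Expr.Fits, Expr.eval, labelsE, i5]
      rw [← pow_succ]
      exact hr.pow_lt_of_le (by omega)
    · simp [Expr.Fits, Expr.eval, i4]
      omega
    · simp [Expr.eval, labelsE, i1, i2, i3, i4, i5, pow_succ]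
    · simp [Expr.cost, labelsE]
  · rintro s' ⟨i1, i2, i3, i4, i5⟩
    have e27 : s'.reg 27 = u := by rw [i1 27 (by omega), h27]
    have e5 : s'.reg 5 = j := by rw [i1 5 (by omega), h5]
    refine ⟨?_, ?_, i1, i2, i3, ?_, ?_⟩
    · simp [Expr.Fits, Expr.eval, bagCountE, bagElemE, e27, e5]
      split_ifs <;> omega
    · simp [Expr.eval, bagCountE, bagElemE, e27, e5, i4]
      by_cases hu : u ∈ D.bag j
      · intro _; rw [hq1 hu, Finset.entry_position hu]; simp
      · intro h; rw [hq2 hu] at h; omega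
    · rw [i4]
      by_cases hu : u ∈ D.bag j
      · simp [hu, hq1 hu, Finset.position_lt_card hu]
      · simp [hu, hq2 hu]
    · intro hu
      rw [i5, hq1 hu]
  · simp only [Expr.cost, bagCountE, bagElemE]
    have : q ≤ D.width + 1 := by omega
    omega

end NAGL

/-! ### Testing the scope of a reward term and adding it to a table. -/

namespace NAGL

open RAM

variable {n L m : ℕ} [NeZero L] {N : NAGL (Fin n) (Fin L)}
  {D : NiceTreeDecomposition N.graph.square (Fin m)} {S W base : ℕ} {σ : Fin m → ℕ} {s : State}

/-- The size of the closed neighbourhood of the vertex in register `v`. -/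
def nbrCountE (v : ℕ) : Expr := .read .nbrCount (.reg v) (.const 0)

/-- For the vertex in register 23, test whether its closed neighbourhood is contained in the bag of
the node in register 5 (register 24) and contains the vertex in register 21 (register 25), and store
the place values of the neighbours from the address in register 4 on. -/
def checkCmd : Cmd :=
  .seq (.assign 24 (.const 1)) <| .seq (.assign 25 (.const 0)) <|
    .forLoop 26 (nbrCountE 23) <|
      .seq (.assign 27 (.read .nbr (.reg 23) (.reg 26))) <| .seq searchCmd <|
        .seq (.assign 24 (.mul (.reg 24) (.lt (.reg 28) (bagCountE 5)))) <|
          .seq (.assign 25 (.add (.reg 25) (.eq (.reg 27) (.reg 21)))) <|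
            .store (.add (.reg 4) (.reg 26)) (.reg 29)

/-- There are at most `t + 1` searches of linear cost, hence the quadratic bound. Register 24 is a
product of truth values and register 25 a count; only whether they vanish matters, and their bounds
keep the product a word. -/
theorem runs_check (hr : N.Room D S W base σ) {j : Fin m} {v a : Fin n} {A : ℕ}
    (hv : (N.graph.closedNbhd v).card ≤ D.width + 1)
    (h4 : s.reg 4 = A) (h5 : s.reg 5 = j) (h21 : s.reg 21 = a) (h23 : s.reg 23 = v)
    (hA : A + D.width + 1 < S) :
    Runs (N.environment D S W) checkCmd s (100 * (D.width + 2) ^ 2) fun s' =>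
      State.Agree 24 s s' ∧ s'.rmem = s.rmem ∧ (∀ x < A, s'.mem x = s.mem x) ∧
        s'.reg 24 ≤ 1 ∧ s'.reg 25 ≤ D.width + 1 ∧
        (s'.reg 24 ≠ 0 ↔ N.graph.closedNbhd v ⊆ D.bag j) ∧
        (s'.reg 25 ≠ 0 ↔ a ∈ N.graph.closedNbhd v) ∧
        ∀ u ∈ N.graph.closedNbhd v, u ∈ D.bag j →
          s'.mem (A + (N.graph.closedNbhd v).position u) = L ^ (D.bag j).position u := by
  obtain ⟨hS, hW, hf, hW4, hw, hL⟩ := hr.bounds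
  set X := N.graph.closedNbhd v with hX
  refine Runs.mono (Runs.seq (Runs.assign ?_ (Runs.seq (Runs.assign ?_
    (Runs.forLoop (40 * (D.width + 2) + 40) (b := X.card)
      (Inv := fun k s' => State.Agree 24 s s' ∧ s'.rmem = s.rmem ∧ (∀ x < A, s'.mem x = s.mem x) ∧
        s'.reg 24 ≤ 1 ∧ s'.reg 25 ≤ k ∧ (s'.reg 24 ≠ 0 ↔ ∀ u ∈ X, X.position u < k → u ∈ D.bag j) ∧
        (s'.reg 25 ≠ 0 ↔ ∃ u ∈ X, X.position u < k ∧ u = a) ∧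
        ∀ u ∈ X, X.position u < k → u ∈ D.bag j →
          s'.mem (A + X.position u) = L ^ (D.bag j).position u) ?_ ?_ ?_ ?_))))) ?_
  · simp [Expr.Fits]
  · simp [Expr.Fits]
  · simp [Expr.eval]
  · rintro k s' ⟨i1, -⟩
    have e23 : s'.reg 23 = v := by rw [i1 23 (by omega), h23]
    simp [Expr.Fits, Expr.eval, nbrCountE, e23, hX]
  · rintro k s' hk hk26 ⟨i1, i2, i3, i4, i5, i6, i7, i8⟩
    have e23 : s'.reg 23 = v := by rw [i1 23 (by omega), h23]
    obtain ⟨w, hw1, hw2, hw3⟩ := Finset.exists_entry_eq hk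
    have hlt : ∀ u ∈ X, X.position u < k + 1 ↔ X.position u < k ∨ u = w := fun u hu => by
      rw [← hw3]; exact Finset.position_lt_succ_iff hu hw1
    refine Runs.mono (Runs.seq (Runs.assign ?_ (Runs.seq (K₂ := 30)
      ((runs_search (u := w) (j := j) hr ?_ ?_).conseq ?_)))) ?_
    · simp [Expr.Fits]
    · simp [i1 5 (by omega), h5]
    · simp [Expr.eval, e23, hk26, ← hX, hw2]
    · rintro s'' - ⟨j1, j2, j3, j4, j5⟩
      have f26 : s''.reg 26 = k := by rw [j1 26 (by omega)]; simpa using hk26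
      have f27 : s''.reg 27 = w := by
        rw [j1 27 (by omega)]; simp [Expr.eval, e23, hk26, ← hX, hw2]
      have f4 : s''.reg 4 = A := by rw [j1 4 (by omega)]; simp [i1 4 (by omega), h4]
      have f5 : s''.reg 5 = j := by rw [j1 5 (by omega)]; simp [i1 5 (by omega), h5]
      have f21 : s''.reg 21 = a := by rw [j1 21 (by omega)]; simp [i1 21 (by omega), h21]
      have f24 : s''.reg 24 = s'.reg 24 := by rw [j1 24 (by omega)]; simp
      have f25 : s''.reg 25 = s'.reg 25 := by rw [j1 25 (by omega)]; simp
      refine Runs.mono (Runs.seq (Runs.assign ?_ (Runs.seq (Runs.assign ?_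
        (Runs.store ?_ ?_ ?_ ?_))))) ?_
      · simp [Expr.Fits, Expr.eval, bagCountE, f5, f24]
        split_ifs <;> omega
      · simp [Expr.Fits, Expr.eval, f25, f27, f21]
        split_ifs <;> omega
      · simp [Expr.Fits, Expr.eval, f4, f26]
        omega
      · simp [Expr.Fits]
      · simp [Expr.eval, f4, f26]
        omega
      · have g1 : State.Agree 24 s s'' := (by simpa using i1 : State.Agree 24 s _).trans
          (j1.mono (by omega))
        simp only [Expr.eval, bagCountE, f4, f5, f21, f24, f25, f26, f27, State.setMem_reg,
          State.setReg_reg, State.setMem_mem, State.setReg_mem, j2, environment_bagCount,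
          State.setReg_rmem, State.setMem_rmem, j3, j4, Nat.reduceEqDiff, reduceIte]
        refine ⟨by simp, by simpa using g1, i2, fun x hx => ?_, ?_, ?_, ?_, ?_, ?_⟩
        · rw [if_neg (by omega)]
          exact i3 x hx
        · simp; split_ifs <;> omega
        · split_ifs <;> omega
        · rw [mul_ne_zero_iff, i6]
          constructor
          · rintro ⟨h1, h2⟩ u hu huk
            rcases (hlt u hu).1 huk with h | rfl
            · exact h1 u hu h
            · simpa using h2
          · intro h
            exact ⟨fun u hu huk => h u hu (by omega), by simpa using h w hw1 (by omega)⟩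
        · have e : ∀ x y : ℕ, x + y ≠ 0 ↔ x ≠ 0 ∨ y ≠ 0 := by omega
          have e' : (if (w : ℕ) = a then 1 else 0) ≠ 0 ↔ w = a := by simp [Fin.val_inj]
          rw [e, i7, e']
          constructor
          · rintro (⟨u, hu, huk, rfl⟩ | rfl)
            · exact ⟨u, hu, by omega, rfl⟩
            · exact ⟨w, hw1, by omega, rfl⟩
          · rintro ⟨u, hu, huk, rfl⟩
            rcases (hlt u hu).1 huk with h | rfl
            · exact .inl ⟨u, hu, h, rfl⟩
            · exact .inr rfl
        · intro u hu huk huj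
          rcases (hlt u hu).1 huk with h | rfl
          · rw [if_neg (by omega)]
            exact i8 u hu h huj
          · rw [hw3, if_pos rfl]
            simpa using j5 huj
      · simp [Expr.cost, bagCountE]
    · simp [Expr.cost]
      omega
  · rintro s' - ⟨i1, i2, i3, i4, i5, i6, i7, i8⟩
    refine ⟨i1, i2, i3, i4, i5.trans hv, i6.trans ?_, i7.trans ?_, fun u hu huj => ?_⟩
    · exact ⟨fun h u hu => h u hu (Finset.position_lt_card hu), fun h u hu _ => h hu⟩
    · constructor
      · rintro ⟨u, hu, -, rfl⟩; exact hu
      · exact fun h => ⟨a, h, Finset.position_lt_card h, rfl⟩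
    · exact i8 u hu (Finset.position_lt_card hu) huj
  · simp only [Expr.cost, nbrCountE]
    nlinarith

/-- The oracle answers only lists of labels ordered like `N[v]`; knowing the label at the position
of every neighbour is enough. -/
theorem oracle_of_forall {v : Fin n} {f : ℕ → ℕ} {x : Fin n → Fin L}
    (h : ∀ u ∈ N.graph.closedNbhd v, f ((N.graph.closedNbhd v).position u) = x u) :
    N.oracle v ((List.range (N.graph.closedNbhd v).card).map f)
      (N.reward v ((N.graph.closedNbhd v).restrict x)) := by
  refine ⟨v.2, (N.graph.closedNbhd v).restrict x, ?_, rfl⟩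
  refine List.ext_getElem (by simp) fun k h1 h2 => ?_
  have hk : k < (N.graph.closedNbhd v).card := by simpa using h1
  obtain ⟨w, hw, e1, e2⟩ := Finset.exists_entry_eq hk
  rw [Finset.entry, List.getD_eq_getElem _ _ (by simpa using hk)] at e1
  simp only [List.getElem_map, Fin.val_inj] at e1
  simp [e1, ← h w hw, e2]

/-- Store the digits of register 26 at the places of the neighbours of the vertex in register 23. -/
def fillCmd : Cmd :=
  .forLoop 27 (nbrCountE 23) <|
    .store (.add (.add (.reg 4) (nbrCountE 23)) (.reg 27))
      (.mod (.div (.reg 26) (.load (.add (.reg 4) (.reg 27)))) labelsE)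

/-- The place values stored by `checkCmd` give each label by one division, so the arguments of a
query are prepared in linear time. They are written just behind the place values. -/
theorem runs_fill (hr : N.Room D S W base σ) {v : Fin n} {A idx : ℕ}
    (hv : (N.graph.closedNbhd v).card ≤ D.width + 1)
    (h4 : s.reg 4 = A) (h23 : s.reg 23 = v) (h26 : s.reg 26 = idx)
    (hA : A + 2 * (D.width + 1) < S) :
    Runs (N.environment D S W) fillCmd s (40 * (D.width + 2)) fun s' =>
      State.Agree 27 s s' ∧ s'.rmem = s.rmem ∧
        (∀ x < A + (N.graph.closedNbhd v).card, s'.mem x = s.mem x) ∧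
        ∀ k < (N.graph.closedNbhd v).card,
          s'.mem (A + (N.graph.closedNbhd v).card + k) = idx / s.mem (A + k) % L := by
  obtain ⟨hS, hW, hf, hW4, hw, hL⟩ := hr.bounds
  refine Runs.mono (Runs.forLoop 20 (b := (N.graph.closedNbhd v).card)
      (Inv := fun k s' => State.Agree 27 s s' ∧ s'.rmem = s.rmem ∧
        (∀ x < A + (N.graph.closedNbhd v).card, s'.mem x = s.mem x) ∧
        ∀ k' < k, s'.mem (A + (N.graph.closedNbhd v).card + k') = idx / s.mem (A + k') % L)
      ?_ ?_ ?_ ?_) ?_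
  · simp
  · rintro k s' ⟨i1, -⟩
    have e23 : s'.reg 23 = v := by rw [i1 23 (by omega), h23]
    simp [Expr.Fits, Expr.eval, nbrCountE, e23]
  · rintro k s' hk hk27 ⟨i1, i2, i3, i4⟩
    have e23 : s'.reg 23 = v := by rw [i1 23 (by omega), h23]
    have e26 : s'.reg 26 = idx := by rw [i1 26 (by omega), h26]
    have e4 : s'.reg 4 = A := by rw [i1 4 (by omega), h4]
    refine Runs.mono (Runs.store ?_ ?_ ?_ ?_) ?_
    · simp [Expr.Fits, Expr.eval, nbrCountE, e4, e23, hk27]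
      omega
    · simp [Expr.Fits, Expr.eval, e4, hk27, labelsE]
      omega
    · simp [Expr.eval, nbrCountE, e4, e23, hk27]
      omega
    · simp [Expr.eval, nbrCountE, labelsE, e4, e23, e26, hk27, i1, i2]
      refine ⟨fun x hx => ?_, fun k' hk' => ?_⟩
      · rw [if_neg (by omega), i3 x hx]
      · split_ifs with h
        · rw [i3 _ (by omega), h]
        · exact i4 k' (by omega)
    · simp [Expr.cost, nbrCountE, labelsE]
  · rintro s' - ⟨i1, i2, i3, i4⟩
    exact ⟨i1, i2, i3, i4⟩
  · simp only [Expr.cost, nbrCountE]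
    omega

/-- Add the reward of the vertex in register 23 to the table at the address in register 10. -/
def addRewardCmd : Cmd :=
  .forLoop 26 (.reg 0) <| .seq fillCmd <|
    .seq (.query 1 (.reg 23) (.add (.reg 4) (nbrCountE 23)) (nbrCountE 23)) <|
      .rstore (.add (.reg 10) (.reg 26)) (.add (.load (.add (.reg 10) (.reg 26))) (.reg 1))

/-- The loop covers the whole slot, including cells beyond the table of `j`. Digits are reduced
modulo `L`, so the oracle is still asked about genuine labels there. -/
theorem runs_addReward (hr : N.Room D S W base σ) {j : Fin m} {v : Fin n} {A T : ℕ}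
    (hv : N.graph.closedNbhd v ⊆ D.bag j)
    (h0 : s.reg 0 = L ^ (D.width + 1)) (h4 : s.reg 4 = A) (h10 : s.reg 10 = T)
    (h23 : s.reg 23 = v) (hA : A + 2 * (D.width + 1) < S) (hT : T + L ^ (D.width + 1) ≤ S)
    (hm : ∀ u ∈ N.graph.closedNbhd v,
      s.mem (A + (N.graph.closedNbhd v).position u) = L ^ (D.bag j).position u) :
    Runs (N.environment D S W) addRewardCmd s (100 * (D.width + 2) * L ^ (D.width + 1)) fun s' =>
      State.Agree 24 s s' ∧ (∀ x < A, s'.mem x = s.mem x) ∧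
        ∀ x, s'.rmem x = s.rmem x + if T ≤ x ∧ x < T + L ^ (D.width + 1) then
          N.reward v ((N.graph.closedNbhd v).restrict (decode (D.bag j) (x - T))) else 0 := by
  obtain ⟨hS, hW, hf, hW4, hw, hL⟩ := hr.bounds
  have hcard : (N.graph.closedNbhd v).card ≤ D.width + 1 :=
    (Finset.card_le_card hv).trans (D.card_bag_le_width j)
  have hpos : 0 < L ^ (D.width + 1) := by positivity
  refine Runs.mono (Runs.forLoop (40 * (D.width + 2) + (D.width + 30)) (b := L ^ (D.width + 1))
      (Inv := fun k s' => State.Agree 26 s s' ∧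
        (∀ x < A + (N.graph.closedNbhd v).card, s'.mem x = s.mem x) ∧
        ∀ x, s'.rmem x = s.rmem x + if T ≤ x ∧ x < T + k then
          N.reward v ((N.graph.closedNbhd v).restrict (decode (D.bag j) (x - T))) else 0)
      ?_ ?_ ?_ ?_) ?_
  · refine ⟨by simp, fun x _ => by simp, fun x => ?_⟩
    rw [if_neg (by omega)]
    simp
  · rintro k s' ⟨i1, -⟩
    have e0 : s'.reg 0 = L ^ (D.width + 1) := by rw [i1 0 (by omega), h0]
    simp [Expr.Fits, Expr.eval, e0]
  · rintro k s' hk hk26 ⟨i1, i2, i3⟩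
    refine Runs.seq ((runs_fill (A := A) (idx := k) hr hcard (by rw [i1 4 (by omega), h4])
      (by rw [i1 23 (by omega), h23]) hk26 hA).conseq ?_)
    rintro t - ⟨j1, j2, j3, j4⟩
    have e0 : t.reg 0 = L ^ (D.width + 1) := by rw [j1 0 (by omega), i1 0 (by omega), h0]
    have e4 : t.reg 4 = A := by rw [j1 4 (by omega), i1 4 (by omega), h4]
    have e10 : t.reg 10 = T := by rw [j1 10 (by omega), i1 10 (by omega), h10]
    have e23 : t.reg 23 = v := by rw [j1 23 (by omega), i1 23 (by omega), h23]
    have e26 : t.reg 26 = k := by rw [j1 26 (by omega), hk26]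
    refine Runs.mono (Runs.seq (Runs.query (b := D.width + 1)
      (r := N.reward v ((N.graph.closedNbhd v).restrict (decode (D.bag j) k))) ?_ ?_ ?_ ?_ ?_ ?_
      (Runs.rstore ?_ ?_ ?_ ?_))) ?_
    · simp [Expr.Fits]
    · simp [Expr.Fits, Expr.eval, nbrCountE, e4, e23]
      omega
    · simp [Expr.Fits, nbrCountE]
    · simp [Expr.eval, nbrCountE, e4, e23]
      intro k hk
      omega
    · simp only [Expr.eval, nbrCountE, e4, e23, environment_oracle, environment_nbrCount]
      refine oracle_of_forall fun u hu => ?_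
      have hu' := Finset.position_lt_card hu
      rw [j4 _ hu', i2 _ (by omega), hm u hu, decode_val]
    · simp [Expr.eval, nbrCountE, e23, hcard]
    · simp [Expr.Fits, Expr.eval, e10, e26]
      omega
    · simp [RExpr.Fits, Expr.Fits, Expr.eval, e10, e26]
      omega
    · simp [Expr.eval, e10, e26]
      omega
    · simp only [Expr.eval, RExpr.eval, State.setRReg_reg, State.setRReg_rreg, State.setRReg_rmem,
        e10, e26, reduceIte, j2]
      refine ⟨by simpa using e26, by simpa using i1.trans (j1.mono (by omega)), ?_, fun x => ?_⟩
      · intro x hx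
        simp [j3 x hx, i2 x hx]
      · simp only [State.setReg_rmem, State.setRMem_rmem, State.setRReg_rmem, j2]
        split_ifs with h1 h2 h2
        · rw [h1, i3, if_neg (by omega)]
          simp
        · omega
        · rw [i3, if_pos (by omega)]
        · rw [i3, if_neg (by omega)]
    · simp [Expr.cost, RExpr.cost, nbrCountE]
      omega
  · rintro s' - ⟨i1, i2, i3⟩
    exact ⟨i1.mono (by omega), fun x hx => i2 x (by omega), i3⟩
  · simp only [Expr.cost]
    nlinarith

end NAGL

/-! ### All reward terms of a node. -/

namespace NAGL

open RAM

variable {n L m : ℕ} [NeZero L] {N : NAGL (Fin n) (Fin L)}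
  {D : NiceTreeDecomposition N.graph.square (Fin m)} {S W base : ℕ} {σ : Fin m → ℕ} {s : State}

/-- Add all rewards assigned to the node in register 5 to its table. -/
def rewardsCmd : Cmd :=
  .seq (.assign 21 (bagElemE 5 12)) <| .forLoop 22 (bagCountE 5) <|
    .seq (.assign 23 (bagElemE 5 22)) <| .seq checkCmd <|
      .branch (.mul (.reg 24) (.reg 25)) addRewardCmd .skip

open Classical in
/-- The number of reward terms assigned to the node `j`. -/
noncomputable def load (β : Fin n → Fin m) (j : Fin m) : ℕ :=
  (Finset.univ.filter fun v => β v = j).card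

/-- Since `v ∈ N[v]`, only vertices of the bag can be assigned to `j`. Each of these at most `t + 1`
candidates costs a quadratic test; a pass over the table is paid only for the terms that belong to
`j`. -/
theorem runs_rewards (hr : N.Room D S W base σ) {β : Fin n → Fin m}
    (hβ : N.IsForgetAssignment D β) {i j : Fin m} {a : Fin n} (hf : D.IsForget D.root i j a)
    {p A T : ℕ} (hp : (D.bag j).entry p = a)
    (h0 : s.reg 0 = L ^ (D.width + 1)) (h4 : s.reg 4 = A) (h5 : s.reg 5 = j) (h10 : s.reg 10 = T)
    (h12 : s.reg 12 = p) (hA : A + 2 * (D.width + 1) < S) (hT : T + L ^ (D.width + 1) ≤ S) :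
    Runs (N.environment D S W) rewardsCmd s
      (200 * (D.width + 2) ^ 3 + 100 * (D.width + 2) * L ^ (D.width + 1) * load β j) fun s' =>
      State.Agree 21 s s' ∧ (∀ x < A, s'.mem x = s.mem x) ∧
        ∀ x, s'.rmem x = s.rmem x + if T ≤ x ∧ x < T + L ^ (D.width + 1) then
          N.localReward β j (decode (D.bag j) (x - T)) else 0 := by
  classical
  obtain ⟨hS, hW, hfr, hW4, hw, hL⟩ := hr.bounds
  have hbj := D.card_bag_le_width j
  have hpos : 0 < L ^ (D.width + 1) := by positivity
  have hcard : ∀ v, (N.graph.closedNbhd v).card ≤ D.width + 1 := fun v =>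
    (Finset.card_le_card (hβ.1 v)).trans (D.card_bag_le_width _)
  set X := D.bag j with hX
  set c := 100 * (D.width + 2) * L ^ (D.width + 1) with hc
  have hmem : ∀ v, β v = j → v ∈ X := fun v hv =>
    hX ▸ hv ▸ hβ.1 v (self_mem_closedNbhd N.graph v)
  -- A round is charged for the number of assigned vertices at its position, which is zero or one;
  -- these charges add up to the load of `j`.
  have hsum : ∑ q ∈ Finset.range X.card,
      (Finset.univ.filter fun v => β v = j ∧ X.position v = q).card = load β j := by
    have := Finset.card_eq_sum_card_fiberwise (s := Finset.univ.filter fun v => β v = j)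
      (f := X.position) (t := Finset.range X.card) fun v hv => by
        have : β v = j := by simpa using hv
        simpa using Finset.position_lt_card (hmem v this)
    simp only [Finset.filter_filter] at this
    exact this.symm
  refine Runs.mono (Runs.seq (Runs.assign ?_ (Runs.forLoop_sum
      (fun q => 100 * (D.width + 2) ^ 2 + 20 + c *
        (Finset.univ.filter fun v => β v = j ∧ X.position v = q).card) (b := X.card)
      (Inv := fun q s' => State.Agree 21 s s' ∧ s'.reg 21 = a ∧ (∀ x < A, s'.mem x = s.mem x) ∧
        ∀ x, s'.rmem x = s.rmem x + if T ≤ x ∧ x < T + L ^ (D.width + 1) then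
          ∑ v ∈ Finset.univ.filter (fun v => β v = j ∧ X.position v < q),
            N.reward v ((N.graph.closedNbhd v).restrict (decode X (x - T))) else 0)
      ?_ ?_ ?_ ?_))) ?_
  · simp [Expr.Fits, bagElemE]
  · simp [Expr.eval, bagElemE, h5, h12, hp, ← hX]
  · rintro k s' ⟨i1, -⟩
    have e5 : s'.reg 5 = j := by rw [i1 5 (by omega), h5]
    simp [Expr.Fits, Expr.eval, bagCountE, e5, hX]
  · rintro q s' hq hq22 ⟨i1, i2, i3, i4⟩
    have e5 : s'.reg 5 = j := by rw [i1 5 (by omega), h5]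
    obtain ⟨w, hw1, hw2, hw3⟩ := Finset.exists_entry_eq hq
    refine Runs.mono (Runs.seq (Runs.assign ?_ (Runs.seq (K₂ := 10 + c *
      (Finset.univ.filter fun v => β v = j ∧ X.position v = q).card)
      ((runs_check (v := w) (a := a) (j := j) (A := A) hr (hcard w) ?_ ?_ ?_ ?_ ?_).conseq ?_)))) ?_
    · simp [Expr.Fits, bagElemE]
    · simp [i1 4 (by omega), h4]
    · simp [e5]
    · simp [i2]
    · simp [Expr.eval, bagElemE, e5, hq22, ← hX, hw2]
    · omega
    · rintro t - ⟨j1, j2, j3, j4, j5, j6, j7, j8⟩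
      have f0 : t.reg 0 = L ^ (D.width + 1) := by
        rw [j1 0 (by omega)]; simp [i1 0 (by omega), h0]
      have f4 : t.reg 4 = A := by rw [j1 4 (by omega)]; simp [i1 4 (by omega), h4]
      have f10 : t.reg 10 = T := by rw [j1 10 (by omega)]; simp [i1 10 (by omega), h10]
      have f21 : t.reg 21 = a := by rw [j1 21 (by omega)]; simp [i2]
      have f22 : t.reg 22 = q := by rw [j1 22 (by omega)]; simpa using hq22
      have f23 : t.reg 23 = w := by
        rw [j1 23 (by omega)]; simp [Expr.eval, bagElemE, e5, hq22, ← hX, hw2]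
      have g1 : State.Agree 21 s t := i1.trans
        (State.Agree.trans (by simp) (j1.mono (by omega)))
      have hiff : t.reg 24 * t.reg 25 ≠ 0 ↔ β w = j := by
        rw [mul_ne_zero_iff, j6, j7, hβ.eq_iff hf]
      have hset : β w = j → (Finset.univ.filter fun v => β v = j ∧ X.position v < q + 1) =
          insert w (Finset.univ.filter fun v => β v = j ∧ X.position v < q) := fun hw => by
        ext v
        simp only [Finset.mem_filter, Finset.mem_univ, true_and, Finset.mem_insert]
        constructor
        · rintro ⟨h1, h2⟩
          rw [← hw3] at h2
          rcases (Finset.position_lt_succ_iff (hmem v h1) hw1).1 h2 with h | h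
          · exact .inr ⟨h1, by omega⟩
          · exact .inl h
        · rintro (rfl | ⟨h1, h2⟩)
          · exact ⟨hw, by omega⟩
          · exact ⟨h1, by omega⟩
      have hset' : β w ≠ j → (Finset.univ.filter fun v => β v = j ∧ X.position v < q + 1) =
          (Finset.univ.filter fun v => β v = j ∧ X.position v < q) := fun hw => by
        ext v
        simp only [Finset.mem_filter, Finset.mem_univ, true_and]
        refine and_congr_right fun h1 => ⟨fun h2 => ?_, fun h2 => by omega⟩
        rw [← hw3] at h2
        rcases (Finset.position_lt_succ_iff (hmem v h1) hw1).1 h2 with h | h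
        · omega
        · subst h; exact absurd h1 hw
      refine Runs.mono (Runs.branch (K₁ := c *
        (Finset.univ.filter fun v => β v = j ∧ X.position v = q).card) (K₂ := 1) ?_ ?_ ?_) ?_
      · simp [Expr.Fits, Expr.eval]
        calc t.reg 24 * t.reg 25 ≤ 1 * (D.width + 1) := Nat.mul_le_mul j4 j5
          _ < W := by omega
      · intro h
        have hwj := hiff.1 (by simpa [Expr.eval] using h)
        have hsub := ((hβ.eq_iff hf).1 hwj).1
        have hone : 1 ≤ (Finset.univ.filter fun v => β v = j ∧ X.position v = q).card :=
          Finset.card_pos.2 ⟨w, by simp [hwj, hw3]⟩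
        refine ((runs_addReward (j := j) (A := A) (T := T) hr hsub f0 f4 f10 f23 hA hT
          fun u hu => j8 u hu (hsub hu)).conseq ?_).mono ?_
        · rintro t' - ⟨k1, k2, k3⟩
          refine ⟨by rw [k1 22 (by omega), f22], ?_, ?_, ?_, ?_⟩
          · simpa using g1.trans (k1.mono (by omega))
          · simp [k1 21 (by omega), f21]
          · intro x hx
            simp [k2 x hx, j3 x hx, i3 x hx]
          · intro x
            simp only [State.setReg_rmem, k3, j2, i4]
            split_ifs with hx
            · rw [hset hwj, Finset.sum_insert (by simp [hw3])]
              ring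
            · ring
        · rw [← hc]; exact Nat.le_mul_of_pos_right _ hone
      · intro h
        have hwj : β w ≠ j := fun h' => hiff.2 h' (by simpa [Expr.eval] using h)
        refine Runs.skip ⟨f22, by simpa using g1, by simp [f21], ?_, ?_⟩
        · intro x hx
          simp [j3 x hx, i3 x hx]
        · intro x
          simp only [State.setReg_rmem, j2, i4, hset' hwj]
      · simp [Expr.cost]
        omega
    · simp [Expr.cost, bagElemE]
      omega
  · rintro s' - ⟨i1, -, i3, i4⟩
    refine ⟨i1, i3, fun x => ?_⟩
    rw [i4]
    have : (Finset.univ.filter fun v => β v = j ∧ X.position v < X.card) =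
        Finset.univ.filter fun v => β v = j := by
      ext v
      simp only [Finset.mem_filter, Finset.mem_univ, true_and, and_iff_left_iff_imp]
      exact fun h => Finset.position_lt_card (hmem v h)
    rw [this, localReward]
    congr
  · simp only [Expr.cost, bagCountE, bagElemE]
    simp only [Finset.sum_add_distrib, ← Finset.mul_sum, hsum,
      Finset.sum_const, Finset.card_range, smul_eq_mul]
    have : X.card * (100 * (D.width + 2) ^ 2 + 30) ≤
        (D.width + 1) * (100 * (D.width + 2) ^ 2 + 30) := by gcongr
    nlinarith

end NAGL

/-! ### Merging the table of a child into that of its parent. -/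

namespace NAGL

open RAM

variable {n L m : ℕ} [NeZero L] {N : NAGL (Fin n) (Fin L)}
  {D : NiceTreeDecomposition N.graph.square (Fin m)} {S W base : ℕ} {σ : Fin m → ℕ} {s : State}

/-- Take the maximum of the entries of the child's table that belong to the entry in register 16. -/
def maxCmd : Cmd :=
  .seq (.assign 17 (.mod (.reg 16) (.reg 13))) <|
    .seq (.assign 18 (.mul (.div (.reg 16) (.reg 15)) (.reg 14))) <|
      .seq (.rassign 1 (.load (.add (.reg 10) (.add (.mul (.reg 18) (.reg 13)) (.reg 17))))) <|
        .forLoop 19 (.reg 14) <|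
          .seq (.rassign 2 (.load (.add (.reg 10)
            (.add (.mul (.add (.reg 18) (.reg 19)) (.reg 13)) (.reg 17))))) <|
            .seq (.compare 20 (.reg 2) (.reg 1)) <|
              .branch (.reg 20) .skip (.rassign 1 (.reg 2))

theorem runs_max (hr : N.Room D S W base σ) {P Q R T idx : ℕ} (hP : 0 < P) (hR : 0 < R)
    (h10 : s.reg 10 = T) (h13 : s.reg 13 = P) (h14 : s.reg 14 = R) (h15 : s.reg 15 = Q)
    (h16 : s.reg 16 = idx) (hT : T + L ^ (D.width + 1) ≤ S)
    (hlt : ∀ c < R, Nat.redigit P Q R idx c < L ^ (D.width + 1)) :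
    Runs (N.environment D S W) maxCmd s (60 * R + 60) fun s' =>
      State.Agree 17 s s' ∧ s'.mem = s.mem ∧ s'.rmem = s.rmem ∧
        (∀ c < R, s.rmem (T + Nat.redigit P Q R idx c) ≤ s'.rreg 1) ∧
        ∃ c < R, s'.rreg 1 = s.rmem (T + Nat.redigit P Q R idx c) := by
  obtain ⟨hS, hW, hfr, hW4, hw, hL⟩ := hr.bounds
  -- Because `P` is positive, all intermediate values are bounded by the final index and are
  -- therefore words.
  have hlt' : ∀ c < R, idx / Q * R + c < L ^ (D.width + 1) ∧
      (idx / Q * R + c) * P < L ^ (D.width + 1) ∧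
      (idx / Q * R + c) * P + idx % P < L ^ (D.width + 1) := fun c hc => by
    have h1 := hlt c hc
    rw [Nat.redigit] at h1
    have h2 := Nat.le_mul_of_pos_right (idx / Q * R + c) hP
    omega
  have h00 := hlt' 0 hR
  simp only [Nat.add_zero] at h00
  refine Runs.mono (Runs.seq (Runs.assign ?_ (Runs.seq (Runs.assign ?_ (Runs.seq (Runs.rassign ?_
    (Runs.forLoop 30 (b := R) (Inv := fun c s' => State.Agree 17 s s' ∧ s'.mem = s.mem ∧
      s'.rmem = s.rmem ∧ s'.reg 17 = idx % P ∧ s'.reg 18 = idx / Q * R ∧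
      (∀ c' < c, s.rmem (T + Nat.redigit P Q R idx c') ≤ s'.rreg 1) ∧
      ∃ c' < R, s'.rreg 1 = s.rmem (T + Nat.redigit P Q R idx c')) ?_ ?_ ?_ ?_))))))) ?_
  · simp [Expr.Fits]
  · simp [Expr.Fits, Expr.eval, h14, h15, h16]
    omega
  · simp [RExpr.Fits, Expr.Fits, Expr.eval, h10, h13, h14, h15, h16]
    omega
  · simp [Expr.eval, RExpr.eval, h10, h13, h14, h15, h16]
    exact ⟨0, hR, by simp [Nat.redigit]⟩
  · rintro c s' ⟨i1, -⟩
    have e14 : s'.reg 14 = R := by rw [i1 14 (by omega), h14]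
    simp [Expr.Fits, Expr.eval, e14]
  · rintro c s' hc hc19 ⟨i1, i2, i3, i4, i5, i6, i7⟩
    have e10 : s'.reg 10 = T := by rw [i1 10 (by omega), h10]
    have e13 : s'.reg 13 = P := by rw [i1 13 (by omega), h13]
    have hcc := hlt' c hc
    have hval : s'.rmem (T + ((idx / Q * R + c) * P + idx % P)) =
      s.rmem (T + Nat.redigit P Q R idx c) := by rw [i3]; rfl
    refine Runs.mono (Runs.seq (Runs.rassign ?_ (Runs.seq (Runs.compare ?_ ?_
      (Runs.branch ?_ (fun h => Runs.skip ?_) fun h => Runs.rassign ?_ ?_))))) ?_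
    · simp [RExpr.Fits, Expr.Fits, Expr.eval, e10, e13, i4, i5, hc19]
      omega
    · simp [RExpr.Fits]
    · simp [RExpr.Fits]
    · simp [Expr.Fits]
    · have h : s.rmem (T + Nat.redigit P Q R idx c) ≤ s'.rreg 1 := by
        simpa [Expr.eval, RExpr.eval, e10, e13, i4, i5, hc19, hval] using h
      simp [i1, i2, i3, i4, i5, hc19]
      refine ⟨fun c' hc' => ?_, i7⟩
      rcases Nat.lt_or_eq_of_le hc' with h' | rfl
      · exact i6 c' h'
      · exact h
    · simp [RExpr.Fits]
    · have h : s'.rreg 1 < s.rmem (T + Nat.redigit P Q R idx c) := by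
        simpa [Expr.eval, RExpr.eval, e10, e13, i4, i5, hc19, hval] using h
      simp [Expr.eval, RExpr.eval, i1, i2, i3, i4, i5, hc19, e10, e13]
      refine ⟨fun c' hc' => ?_, c, hc, rfl⟩
      rcases Nat.lt_or_eq_of_le hc' with h' | rfl
      · exact (i6 c' h').trans h.le
      · exact le_rfl
    · simp [Expr.cost, RExpr.cost]
  · rintro s' - ⟨i1, i2, i3, i4, i5, i6, i7⟩
    exact ⟨i1, i2, i3, i6, i7⟩
  · simp only [Expr.cost, RExpr.cost]
    omega

/-- Add the contribution of the child to the table at the address in register 9. -/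
def combineCmd : Cmd :=
  .forLoop 16 (.div (.reg 0) (.reg 14)) <| .seq maxCmd <|
    .rstore (.add (.reg 9) (.reg 16)) (.add (.load (.add (.reg 9) (.reg 16))) (.reg 1))

/-- There are `L^(t+1) / R` entries with `R` candidates each, so the cost is `O(L^(t+1))` also at
forget nodes. The slots are disjoint, so the child's entries do not change during the loop. -/
theorem runs_combine (hr : N.Room D S W base σ) {P Q R T T' : ℕ} (hP : 0 < P) (hR : 0 < R)
    (h0 : s.reg 0 = L ^ (D.width + 1)) (h9 : s.reg 9 = T') (h10 : s.reg 10 = T)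
    (h13 : s.reg 13 = P) (h14 : s.reg 14 = R) (h15 : s.reg 15 = Q)
    (hT : T + L ^ (D.width + 1) ≤ S) (hT' : T' + L ^ (D.width + 1) ≤ S)
    (hTT : T + L ^ (D.width + 1) ≤ T' ∨ T' + L ^ (D.width + 1) ≤ T)
    (hlt : ∀ idx < L ^ (D.width + 1) / R, ∀ c < R,
      Nat.redigit P Q R idx c < L ^ (D.width + 1)) :
    Runs (N.environment D S W) combineCmd s (200 * L ^ (D.width + 1)) fun s' =>
      State.Agree 16 s s' ∧ s'.mem = s.mem ∧
        (∀ x, ¬ (T' ≤ x ∧ x < T' + L ^ (D.width + 1)) → s'.rmem x = s.rmem x) ∧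
        ∀ idx < L ^ (D.width + 1) / R, ∃ μ, s'.rmem (T' + idx) = s.rmem (T' + idx) + μ ∧
          (∀ c < R, s.rmem (T + Nat.redigit P Q R idx c) ≤ μ) ∧
          ∃ c < R, μ = s.rmem (T + Nat.redigit P Q R idx c) := by
  obtain ⟨hS, hW, hfr, hW4, hw, hL⟩ := hr.bounds
  have hpos : 0 < L ^ (D.width + 1) := by positivity
  have hdiv : L ^ (D.width + 1) / R ≤ L ^ (D.width + 1) := Nat.div_le_self _ _
  refine Runs.mono (Runs.forLoop (60 * R + 60 + 20) (b := L ^ (D.width + 1) / R)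
    (Inv := fun k s' => State.Agree 16 s s' ∧ s'.mem = s.mem ∧
      (∀ x, ¬ (T' ≤ x ∧ x < T' + k) → s'.rmem x = s.rmem x) ∧
      ∀ idx < k, ∃ μ, s'.rmem (T' + idx) = s.rmem (T' + idx) + μ ∧
        (∀ c < R, s.rmem (T + Nat.redigit P Q R idx c) ≤ μ) ∧
        ∃ c < R, μ = s.rmem (T + Nat.redigit P Q R idx c)) ?_ ?_ ?_ ?_) ?_
  · simp
  · rintro k s' ⟨i1, -⟩
    have e0 : s'.reg 0 = L ^ (D.width + 1) := by rw [i1 0 (by omega), h0]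
    have e14 : s'.reg 14 = R := by rw [i1 14 (by omega), h14]
    simp [Expr.Fits, Expr.eval, e0, e14]
  · rintro k s' hk hk16 ⟨i1, i2, i3, i4⟩
    refine Runs.seq ((runs_max (T := T) hr hP hR (by rw [i1 10 (by omega), h10])
      (by rw [i1 13 (by omega), h13]) (by rw [i1 14 (by omega), h14])
      (by rw [i1 15 (by omega), h15]) hk16 hT (hlt k hk)).conseq ?_)
    rintro t - ⟨j1, j2, j3, j4, j5⟩
    have f9 : t.reg 9 = T' := by rw [j1 9 (by omega), i1 9 (by omega), h9]
    have f16 : t.reg 16 = k := by rw [j1 16 (by omega), hk16]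
    refine Runs.mono (Runs.rstore ?_ ?_ ?_ ?_) ?_
    · simp [Expr.Fits, Expr.eval, f9, f16]
      omega
    · simp [RExpr.Fits, Expr.Fits, Expr.eval, f9, f16]
      omega
    · simp [Expr.eval, f9, f16]
      omega
    · have hsame : ∀ c < R, s'.rmem (T + Nat.redigit P Q R k c) =
          s.rmem (T + Nat.redigit P Q R k c) := fun c hc => by
        have := hlt k hk c hc
        exact i3 _ (by omega)
      simp only [Expr.eval, RExpr.eval, f9, f16, State.setRMem_reg, State.setReg_rmem,
        State.setRMem_rmem, State.setReg_mem, State.setRMem_mem, j3]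
      refine ⟨trivial, by simpa using i1.trans (j1.mono (by omega)), by rw [j2, i2], ?_, ?_⟩
      · intro x hx
        rw [if_neg (by omega)]
        exact i3 x (by omega)
      · intro idx hidx
        rcases Nat.lt_succ_iff_lt_or_eq.1 hidx with h | rfl
        · rw [if_neg (by omega)]
          exact i4 idx h
        · rw [if_pos rfl]
          refine ⟨t.rreg 1, by rw [i3 _ (by omega)], fun c hc => ?_, ?_⟩
          · rw [← hsame c hc]; exact j4 c hc
          · obtain ⟨c, hc, h⟩ := j5
            exact ⟨c, hc, by rw [h, hsame c hc]⟩
    · simp [Expr.cost, RExpr.cost]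
  · rintro s' - ⟨i1, i2, i3, i4⟩
    exact ⟨i1, i2, fun x hx => i3 x (by omega), i4⟩
  · simp only [Expr.cost]
    have h1 : L ^ (D.width + 1) / R * R ≤ L ^ (D.width + 1) := Nat.div_mul_le_self _ _
    nlinarith

/-- Complete the table of the child in register 5 (at the address in register 10), and add its
contribution to the table of the node in register 8 (at the address in register 9). -/
def mergeCmd : Cmd :=
  .seq scanCmd <|
    .seq (.assign 14 (.add (.const 1)
      (.mul (.lt (bagCountE 8) (bagCountE 5)) (.sub labelsE (.const 1))))) <|
      .seq (.assign 15 (.mul (.reg 13) (.add (.const 1)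
        (.mul (.lt (bagCountE 5) (bagCountE 8)) (.sub labelsE (.const 1)))))) <|
        .seq (.branch (.lt (bagCountE 8) (bagCountE 5)) rewardsCmd .skip) combineCmd

/-- The child's table lacks only its own rewards, as `htab` says; they are added before the maximum
is taken. One piece of code serves every type of parent, with `P`, `Q`, `R` found by comparing the
two bags. -/
theorem runs_merge (hr : N.Room D S W base σ) {β : Fin n → Fin m}
    (hβ : N.IsForgetAssignment D β) {i j : Fin m} (hj : j ∈ D.children D.root i) {A T T' : ℕ}
    (h0 : s.reg 0 = L ^ (D.width + 1)) (h4 : s.reg 4 = A) (h5 : s.reg 5 = j) (h8 : s.reg 8 = i)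
    (h9 : s.reg 9 = T') (h10 : s.reg 10 = T) (hA : A + 2 * (D.width + 1) < S)
    (hT : T + L ^ (D.width + 1) ≤ S) (hT' : T' + L ^ (D.width + 1) ≤ S)
    (hTT : T + L ^ (D.width + 1) ≤ T' ∨ T' + L ^ (D.width + 1) ≤ T)
    (htab : ∀ idx < L ^ (D.bag j).card, s.rmem (T + idx) + N.localReward β j (decode (D.bag j) idx) =
      N.table D β j (decode (D.bag j) idx)) :
    Runs (N.environment D S W) mergeCmd s
      (300 * (D.width + 2) ^ 3 + 200 * L ^ (D.width + 1) +
        100 * (D.width + 2) * L ^ (D.width + 1) * load β j) fun s' =>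
      State.Agree 12 s s' ∧ (∀ x < A, s'.mem x = s.mem x) ∧
        (∀ idx < L ^ (D.bag j).card, s'.rmem (T + idx) = N.table D β j (decode (D.bag j) idx)) ∧
        (∀ idx < L ^ (D.bag i).card, s'.rmem (T' + idx) = s.rmem (T' + idx) +
          N.contribution D β i j (decode (D.bag i) idx)) ∧
        ∀ x, ¬ (T ≤ x ∧ x < T + L ^ (D.width + 1)) → ¬ (T' ≤ x ∧ x < T' + L ^ (D.width + 1)) →
          s'.rmem x = s.rmem x := by
  obtain ⟨hS, hW, hfr, hW4, hw, hL⟩ := hr.bounds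
  obtain ⟨p, Q, R, hl⟩ := exists_isLink hj
  have hRL : R ≤ L := by rcases hl.radix_cases with h | h <;> omega
  have hR : 0 < R := by rcases hl.radix_cases with h | h <;> omega
  have hLW : L < W := by simpa using hr.pow_lt_of_le (k := 1) (by omega)
  have hpow : ∀ k, L ^ (D.bag k).card ≤ L ^ (D.width + 1) := fun k =>
    Nat.pow_le_pow_right (by omega) (D.card_bag_le_width k)
  have hQW := hl.divisor_le
  refine Runs.mono (Runs.seq (K₂ := 200 * (D.width + 2) ^ 3 +
    100 * (D.width + 2) * L ^ (D.width + 1) * load β j + 200 * L ^ (D.width + 1) + 60)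
    ((runs_scan hr hl h8 h5).conseq ?_)) ?_
  · rintro t - ⟨i1, i2, i3, i4, i5⟩
    have e5 : t.reg 5 = j := by rw [i1 5 (by omega), h5]
    have e8 : t.reg 8 = i := by rw [i1 8 (by omega), h8]
    have eR : 1 + (if (D.bag i).card < (D.bag j).card then 1 else 0) * (L - 1) = R := by
      rw [hl.radix_eq]; split_ifs <;> omega
    have eQ : L ^ p * (1 + (if (D.bag j).card < (D.bag i).card then 1 else 0) * (L - 1)) = Q := by
      rw [hl.divisor_eq]; split_ifs
      · congr 1; omega
      · simp
    refine Runs.mono (Runs.seq (Runs.assign ?_ (Runs.seq (Runs.assign ?_ (Runs.seq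
      (K₂ := 200 * L ^ (D.width + 1)) (Runs.conseq (P := fun t' => State.Agree 12 s t' ∧
          t'.reg 13 = L ^ p ∧ t'.reg 14 = R ∧ t'.reg 15 = Q ∧ (∀ x < A, t'.mem x = s.mem x) ∧
          (∀ idx < L ^ (D.bag j).card,
            t'.rmem (T + idx) = N.table D β j (decode (D.bag j) idx)) ∧
          ∀ x, ¬ (T ≤ x ∧ x < T + L ^ (D.width + 1)) → t'.rmem x = s.rmem x)
        (Runs.branch (K₁ := 200 * (D.width + 2) ^ 3 +
          100 * (D.width + 2) * L ^ (D.width + 1) * load β j) (K₂ := 1) ?_ ?_ ?_) ?_)))))) ?_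
    · simp [Expr.Fits, Expr.eval, bagCountE, labelsE, e5, e8]
      split_ifs <;> omega
    · simp only [Expr.Fits, Expr.eval, bagCountE, labelsE, e5, e8, State.setReg_reg, i5,
        environment_bagCount, environment_numLabels, Nat.reduceEqDiff, reduceIte, eQ,
        environment_wordBound]
      simp
      split_ifs <;> omega
    · simp [Expr.Fits, bagCountE]
    · intro h
      have hlt : (D.bag i).card < (D.bag j).card := by
        simpa [Expr.eval, bagCountE, e5, e8] using h
      obtain ⟨a, hf, ha, -⟩ := hl.isForget hlt
      refine (runs_rewards (A := A) (T := T) (p := p) hr hβ hf ha ?_ ?_ ?_ ?_ ?_ hA hT).conseq ?_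
      · simp [i1 0 (by omega), h0]
      · simp [i1 4 (by omega), h4]
      · simp [e5]
      · simp [i1 10 (by omega), h10]
      · simp [i4]
      · rintro t' - ⟨j1, j2, j3⟩
        refine ⟨?_, ?_, ?_, ?_, ?_, ?_, ?_⟩
        · exact i1.trans (State.Agree.trans (by simp) (j1.mono (by omega)))
        · simp [j1 13 (by omega), i5]
        · simp [j1 14 (by omega), Expr.eval, bagCountE, labelsE, e5, e8, ← eR]
        · simp [j1 15 (by omega), Expr.eval, bagCountE, labelsE, e5, e8, i5, ← eQ]
        · intro x hx
          simp [j2 x hx, i2]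
        · intro idx hidx
          have := hpow j
          rw [← htab idx hidx, j3, if_pos (by omega)]
          simp [i3]
        · intro x hx
          rw [j3, if_neg hx]
          simp [i3]
    · intro h
      have hlt : ¬ (D.bag i).card < (D.bag j).card := by
        simpa [Expr.eval, bagCountE, e5, e8] using h
      -- Terms are assigned only to children of forget nodes, so here nothing has to be added.
      have hz : ∀ x, N.localReward β j x = 0 := hβ.localReward_eq_zero fun i' a h' => by
        have := D.parent_unique (D.isForget_child h') hj
        subst this
        refine hlt (Finset.card_lt_card ⟨fun v hv => ((D.isForget_mem_iff h').1 hv).1, fun h2 => ?_⟩)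
        exact ((D.isForget_mem_iff h').1 (h2 h'.2.1)).2 rfl
      refine Runs.skip ⟨?_, ?_, ?_, ?_, ?_, ?_, ?_⟩
      · simpa using i1
      · simp [i5]
      · simp [Expr.eval, bagCountE, labelsE, e5, e8, ← eR]
      · simp [Expr.eval, bagCountE, labelsE, e5, e8, i5, ← eQ]
      · simp [i2]
      · intro idx hidx
        rw [← htab idx hidx, hz]
        simp [i3]
      · simp [i3]
    · rintro t' - ⟨j1, j2, j3, j4, j5, j6, j7⟩
      refine (runs_combine (T := T) (T' := T') (P := L ^ p) (Q := Q) (R := R) hr (by positivity) hR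
        ?_ ?_ ?_ j2 j3 j4 hT hT' hTT hl.index_lt).conseq ?_
      · rw [j1 0 (by omega), h0]
      · rw [j1 9 (by omega), h9]
      · rw [j1 10 (by omega), h10]
      · rintro t'' - ⟨k1, k2, k3, k4⟩
        refine ⟨j1.trans (k1.mono (by omega)), fun x hx => by rw [k2, j5 x hx], ?_, ?_, ?_⟩
        · intro idx hidx
          have := hpow j
          rw [k3 _ (by omega), j6 idx hidx]
        · intro idx hidx
          obtain ⟨μ, h1, h2, c, hc, h3⟩ := k4 idx (hidx.trans_le hl.le_div)
          have := hpow i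
          rw [h1, j7 _ (by omega)]
          congr 1
          obtain ⟨hle, c', hc', hatt⟩ := hl.contribution_spec hβ.1 hidx
          apply le_antisymm
          · rw [h3, j6 _ (hl.child_index_lt idx hidx c hc)]
            exact hle c hc
          · rw [← hatt, ← j6 _ (hl.child_index_lt idx hidx c' hc')]
            exact h2 c' hc'
        · intro x h1 h2
          rw [k3 x h2, j7 x h1]
    · simp [Expr.cost, bagCountE, labelsE]
      omega
  · have : 40 * (D.width + 2) + 60 ≤ 100 * (D.width + 2) ^ 3 := by
      nlinarith [sq_nonneg (D.width + 2)]
    omega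

end NAGL

/-! ### The depth-first traversal. -/

namespace NAGL

open RAM

variable {n L m : ℕ} [NeZero L] {N : NAGL (Fin n) (Fin L)}
  {D : NiceTreeDecomposition N.graph.square (Fin m)} {S W base : ℕ} {s : State}

/-- The slot of the table of the node `i`: the node itself if all tables are kept, and its depth on
the stack otherwise. -/
noncomputable def slot (D : NiceTreeDecomposition N.graph.square (Fin m)) (keep : Bool) (i : Fin m) :
    ℕ := bif keep then i else D.depth i + 1

/-- The unfinished table of `i` is safe while the subtree of a child is traversed: with slots by
depth, descendants lie strictly deeper. -/
theorem slot_ne (keep : Bool) {i j k : Fin m} (hj : j ∈ D.children D.root i) (hk : k ∈ D.desc j) :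
    slot D keep k ≠ slot D keep i := by
  have h1 := D.depth_child hj
  have h2 := D.depth_le_of_mem_desc hk
  cases keep
  · simp [slot]; omega
  · simp only [slot, cond_true, ne_eq, Fin.val_inj]
    rintro rfl
    omega

theorem slot_injective : Function.Injective (slot D true) := fun i j h => by
  simpa [slot, Fin.val_inj] using h

theorem slot_disjoint {a b B : ℕ} (h : a ≠ b) : a * B + B ≤ b * B ∨ b * B + B ≤ a * B := by
  rw [← Nat.succ_mul, ← Nat.succ_mul]
  rcases Nat.lt_or_gt_of_ne h with h | h
  · exact .inl (Nat.mul_le_mul_right _ h)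
  · exact .inr (Nat.mul_le_mul_right _ h)

theorem Room.slot_le {σ : Fin m → ℕ} (hr : N.Room D S W base σ) (i : Fin m) :
    σ i * L ^ (D.width + 1) + L ^ (D.width + 1) ≤ S := by
  rw [← Nat.succ_mul]; exact hr.slots i

/-- The number of children of the node in register `i`. -/
def childCountE (i : ℕ) : Expr := .read .childCount (.reg i) (.const 0)

/-- Push the next child of the node in register 5. -/
def pushCmd (keep : Bool) : Cmd :=
  .seq (.store (.add (.reg 4) (.const 1)) (.add (.reg 6) (.const 1))) <|
    .seq (.assign 7 (.read .child (.reg 5) (.reg 6))) <|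
      .seq (.store (.add (.reg 4) (.const 2)) (.reg 7)) <|
        .seq (.store (.add (.reg 4) (.const 3)) (.const 0)) <|
          .seq (.assign 3 (.add (.reg 3) (.const 1))) <|
            .seq (.assign 9 (.mul (bif keep then .reg 7 else .reg 3) (.reg 0))) <|
              .forLoop 10 (.reg 0) (.rstore (.add (.reg 9) (.reg 10)) .zero)

/-- Pop the node in register 5, and merge its table into the table of its parent. -/
def popCmd (keep : Bool) : Cmd :=
  .seq (.assign 3 (.sub (.reg 3) (.const 1))) <|
    .branch (.reg 3)
      (.seq (.assign 8 (.load (.sub (.reg 4) (.const 2)))) <|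
        .seq (.assign 9 (.mul (bif keep then .reg 8 else .reg 3) (.reg 0))) <|
          .seq (.assign 10 (.mul (bif keep then .reg 5 else .add (.reg 3) (.const 1)) (.reg 0)))
            mergeCmd)
      .skip

/-- One step of the depth-first traversal. -/
def traverseCmd (keep : Bool) : Cmd :=
  .seq (.assign 4 (.add (.reg 1) (.mul (.const 2) (.reg 3)))) <|
    .seq (.assign 5 (.load (.reg 4))) <|
      .seq (.assign 6 (.load (.add (.reg 4) (.const 1)))) <|
        .branch (.lt (.reg 6) (childCountE 5)) (pushCmd keep) (popCmd keep)

/-- A frame consists of a node and the number of its children already pushed. The slot of the new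
node is cleared because it may hold the table of a finished node of the same depth. -/
theorem runs_push {keep : Bool} (hr : N.Room D S W base (slot D keep)) {i j : Fin m} {c F : ℕ}
    (hF : F = base + 2 * (D.depth i + 1)) (hj : j ∈ D.children D.root i)
    (hc : c < (D.children D.root i).card) (hjc : (D.children D.root i).entry c = j)
    (h0 : s.reg 0 = L ^ (D.width + 1)) (h1 : s.reg 1 = base) (h3 : s.reg 3 = D.depth i + 1)
    (hm : s.mem F = i) (hm' : s.mem (F + 1) = c) :
    Runs (N.environment D S W) (traverseCmd keep) s (20 * L ^ (D.width + 1) + 70) fun s' =>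
      State.Agree 3 s s' ∧ s'.reg 3 = D.depth j + 1 ∧ (∀ x < F + 1, s'.mem x = s.mem x) ∧
        s'.mem (F + 1) = c + 1 ∧ s'.mem (F + 2) = j ∧ s'.mem (F + 3) = 0 ∧
        (∀ x < L ^ (D.width + 1), s'.rmem (slot D keep j * L ^ (D.width + 1) + x) = 0) ∧
        ∀ x, ¬ (slot D keep j * L ^ (D.width + 1) ≤ x ∧
          x < slot D keep j * L ^ (D.width + 1) + L ^ (D.width + 1)) → s'.rmem x = s.rmem x := by
  obtain ⟨hS, hW, hfr, hW4, hw, hL⟩ := hr.bounds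
  have hdj := D.depth_child hj
  have hhi := D.depth_le_height i
  have hhj := D.depth_le_height j
  have h2 := D.card_children_le i
  have hTS := hr.slot_le j
  have hpos : 0 < L ^ (D.width + 1) := by positivity
  set B := L ^ (D.width + 1) with hB
  set T := slot D keep j * B with hT
  have hslot : ∀ t : State, t.reg 7 = j → t.reg 3 = D.depth j + 1 → t.reg 0 = B →
      (Expr.mul (bif keep then .reg 7 else .reg 3) (.reg 0)).eval (N.environment D S W) t = T := by
    intro t h7 h3 h0
    cases keep <;> simp [Expr.eval, h7, h3, h0, hT, slot]
  refine Runs.mono (Runs.seq (Runs.assign ?_ (Runs.seq (Runs.assign ?_ (Runs.seq (Runs.assign ?_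
    (Runs.branch (K₁ := 20 * B + 45) (K₂ := 0) ?_ (fun _ => ?_) fun h => ?_))))))) ?_
  · simp [Expr.Fits, Expr.eval, h1, h3]
    omega
  · simp [Expr.Fits, Expr.eval, h1, h3]
    omega
  · simp [Expr.Fits, Expr.eval, h1, h3]
    omega
  · simp [Expr.Fits, childCountE]
  · have e4 : base + 2 * (D.depth i + 1) = F := hF.symm
    refine Runs.mono (Runs.seq (Runs.store ?_ ?_ ?_ (Runs.seq (Runs.assign ?_ (Runs.seq
      (Runs.store ?_ ?_ ?_ (Runs.seq (Runs.store ?_ ?_ ?_ (Runs.seq (Runs.assign ?_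
      (Runs.seq (Runs.assign ?_ (Runs.forLoop 5 (b := B) (Inv := fun k s' =>
        State.Agree 3 s s' ∧ s'.reg 3 = D.depth j + 1 ∧ s'.reg 9 = T ∧
        (∀ x < F + 1, s'.mem x = s.mem x) ∧
        s'.mem (F + 1) = c + 1 ∧ s'.mem (F + 2) = j ∧ s'.mem (F + 3) = 0 ∧
        (∀ x < k, s'.rmem (T + x) = 0) ∧
        ∀ x, ¬ (T ≤ x ∧ x < T + k) → s'.rmem x = s.rmem x)
        ?_ ?_ ?_ ?_))))))))))))) ?_
    · simp [Expr.Fits, Expr.eval, h1, h3]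
      omega
    · simp [Expr.Fits, Expr.eval, h1, h3, e4, hm, hm']
      omega
    · simp [Expr.eval, h1, h3]
      omega
    · simp [Expr.Fits]
    · simp [Expr.Fits, Expr.eval, h1, h3]
      omega
    · simp [Expr.Fits]
    · simp [Expr.eval, h1, h3]
      omega
    · simp [Expr.Fits, Expr.eval, h1, h3]
      omega
    · simp [Expr.Fits]
    · simp [Expr.eval, h1, h3]
      omega
    · simp [Expr.Fits, Expr.eval, h1, h3]
      omega
    · cases keep <;> simp [Expr.Fits, Expr.eval, h1, h3, e4, hm, hm', hjc, h0]
      · have : slot D false j = D.depth i + 1 + 1 := by simp [slot, hdj]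
        rw [← this]; omega
      · have : slot D true j = j := by simp [slot]
        rw [← this]; omega
    · refine ⟨by simp, by simp [Expr.eval, h3, hdj], ?_, ?_, ?_, ?_, ?_, by simp, ?_⟩
      · rw [State.setReg_reg, if_neg (by omega), State.setReg_reg, if_pos rfl]
        apply hslot <;> simp [Expr.eval, h1, h3, e4, hm, hm', hjc, h0, hdj]
      · intro x hx
        simp [Expr.eval, h1, h3, e4]
        rw [if_neg (by omega), if_neg (by omega), if_neg (by omega)]
      · simp [Expr.eval, h1, h3, e4, hm']
      · simp [Expr.eval, h1, h3, e4, hm, hm', hjc]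
      · simp [Expr.eval, h1, h3, e4]
      · intro x hx
        simp
    · rintro k t ⟨i1, -⟩
      simp [Expr.Fits, Expr.eval, i1 0 (by omega), h0]
    · rintro k t hk hk10 ⟨i1, i2, i3, i4, i5, i6, i7, i8, i9⟩
      refine Runs.mono (Runs.rstore ?_ ?_ ?_ ?_) ?_
      · simp [Expr.Fits, Expr.eval, i3, hk10]
        omega
      · simp [RExpr.Fits]
      · simp [Expr.eval, i3, hk10]
        omega
      · simp [Expr.eval, RExpr.eval, i1, i2, i3, hk10, i5, i6, i7]
        refine ⟨fun x hx => i4 x (by omega), fun x hx => ?_, fun x hx => ?_⟩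
        · intro hne
          exact i8 x (by omega)
        · rw [if_neg (by omega)]
          exact i9 x (by omega)
      · simp [Expr.cost, RExpr.cost]
    · rintro t - ⟨i1, i2, i3, i4, i5, i6, i7, i8, i9⟩
      exact ⟨i1, i2, i4, i5, i6, i7, i8, i9⟩
    · cases keep <;> simp [Expr.cost] <;> omega
  · exfalso
    have e4 : base + 2 * (D.depth i + 1) = F := hF.symm
    simp [Expr.eval, h1, h3, e4, hm, hm', childCountE] at h
    omega
  · simp [Expr.cost, childCountE]
    omega

/-- The entries from the address `T` on are those of the function `f` of a labeling of the bag of `i`. -/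
def Holds (D : NiceTreeDecomposition N.graph.square (Fin m)) (keep : Bool) (s : State) (i : Fin m)
    (f : (Fin n → Fin L) → ℝ) : Prop :=
  ∀ idx < L ^ (D.bag i).card,
    s.rmem (slot D keep i * L ^ (D.width + 1) + idx) = f (decode (D.bag i) idx)

/-- The slot of the node `i`. -/
def InSlot (D : NiceTreeDecomposition N.graph.square (Fin m)) (keep : Bool) (i : Fin m) (x : ℕ) :
    Prop :=
  slot D keep i * L ^ (D.width + 1) ≤ x ∧
    x < slot D keep i * L ^ (D.width + 1) + L ^ (D.width + 1)

theorem inSlot_add (keep : Bool) (i : Fin m) {idx : ℕ} (h : idx < L ^ (D.bag i).card) :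
    InSlot D keep i (slot D keep i * L ^ (D.width + 1) + idx) := by
  have : L ^ (D.bag i).card ≤ L ^ (D.width + 1) :=
    Nat.pow_le_pow_right (Nat.pos_of_neZero L) (D.card_bag_le_width i)
  constructor <;> omega

theorem InSlot.slot_eq {keep : Bool} {i j : Fin m} {x : ℕ} (h : InSlot D keep i x)
    (h' : InSlot D keep j x) : slot D keep i = slot D keep j := by
  by_contra hne
  have := slot_disjoint (B := L ^ (D.width + 1)) hne
  simp only [InSlot] at h h'
  omega

/-- Here `f` is what the parent's table has accumulated from the children merged before. -/
theorem runs_pop {keep : Bool} (hr : N.Room D S W base (slot D keep)) {β : Fin n → Fin m}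
    (hβ : N.IsForgetAssignment D β) {i j : Fin m} {F : ℕ} {f : (Fin n → Fin L) → ℝ}
    (hF : F = base + 2 * (D.depth i + 1)) (hj : j ∈ D.children D.root i)
    (h0 : s.reg 0 = L ^ (D.width + 1)) (h1 : s.reg 1 = base) (h3 : s.reg 3 = D.depth j + 1)
    (hm : s.mem F = i) (hm2 : s.mem (F + 2) = j) (hm3 : s.mem (F + 3) = (D.children D.root j).card)
    (htab : Holds D keep s j fun x => N.table D β j x - N.localReward β j x)
    (htab' : Holds D keep s i f) :
    Runs (N.environment D S W) (traverseCmd keep) s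
      (300 * (D.width + 2) ^ 3 + 200 * L ^ (D.width + 1) +
        100 * (D.width + 2) * L ^ (D.width + 1) * load β j + 70) fun s' =>
      State.Agree 3 s s' ∧ s'.reg 3 = D.depth i + 1 ∧ (∀ x < F + 2, s'.mem x = s.mem x) ∧
        Holds D keep s' j (N.table D β j) ∧
        (Holds D keep s' i fun x => f x + N.contribution D β i j x) ∧
        ∀ x, ¬ InSlot D keep j x → ¬ InSlot D keep i x → s'.rmem x = s.rmem x := by
  obtain ⟨hS, hW, hfr, hW4, hw, hL⟩ := hr.bounds
  have hdj := D.depth_child hj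
  have hhj := D.depth_le_height j
  have hTj := hr.slot_le j
  have hTi := hr.slot_le i
  have hne := slot_ne keep hj (D.self_mem_desc j)
  have hdis := slot_disjoint (B := L ^ (D.width + 1)) hne
  have hpos : 0 < L ^ (D.width + 1) := by positivity
  set B := L ^ (D.width + 1) with hB
  -- The frame of `j` is no longer needed once `j` is in a register, so the scratch area of the
  -- merge begins on it.
  have e2 : base + 2 * (D.depth j + 1) = F + 2 := by omega
  refine Runs.mono (Runs.seq (Runs.assign ?_ (Runs.seq (Runs.assign ?_ (Runs.seq (Runs.assign ?_
    (Runs.branch (K₁ := 0) (K₂ := 300 * (D.width + 2) ^ 3 + 200 * B +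
        100 * (D.width + 2) * B * load β j + 40) ?_ (fun h => ?_) fun _ => ?_))))))) ?_
  · simp [Expr.Fits, Expr.eval, h1, h3]
    omega
  · simp [Expr.Fits, Expr.eval, h1, h3]
    omega
  · simp [Expr.Fits, Expr.eval, h1, h3]
    omega
  · simp [Expr.Fits, childCountE]
  · exfalso
    simp [Expr.eval, h1, h3, e2, hm2, hm3, childCountE] at h
  · refine Runs.mono (Runs.seq (Runs.assign ?_ (Runs.branch (K₂ := 0)
      (K₁ := 300 * (D.width + 2) ^ 3 + 200 * B +
        100 * (D.width + 2) * B * load β j + 30) ?_ (fun _ => ?_) fun h => ?_))) ?_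
    · simp [Expr.Fits]
    · simp [Expr.Fits]
    · refine Runs.mono (Runs.seq (Runs.assign ?_ (Runs.seq (Runs.assign ?_ (Runs.seq
        (Runs.assign ?_ ((runs_merge (i := i) (j := j) (A := F + 2)
          (T := slot D keep j * B) (T' := slot D keep i * B) hr hβ hj
          ?_ ?_ ?_ ?_ ?_ ?_ ?_ hTj hTi hdis ?_).conseq ?_))))))) ?_
      · simp [Expr.Fits, Expr.eval, h1, h3]
        omega
      · cases keep <;> simp [Expr.Fits, Expr.eval, h0, h1, h3, e2, hm]
        · have : slot D false i = D.depth j := by simp [slot, hdj]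
          rw [← this]; omega
        · have : slot D true i = i := by simp [slot]
          rw [← this]; omega
      · cases keep <;> simp [Expr.Fits, Expr.eval, h0, h1, h3, e2, hm2]
        · have : slot D false j = D.depth j + 1 := by simp [slot]
          rw [← this]; omega
        · have : slot D true j = j := by simp [slot]
          rw [← this]; omega
      · simp [h0, hB]
      · simp [Expr.eval, h1, h3, e2]
      · simp [Expr.eval, h1, h3, e2, hm2]
      · simp [Expr.eval, h1, h3, e2, hm]
      · have e3 : base + 2 * (D.depth j + 1) - 2 = F := by omega
        cases keep <;> simp [Expr.eval, h0, h1, h3, e3, hm, slot, ← hdj]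
      · cases keep <;> simp [Expr.eval, h0, h1, h3, e2, hm2, slot]
      · omega
      · intro idx hidx
        have := htab idx hidx
        simp only [State.setReg_rmem]
        rw [this]
        ring
      · rintro t - ⟨i1, i2, i3, i4, i5⟩
        refine ⟨?_, ?_, ?_, i3, ?_, ?_⟩
        · exact State.Agree.trans (by simp) (i1.mono (by omega))
        · rw [i1 3 (by omega)]
          simp [Expr.eval, h3, hdj]
        · intro x hx
          simp [i2 x hx]
        · intro idx hidx
          refine (i4 idx hidx).trans ?_
          simp only [State.setReg_rmem]
          rw [htab' idx hidx]
        · intro x h1 h2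
          simp [i5 x h1 h2]
      · cases keep <;> simp only [Expr.cost, cond_true, cond_false, ← hB] <;> omega
    · exfalso
      simp [Expr.eval, h3] at h
      omega
    · simp [Expr.cost]
      omega
  · simp [Expr.cost, childCountE]
    omega

/-- The cost of the traversal of a node. -/
noncomputable def nodeCost (D : NiceTreeDecomposition N.graph.square (Fin m)) (β : Fin n → Fin m)
    (k : Fin m) : ℕ :=
  300 * (D.width + 2) ^ 3 + 220 * L ^ (D.width + 1) +
    100 * (D.width + 2) * L ^ (D.width + 1) * load β k + 150

/-- The traversal of the subtree of `i` computes the table of `i` up to the rewards of `i`. -/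
theorem iterates_traverse {keep : Bool} (hr : N.Room D S W base (slot D keep)) {β : Fin n → Fin m}
    (hβ : N.IsForgetAssignment D β) (i : Fin m) {F : ℕ} (hF : F = base + 2 * (D.depth i + 1))
    (h0 : s.reg 0 = L ^ (D.width + 1)) (h1 : s.reg 1 = base) (h3 : s.reg 3 = D.depth i + 1)
    (hm : s.mem F = i) (hm' : s.mem (F + 1) = 0) (htab : Holds D keep s i fun _ => 0) :
    Iterates (N.environment D S W) (.reg 3) (traverseCmd keep) s
      (∑ j ∈ D.children D.root i, ∑ k ∈ D.desc j, nodeCost D β k) fun s' =>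
      State.Agree 3 s s' ∧ s'.reg 3 = D.depth i + 1 ∧ (∀ x < F + 1, s'.mem x = s.mem x) ∧
        s'.mem (F + 1) = (D.children D.root i).card ∧
        (Holds D keep s' i fun x => N.table D β i x - N.localReward β i x) ∧
        (keep = true → ∀ k ∈ D.desc i, k ≠ i → Holds D keep s' k (N.table D β k)) ∧
        ∀ x, (∀ k ∈ D.desc i, ¬ InSlot D keep k x) → s'.rmem x = s.rmem x := by
  classical
  induction i using D.children_induction generalizing s F with
  | _ i ih =>
    set ch := D.children D.root i with hch
    -- The inner induction is on the number `c` of children that are finished; these are the first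
    -- ones in increasing order.
    suffices key : ∀ c ≤ ch.card, Iterates (N.environment D S W) (.reg 3) (traverseCmd keep) s
        (∑ j ∈ ch.filter (fun j => ch.position j < c), ∑ k ∈ D.desc j, nodeCost D β k) fun s' =>
        State.Agree 3 s s' ∧ s'.reg 3 = D.depth i + 1 ∧ (∀ x < F + 1, s'.mem x = s.mem x) ∧
        s'.mem (F + 1) = c ∧
        (Holds D keep s' i fun x => ∑ j ∈ ch.filter (fun j => ch.position j < c),
          N.contribution D β i j x) ∧
        (keep = true → ∀ j ∈ ch, ch.position j < c → ∀ k ∈ D.desc j,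
          Holds D keep s' k (N.table D β k)) ∧
        ∀ x, (∀ k ∈ D.desc i, ¬ InSlot D keep k x) → s'.rmem x = s.rmem x by
      have hall : ch.filter (fun j => ch.position j < ch.card) = ch :=
        Finset.filter_true_of_mem fun j hj => Finset.position_lt_card hj
      have := key ch.card le_rfl
      rw [hall] at this
      refine this.conseq ?_
      rintro t - ⟨i1, i2, i3, i4, i5, i6, i7⟩
      refine ⟨i1, i2, i3, i4, ?_, ?_, i7⟩
      · intro idx hidx
        refine (i5 idx hidx).trans ?_
        simp only [table_eq, add_sub_cancel_right, hch]
      · intro hk k hki hne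
        obtain ⟨j, hj, hkj⟩ := (D.mem_desc_iff.1 hki).resolve_left hne
        exact i6 hk j hj (Finset.position_lt_card hj) k hkj
    intro c
    induction c with
    | zero =>
      intro _
      refine (Iterates.refl ?_).mono (Nat.zero_le _)
      refine ⟨by simp, h3, fun _ _ => rfl, hm', ?_, by simp, fun _ _ => rfl⟩
      simpa using htab
    | succ c ihc =>
      intro hc
      obtain ⟨j, hj, hj1, hj2⟩ := Finset.exists_entry_eq (X := ch) (k := c) (by omega)
      have hset : ch.filter (fun j => ch.position j < c + 1) =
          insert j (ch.filter fun j => ch.position j < c) := by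
        ext k
        simp only [Finset.mem_filter, Finset.mem_insert]
        constructor
        · rintro ⟨h1, h2⟩
          rw [← hj2] at h2
          rcases (Finset.position_lt_succ_iff h1 hj).1 h2 with h | h
          · exact .inr ⟨h1, by omega⟩
          · exact .inl h
        · rintro (rfl | ⟨h1, h2⟩)
          · exact ⟨hj, by omega⟩
          · exact ⟨h1, by omega⟩
      have hnot : j ∉ ch.filter fun j => ch.position j < c := by simp [hj2]
      have hdj := D.depth_child hj
      rw [hset, Finset.sum_insert hnot, add_comm]
      refine ((ihc (by omega)).conseq ?_).bind
      rintro t - ⟨i1, i2, i3, i4, i5, i6, i7⟩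
      -- A child takes one iteration to be pushed, the iterations of its own subtree by induction,
      -- and one iteration to be popped.
      refine Iterates.mono (Iterates.bind (Iterates.conseq (Iterates.step
        (K := 20 * L ^ (D.width + 1) + 70) trivial ?_ (runs_push hr hF hj hc hj1 ?_ ?_
          i2 ?_ i4)) (Q := fun t' => Iterates (N.environment D S W) (.reg 3) (traverseCmd keep) t'
            (∑ j' ∈ D.children D.root j, ∑ k ∈ D.desc j', nodeCost D β k +
              (300 * (D.width + 2) ^ 3 + 200 * L ^ (D.width + 1) +
        100 * (D.width + 2) * L ^ (D.width + 1) * load β j + 72)) _) ?_)) ?_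
      · simp [Expr.eval, i2]
      · rw [i1 0 (by omega), h0]
      · rw [i1 1 (by omega), h1]
      · rw [i3 F (by omega), hm]
      · rintro t1 - ⟨j1, j2, j3, j4, j5, j6, j7, j8⟩
        have hns : ∀ {a b : Fin m} {x : ℕ}, InSlot D keep a x → slot D keep b ≠ slot D keep a →
            ¬ InSlot D keep b x := fun ha hne hb => hne (hb.slot_eq ha)
        refine Iterates.bind ((ih j hj (s := t1) (F := F + 2) (by omega) ?_ ?_ j2 j5 j6 ?_).conseq ?_)
        · rw [j1 0 (by omega), i1 0 (by omega), h0]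
        · rw [j1 1 (by omega), i1 1 (by omega), h1]
        · exact fun idx hidx => j7 idx (lt_of_lt_of_le hidx
            (Nat.pow_le_pow_right (Nat.pos_of_neZero L) (D.card_bag_le_width j)))
        rintro t2 - ⟨k1, k2, k3, k4, k5, k6, k7⟩
        -- Cells in a slot not used by the subtree of `j` survive the push and the traversal of `j`.
        have hkj : ∀ {k x}, InSlot D keep k x → (∀ k' ∈ D.desc j, slot D keep k' ≠ slot D keep k) →
            t2.rmem x = t.rmem x := fun {k x} hk hne => by
          rw [k7 x fun k' hk' => hns hk (hne k' hk'), j8 x (hns hk (hne j (D.self_mem_desc j)))]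
        refine Iterates.mono (Iterates.conseq (Iterates.step ?_ ?_ (runs_pop hr hβ hF hj
          ?_ ?_ k2 ?_ ?_ k4 k5 (f := fun x => ∑ j ∈ ch.filter (fun j => ch.position j < c),
            N.contribution D β i j x) ?_)) ?_) ?_
        · simp [Expr.Fits]
        · simp [Expr.eval, k2]
        · rw [k1 0 (by omega), j1 0 (by omega), i1 0 (by omega), h0]
        · rw [k1 1 (by omega), j1 1 (by omega), i1 1 (by omega), h1]
        · rw [k3 F (by omega), j3 F (by omega), i3 F (by omega), hm]
        · rw [k3 (F + 2) (by omega), j5]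
        · intro idx hidx
          refine (hkj (inSlot_add keep i hidx) fun k' hk' => slot_ne keep hj hk').trans ?_
          exact i5 idx hidx
        · rintro t3 - ⟨l1, l2, l3, l4, l5, l6⟩
          refine ⟨((i1.trans j1).trans k1).trans l1, l2, fun x hx => ?_, ?_, fun idx hidx => ?_,
            ?_, fun x hx => ?_⟩
          · rw [l3 x (by omega), k3 x (by omega), j3 x (by omega), i3 x (by omega)]
          · rw [l3 _ (by omega), k3 _ (by omega), j4]
          · refine (l5 idx hidx).trans ?_
            simp only [Finset.sum_insert hnot]
            exact add_comm _ _
          · rintro rfl j' hj' hpos k hk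
            have hki : ∀ {x}, InSlot D true k x → ¬ InSlot D true i x := fun hx =>
              hns hx (slot_ne true hj' hk).symm
            rcases (Finset.position_lt_succ_iff hj' hj).1 (by omega) with h | rfl
            -- Tables below an earlier sibling persist because the subtrees are disjoint and, when
            -- all tables are kept, slots are injective.
            · have hdis : ∀ k' ∈ D.desc j, k' ≠ k := by
                rintro k' hk' rfl
                have hne : j' ≠ j := by rintro rfl; omega
                exact Finset.disjoint_left.1 (D.desc_disjoint hj' hj hne) hk hk'
              intro idx hidx
              have hin := inSlot_add true k hidx
              rw [l6 _ (hns hin (slot_injective.ne (hdis j (D.self_mem_desc j)))) (hki hin),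
                hkj hin fun k' hk' => slot_injective.ne (hdis k' hk')]
              exact i6 rfl j' hj' (by omega) k hk idx hidx
            · by_cases hkj' : k = j'
              · subst hkj'
                exact l4
              · intro idx hidx
                have hin := inSlot_add true k hidx
                rw [l6 _ (hns hin (slot_injective.ne (Ne.symm hkj'))) (hki hin)]
                exact k6 rfl k hk hkj' idx hidx
          · have hsub : ∀ k ∈ D.desc j, ¬ InSlot D keep k x := fun k hk =>
              hx k (D.mem_desc_iff.2 (.inr ⟨j, hj, hk⟩))
            rw [l6 x (hsub j (D.self_mem_desc j)) (hx i (D.self_mem_desc i)), k7 x hsub,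
              j8 x (hsub j (D.self_mem_desc j)), i7 x hx]
        · simp only [Expr.cost]
          omega
      · rw [D.sum_desc, nodeCost]
        simp only [Expr.cost]
        omega

end NAGL

/-! ### The size of a slot, and the computation of all tables. -/

namespace NAGL

open RAM

variable {n L m : ℕ} [NeZero L] {N : NAGL (Fin n) (Fin L)}
  {D : NiceTreeDecomposition N.graph.square (Fin m)} {S W base : ℕ} {s : State}

/-- Compute the size of the largest bag in register 2, and the size of the largest table in
register 0. -/
def sizeCmd : Cmd :=
  .seq (.forLoop 4 (.read .numNodes (.const 0) (.const 0))
      -- With truncated subtraction, `r + (b - r)` is the maximum of `r` and `b`.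
      (.assign 2 (.add (.reg 2) (.sub (bagCountE 4) (.reg 2))))) <|
    .seq (.assign 0 (.const 1)) (.forLoop 4 (.reg 2) (.assign 0 (.mul (.reg 0) labelsE)))

theorem runs_size {σ : Fin m → ℕ} (hr : N.Room D S W base σ) (h2 : s.reg 2 = 0) :
    Runs (N.environment D S W) sizeCmd s (30 * m + 20 * (D.width + 2)) fun s' =>
      s'.reg 0 = L ^ (D.width + 1) ∧ s'.mem = s.mem ∧ s'.rmem = s.rmem := by
  obtain ⟨hS, hW, hfr, hW4, hw, hL⟩ := hr.bounds
  have : Nonempty (Fin n) := ⟨⟨0, hr.pos⟩⟩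
  set f : ℕ → ℕ := fun k => (Finset.univ.filter fun i : Fin m => (i : ℕ) < k).sup
    fun i => (D.bag i).card with hf
  have hm : 0 < m := D.root.pos
  have hfm : f m = D.width + 1 := by
    have : (Finset.univ.filter fun i : Fin m => (i : ℕ) < m) = Finset.univ :=
      Finset.filter_true_of_mem fun i _ => i.2
    rw [hf, D.width_add_one]
    simp only [this]
  have hfs : ∀ i : Fin m, f (i + 1) = max (D.bag i).card (f i) := fun i => by
    have : (Finset.univ.filter fun k : Fin m => (k : ℕ) < i + 1) =
        insert i (Finset.univ.filter fun k : Fin m => (k : ℕ) < i) := by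
      ext k
      simp only [Finset.mem_filter, Finset.mem_univ, true_and, Finset.mem_insert, Fin.ext_iff]
      omega
    simp only [hf, this, Finset.sup_insert]
  have hfw : ∀ k, f k ≤ D.width + 1 := fun k => Finset.sup_le fun i _ => D.card_bag_le_width i
  refine Runs.mono (Runs.seq (Runs.forLoop 10 (b := m) (Inv := fun k s' => s'.reg 2 = f k ∧
    s'.mem = s.mem ∧ s'.rmem = s.rmem) ?_ ?_ ?_ fun t _ ht => ?_)
    (K₂ := 2 + ((D.width + 1) * 14 + 6))) ?_
  · simp [h2, hf]
  · intro k t _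
    simp [Expr.Fits, Expr.eval]
  · rintro k t hk h4 ⟨i1, i2, i3⟩
    have hb := environment_bagCount N D S W ⟨k, hk⟩ 0
    have := hfs ⟨k, hk⟩
    have := D.card_bag_le_width ⟨k, hk⟩
    have := hfw k
    simp only at *
    refine Runs.mono (Runs.assign ?_ ?_) ?_
    · simp [Expr.Fits, Expr.eval, bagCountE, i1, h4, hb]
      omega
    · refine ⟨by simp [h4], ?_, by simp [i2], by simp [i3]⟩
      simp [Expr.eval, bagCountE, i1, h4, hb]
      omega
    · simp [Expr.cost, bagCountE]
  · obtain ⟨i1, i2, i3⟩ := ht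
    rw [hfm] at i1
    refine Runs.mono (Runs.seq (Runs.assign ?_ (Runs.forLoop 6 (b := D.width + 1)
      (Inv := fun k s' => s'.reg 0 = L ^ k ∧ s'.reg 2 = D.width + 1 ∧ s'.mem = s.mem ∧
        s'.rmem = s.rmem) ?_ ?_ ?_ ?_))) ?_
    · simp [Expr.Fits]
    · simp [Expr.eval, i1, i2, i3]
    · rintro k u ⟨-, j2, -⟩
      simp [Expr.Fits, Expr.eval, j2]
    · rintro k u hk h4 ⟨j1, j2, j3, j4⟩
      refine Runs.mono (Runs.assign ?_ ?_) ?_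
      · simp [Expr.Fits, Expr.eval, labelsE, j1]
        rw [← pow_succ]
        exact hr.pow_lt_of_le (by omega)
      · simp [Expr.eval, labelsE, j1, j2, j3, j4, h4, pow_succ]
      · simp [Expr.cost, labelsE]
    · rintro u - ⟨j1, j2, j3, j4⟩
      exact ⟨j1, j3, j4⟩
    · simp only [Expr.cost]
      omega
  · simp only [Expr.cost]
    omega

/-- Compute the tables of all nodes; if `keep` is set, they are all kept, and the first `n` cells of
the word memory are left free. -/
def tableCmd (keep : Bool) : Cmd :=
  .seq sizeCmd <|
    .seq (.assign 1 (bif keep then .read .numVertices (.const 0) (.const 0) else .const 0)) <|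
      .seq (.assign 3 (.const 1)) <|
        .seq (.store (.add (.reg 1) (.const 2)) (.read .rootNode (.const 0) (.const 0))) <|
          .loop (.reg 3) (traverseCmd keep)

/-- The root has no parent to merge into; popping it only brings the stack height to zero, which
ends the loop. -/
theorem runs_pop_root {keep : Bool} (hr : N.Room D S W base (slot D keep))
    (h1 : s.reg 1 = base) (h3 : s.reg 3 = 1) (hm : s.mem (base + 2) = D.root)
    (hm' : s.mem (base + 3) = (D.children D.root D.root).card) :
    Runs (N.environment D S W) (traverseCmd keep) s 40 fun s' =>
      State.Agree 3 s s' ∧ s'.reg 3 = 0 ∧ s'.mem = s.mem ∧ s'.rmem = s.rmem := by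
  obtain ⟨hS, hW, hfr, hW4, hw, hL⟩ := hr.bounds
  refine Runs.mono (Runs.seq (Runs.assign ?_ (Runs.seq (Runs.assign ?_ (Runs.seq (Runs.assign ?_
    (Runs.branch (K₁ := 0) (K₂ := 10) ?_ (fun h => ?_) fun _ => ?_))))))) ?_
  · simp [Expr.Fits, Expr.eval, h1, h3]
    omega
  · simp [Expr.Fits, Expr.eval, h1, h3]
    omega
  · simp [Expr.Fits, Expr.eval, h1, h3]
    omega
  · simp [Expr.Fits, childCountE]
  · exfalso
    simp [Expr.eval, h1, h3, hm, hm', childCountE] at h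
  · refine Runs.mono (Runs.seq (Runs.assign ?_ (Runs.branch (K₁ := 0) ?_ (fun h => ?_)
      fun _ => Runs.skip ?_))) ?_
    · simp [Expr.Fits]
    · simp [Expr.Fits]
    · simp [Expr.eval, h3] at h
    · simp [Expr.eval, h3]
    · simp [Expr.cost]
  · simp [Expr.cost, childCountE]

theorem runs_table {keep : Bool} (hr : N.Room D S W base (slot D keep)) {β : Fin n → Fin m}
    (hβ : N.IsForgetAssignment D β) (hbase : base = bif keep then n else 0) :
    Runs (N.environment D S W) (tableCmd keep) State.init
      (30 * m + 20 * (D.width + 2) + ∑ i, nodeCost D β i) fun s' =>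
      s'.reg 0 = L ^ (D.width + 1) ∧ s'.reg 1 = base ∧ (∀ x < base, s'.mem x = 0) ∧
        Holds D keep s' D.root (N.table D β D.root) ∧
        (keep = true → ∀ i, Holds D keep s' i (N.table D β i)) := by
  obtain ⟨hS, hW, hfr, hW4, hw, hL⟩ := hr.bounds
  refine Runs.mono (Runs.seq ((runs_size hr rfl).conseq (Q := fun t => Runs (N.environment D S W) _
    t (∑ i, nodeCost D β i) _) ?_)) le_rfl
  rintro t - ⟨i1, i2, i3⟩
  refine Runs.mono (Runs.seq (Runs.assign ?_ (Runs.seq (Runs.assign ?_ (Runs.seq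
    (Runs.store ?_ ?_ ?_ (Iterates.runs_loop (Iterates.bind (Iterates.conseq
      (iterates_traverse (F := base + 2) hr hβ D.root ?_ ?_ ?_ ?_ ?_ ?_ ?_)
      (Q := fun u => Iterates _ _ _ u 42 _) ?_))))))))) ?_
  · cases keep <;> simp [Expr.Fits]
  · simp [Expr.Fits]
  · cases keep <;> simp [Expr.Fits, Expr.eval] <;> simp at hbase <;> omega
  · simp [Expr.Fits]
  · cases keep <;> simp [Expr.eval] <;> simp at hbase <;> omega
  · simp [D.depth_root]
  · simp [i1]
  · cases keep <;> simp [Expr.eval, hbase]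
  · simp [Expr.eval, D.depth_root]
  · cases keep <;> simp [Expr.eval, hbase]
  · cases keep <;> simp [Expr.eval, hbase, i2, State.init]
  · intro idx _
    simp [i3, State.init]
  · rintro u - ⟨j1, j2, j3, j4, j5, j6, j7⟩
    rw [D.depth_root] at j2
    -- The rewards of the root are never added by the program, and they vanish because its bag is
    -- empty.
    have hroot : Holds D keep u D.root (N.table D β D.root) := fun idx hidx => by
      refine (j5 idx hidx).trans ?_
      simp only [N.localReward_leaf D β hβ.1 D.bag_root, sub_zero]
    refine (Iterates.step ?_ ?_ ((runs_pop_root hr ?_ j2 ?_ j4).conseq ?_)).mono ?_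
    · simp [Expr.Fits]
    · simp [Expr.eval, j2]
    · rw [j1 1 (by omega)]
      cases keep <;> simp [Expr.eval, hbase]
    · rw [j3 _ (by omega)]
      cases keep <;> simp [Expr.eval, hbase]
    · rintro v - ⟨k1, k2, k3, k4⟩
      refine ⟨by simp [Expr.Fits], by simp [Expr.eval, k2], ?_, ?_, ?_, ?_, ?_⟩
      · rw [k1 0 (by omega), j1 0 (by omega)]
        simp [i1]
      · rw [k1 1 (by omega), j1 1 (by omega)]
        cases keep <;> simp [Expr.eval, hbase]
      · intro x hx
        rw [k3, j3 x (by omega)]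
        cases keep <;> simp [Expr.eval, i2, State.init] <;> simp at hbase <;> omega
      · intro idx hidx
        rw [k4]
        exact hroot idx hidx
      · intro hk i idx hidx
        rw [k4]
        by_cases hi : i = D.root
        · subst hi
          exact hroot idx hidx
        · exact j6 hk i (by simp [D.desc_root]) hi idx hidx
    · simp [Expr.cost]
  -- The traversal uses up the cost of every node except the root; the root's share pays for the
  -- initialization and the last pop.
  · have h1 : ∑ i, nodeCost D β i = ∑ i ∈ D.desc D.root, nodeCost D β i := by rw [D.desc_root]
    have h2 : 150 ≤ nodeCost D β D.root := by simp only [nodeCost]; omega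
    rw [h1, D.sum_desc]
    cases keep <;> simp only [Expr.cost, cond_true, cond_false] <;> omega

end NAGL

/-! ### Choosing the label of a forgotten vertex. -/

theorem Nat.sum_digits {L q : ℕ} (d : ℕ → ℕ) (hd : ∀ k < q, d k < L) :
    ∑ k ∈ Finset.range q, d k * L ^ k < L ^ q ∧
      ∀ p < q, (∑ k ∈ Finset.range q, d k * L ^ k) / L ^ p % L = d p := by
  have h : ∑ k ∈ Finset.range q, d k * L ^ k =
      (finFunctionFinEquiv fun k : Fin q => (⟨d k, hd k k.2⟩ : Fin L) : Fin (L ^ q)) := by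
    rw [finFunctionFinEquiv_apply, Finset.sum_range]
  refine ⟨by rw [h]; exact Fin.is_lt _, fun p hp => ?_⟩
  have := congrArg Fin.val (congrFun (finFunctionFinEquiv.symm_apply_apply
    fun k : Fin q => (⟨d k, hd k k.2⟩ : Fin L)) ⟨p, hp⟩)
  rw [h]
  exact this

theorem NiceTreeDecomposition.card_lt_of_isForget {V I : Type*} [Fintype I] {H : SimpleGraph V}
    (D : NiceTreeDecomposition H I) {i j : I} {a : V} (h : D.IsForget D.root i j a) :
    (D.bag i).card < (D.bag j).card :=
  Finset.card_lt_card <| Finset.ssubset_iff_subset_ne.2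
    ⟨fun _ hv => ((D.isForget_mem_iff h).1 hv).1, fun he => by
      have := h.2.1
      rw [← he, D.isForget_mem_iff h] at this
      exact this.2 rfl⟩

namespace NAGL

open RAM

variable {n L m : ℕ} [NeZero L] {N : NAGL (Fin n) (Fin L)}
  {D : NiceTreeDecomposition N.graph.square (Fin m)} {S W : ℕ} {s : State}

/-- The inverse of `decode`: this sum is the table index of the restriction of `x` to `X`. -/
theorem decode_sum {X : Finset (Fin n)} {x : Fin n → Fin L} {d : ℕ → ℕ}
    (hd : ∀ v ∈ X, d (X.position v) = x v) :
    ∑ k ∈ Finset.range X.card, d k * L ^ k < L ^ X.card ∧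
      ∀ v ∈ X, decode X (∑ k ∈ Finset.range X.card, d k * L ^ k) v = x v := by
  have hlt : ∀ k < X.card, d k < L := fun k hk => by
    obtain ⟨v, hv, -, rfl⟩ := Finset.exists_entry_eq hk
    rw [hd v hv]
    exact (x v).2
  obtain ⟨h1, h2⟩ := Nat.sum_digits d hlt
  refine ⟨h1, fun v hv => Fin.ext ?_⟩
  rw [decode_val, h2 _ (Finset.position_lt_card hv), hd v hv]

/-- Add the index of the current labeling of the bag of the node in register 5 to register 17. -/
def indexCmd : Cmd :=
  .seq (.assign 18 (.const 1)) <| .forLoop 19 (bagCountE 5) <|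
    .seq (.assign 17 (.add (.reg 17) (.mul (.load (bagElemE 5 19)) (.reg 18))))
      (.assign 18 (.mul (.reg 18) labelsE))

theorem runs_index {σ : Fin m → ℕ} (hr : N.Room D S W n σ) {j : Fin m} {T : ℕ}
    {x : Fin n → Fin L} (h5 : s.reg 5 = j) (h17 : s.reg 17 = T) (hT : T + L ^ (D.width + 1) ≤ S)
    (hx : ∀ v : Fin n, s.mem v = x v) :
    Runs (N.environment D S W) indexCmd s (40 * (D.width + 2)) fun s' =>
      State.Agree 17 s s' ∧ s'.mem = s.mem ∧ s'.rmem = s.rmem ∧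
        s'.reg 17 = T + ∑ k ∈ Finset.range (D.bag j).card, s.mem ((D.bag j).entry k) * L ^ k := by
  obtain ⟨hS, hW, hf, h4, hw, hL⟩ := hr.bounds
  have hbj := D.card_bag_le_width j
  set X := D.bag j with hX
  have hdL : ∀ k < X.card, s.mem (X.entry k) < L := fun k hk => by
    obtain ⟨v, hv, h1, rfl⟩ := Finset.exists_entry_eq hk
    rw [h1, hx]
    exact (x v).2
  have hpow : ∀ k ≤ X.card, L ^ k ≤ L ^ (D.width + 1) := fun k hk =>
    Nat.pow_le_pow_right (by omega) (by omega)
  refine Runs.mono (Runs.seq (Runs.assign ?_ (Runs.forLoop 20 (b := X.card) (Inv := fun k s' =>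
    State.Agree 17 s s' ∧ s'.mem = s.mem ∧ s'.rmem = s.rmem ∧ s'.reg 18 = L ^ k ∧
      s'.reg 17 = T + ∑ k' ∈ Finset.range k, s.mem (X.entry k') * L ^ k') ?_ ?_ ?_ ?_))) ?_
  · simp [Expr.Fits]
  · simp [Expr.eval, h17]
  · rintro k t ⟨i1, -⟩
    simp [Expr.Fits, Expr.eval, bagCountE, i1 5 (by omega), h5, hX]
  · rintro k t hk h19 ⟨i1, i2, i3, i4, i5⟩
    have e5 : t.reg 5 = j := by rw [i1 5 (by omega), h5]
    have hen : X.entry k < n := by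
      obtain ⟨v, hv, h1, -⟩ := Finset.exists_entry_eq hk
      rw [h1]; exact v.2
    have hsum : ∑ k' ∈ Finset.range k, s.mem (X.entry k') * L ^ k' +
        s.mem (X.entry k) * L ^ k < L ^ (k + 1) := by
      rw [← Finset.sum_range_succ]
      exact (Nat.sum_digits (fun k => s.mem (X.entry k)) fun k' hk' => hdL k' (by omega)).1
    have hk1 := hpow (k + 1) (by omega)
    refine Runs.mono (Runs.seq (Runs.assign ?_ (Runs.assign ?_ ?_))) ?_
    · simp [Expr.Fits, Expr.eval, bagElemE, e5, h19, i2, i4, i5, ← hX]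
      omega
    · simp [Expr.Fits, Expr.eval, labelsE, i4]
      rw [← pow_succ]
      omega
    · simp [Expr.eval, labelsE, bagElemE, e5, h19, i1, i2, i3, i4, i5, ← hX, pow_succ,
        Finset.sum_range_succ, add_assoc]
    · simp [Expr.cost, labelsE, bagElemE]
  · rintro t - ⟨i1, i2, i3, i4, i5⟩
    exact ⟨i1, i2, i3, i5⟩
  · simp only [Expr.cost, bagCountE]
    omega

/-- Choose the best label for the vertex that is forgotten between the nodes in the registers 5
and 8. -/
def chooseCmd : Cmd :=
  .seq scanCmd <|
    .seq (.assign 11 (bagElemE 5 12)) <|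
      .seq (.store (.reg 11) (.const 0)) <|
        .seq (.assign 17 (.mul (.reg 5) (.reg 0))) <|
          .seq indexCmd <|
            .seq (.assign 16 (.const 0)) <|
              .seq (.forLoop 15 labelsE <|
                .seq (.compare 18 (.load (.add (.reg 17) (.mul (.reg 16) (.reg 13))))
                    (.load (.add (.reg 17) (.mul (.reg 15) (.reg 13)))))
                  (.branch (.reg 18) (.assign 16 (.reg 15)) .skip))
                (.store (.reg 11) (.reg 16))

theorem Room.slot_le_of_keep {base : ℕ} (hr : N.Room D S W base (slot D true)) (j : Fin m) :
    j * L ^ (D.width + 1) + L ^ (D.width + 1) ≤ S := hr.slot_le j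

/-- The label of `a` is first set to zero. If `e` is the resulting index, the candidates are the
entries `e + c * L^p`, so the choice takes `O(t + L)` steps. The first `n` words of the memory hold
the current labeling. -/
theorem runs_choose (hr : N.Room D S W n (slot D true)) {β : Fin n → Fin m}
    (hβ : N.IsAssignment D β) {i j : Fin m} {a : Fin n} (hf : D.IsForget D.root i j a)
    {x : Fin n → Fin L} (h0 : s.reg 0 = L ^ (D.width + 1)) (h5 : s.reg 5 = j) (h8 : s.reg 8 = i)
    (hx : ∀ v : Fin n, s.mem v = x v) (htab : Holds D true s j (N.table D β j)) :
    Runs (N.environment D S W) chooseCmd s (100 * (D.width + 2) + 50 * L + 30) fun s' =>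
      State.Agree 11 s s' ∧ s'.rmem = s.rmem ∧ (∀ y ≥ n, s'.mem y = s.mem y) ∧
        ∃ c, (∀ v : Fin n, s'.mem v = Function.update x a c v) ∧
          ∀ c', N.table D β j (Function.update x a c') ≤ N.table D β j (Function.update x a c) := by
  obtain ⟨hS, hW, hfr, hW4, hw, hL⟩ := hr.bounds
  have hTS := hr.slot_le_of_keep j
  obtain ⟨p, Q, R, hl⟩ := exists_isLink (N := N) (D.isForget_child hf)
  obtain ⟨a', hf', hp, hpj⟩ := hl.isForget (D.card_lt_of_isForget hf)
  obtain rfl := D.isForget_vertex_unique hf hf' rfl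
  set X := D.bag j with hX
  have hpos : X.position a = p := by
    obtain ⟨v, hv, h1, h2⟩ := Finset.exists_entry_eq hpj
    rw [hp, Fin.val_inj] at h1
    rw [h1, h2]
  set B := L ^ (D.width + 1) with hB
  have hXB : L ^ X.card ≤ B := Nat.pow_le_pow_right (by omega) (D.card_bag_le_width j)
  have hpB : L ^ p ≤ B := Nat.pow_le_pow_right (by omega) (hpj.le.trans (D.card_bag_le_width j))
  have hLB : L ≤ B := by simpa using Nat.pow_le_pow_right (n := L) (by omega) (show 1 ≤ D.width + 1 by omega)
  -- the entry for the label `c`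
  set e := ∑ k ∈ Finset.range X.card, (s.setMem a 0).mem (X.entry k) * L ^ k with he
  have hent : ∀ c : Fin L, e + c * L ^ p < L ^ X.card ∧ ∀ t : State, t.rmem = s.rmem →
      t.rmem (j * B + (e + c * L ^ p)) = N.table D β j (Function.update x a c) := fun c => by
    -- The digit at place `p` is zero in `e`, so adding `c * L^p` replaces it by `c` without a
    -- carry.
    have h1 : e + c * L ^ p = ∑ k ∈ Finset.range X.card,
        Function.update (fun k => s.mem (X.entry k)) p (c : ℕ) k * L ^ k := by
      have hpm := Finset.mem_range.2 hpj
      rw [he, ← Finset.add_sum_erase _ _ hpm, ← Finset.add_sum_erase _ _ hpm]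
      simp only [State.setMem_mem, hp, Function.update_self]
      rw [if_pos trivial, zero_mul, zero_add, add_comm]
      refine congrArg _ (Finset.sum_congr rfl fun k hk => ?_)
      obtain ⟨hkp, hk⟩ := Finset.mem_erase.1 hk
      obtain ⟨v, hv, h3, h4⟩ := Finset.exists_entry_eq (Finset.mem_range.1 hk)
      rw [Function.update_of_ne hkp, if_neg]
      rw [h3, Fin.val_inj]
      rintro rfl
      omega
    obtain ⟨h2, h3⟩ := decode_sum (X := X) (x := Function.update x a c)
      (d := Function.update (fun k => s.mem (X.entry k)) p (c : ℕ)) fun v hv => by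
        by_cases hva : v = a
        · subst hva
          rw [hpos, Function.update_self, Function.update_self]
        · rw [Function.update_of_ne hva, Function.update_of_ne, Finset.entry_position hv, hx]
          intro h
          rw [← hpos] at h
          have := Finset.entry_position hv
          rw [h, hpos, hp, Fin.val_inj] at this
          exact hva this.symm
    rw [← h1] at h2 h3
    refine ⟨h2, fun t ht => ?_⟩
    rw [ht]
    exact (htab _ h2).trans (N.table_congr D β hβ h3)
  set g : Fin L → ℝ := fun c => N.table D β j (Function.update x a c) with hg
  refine Runs.mono (Runs.seq (K₂ := 60 * (D.width + 2) + 50 * L + 30) ((runs_scan hr hl h8 h5).conseq ?_)) ?_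
  · rintro t1 - ⟨i1, i2, i3, i4, i5⟩
    have e5 : t1.reg 5 = j := by rw [i1 5 (by omega), h5]
    have e0 : t1.reg 0 = B := by rw [i1 0 (by omega), h0]
    refine Runs.mono (Runs.seq (Runs.assign ?_ (Runs.seq (Runs.store ?_ ?_ ?_ (Runs.seq
      (Runs.assign ?_ (Runs.seq (K₂ := 50 * L + 15) ((runs_index (j := j) (x := Function.update x a 0) (T := j * B) hr ?_ ?_ ?_ ?_).conseq ?_)))))))) ?_
    · simp [Expr.Fits, bagElemE]
    · simp [Expr.Fits]
    · simp [Expr.Fits]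
    · simp [Expr.eval, bagElemE, e5, i4, ← hX, hp]
      omega
    · simp [Expr.Fits, Expr.eval, e5, e0]
      omega
    · simp [e5]
    · simp [Expr.eval, e5, e0]
    · omega
    · intro v
      simp [Expr.eval, bagElemE, e5, i4, ← hX, hp, i2, Fin.val_inj, Function.update_apply, hx]
      split_ifs <;> simp
    · rintro t2 - ⟨k1, k2, k3, k4⟩
      have k4' : t2.reg 17 = j * B + e := by
        rw [k4, he]
        simp [Expr.eval, bagElemE, e5, i4, ← hX, hp, i2]
      have k2' : ∀ y, t2.mem y = if y = a then 0 else s.mem y := fun y => by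
        rw [k2]
        simp [Expr.eval, bagElemE, e5, i4, ← hX, hp, i2]
      have a1 : State.Agree 11 s t2 := by
        refine State.Agree.trans (i1.mono (by omega)) (State.Agree.trans ?_ (k1.mono (by omega)))
        simp
      have f11 : t2.reg 11 = a := by
        rw [k1 11 (by omega)]
        simp [Expr.eval, bagElemE, e5, i4, ← hX, hp]
      have f13 : t2.reg 13 = L ^ p := by
        rw [k1 13 (by omega)]
        simp [i5]
      have k3' : t2.rmem = s.rmem := by rw [k3]; simp [i3]
      refine Runs.mono (Runs.seq (Runs.assign ?_ (Runs.seq (K₂ := 3) (Runs.forLoop 20 (b := L)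
        (Inv := fun k u => State.Agree 11 s u ∧ u.reg 11 = a ∧ u.reg 13 = L ^ p ∧
          u.reg 17 = j * B + e ∧ u.mem = t2.mem ∧ u.rmem = s.rmem ∧
          ∃ c : Fin L, u.reg 16 = c ∧ ∀ c' : Fin L, (c' : ℕ) < k → g c' ≤ g c)
        ?_ ?_ ?_ ?_)))) ?_
      · simp [Expr.Fits]
      · refine ⟨by simpa using a1, by simp [f11], by simp [f13], by simp [k4'], by simp,
          by simp [k3'], 0, by simp [Expr.eval], by simp⟩
      · intro k u _
        simp [Expr.Fits, Expr.eval, labelsE]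
      · rintro k u hk h15 ⟨l1, l2, l3, l4, l5, l6, c, l7, l8⟩
        obtain ⟨m1, m2⟩ := hent c
        obtain ⟨m3, m4⟩ := hent ⟨k, hk⟩
        simp only at m3 m4
        have ec : (RExpr.load (.add (.reg 17) (.mul (.reg 16) (.reg 13)))).eval
            (N.environment D S W) u = g c := by
          refine Eq.trans ?_ (m2 u l6)
          simp [RExpr.eval, Expr.eval, l4, l7, l3, add_assoc]
        have ek : (RExpr.load (.add (.reg 17) (.mul (.reg 15) (.reg 13)))).eval
            (N.environment D S W) u = g ⟨k, hk⟩ := by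
          refine Eq.trans ?_ (m4 u l6)
          simp [RExpr.eval, Expr.eval, l4, h15, l3, add_assoc]
        refine Runs.mono (Runs.seq (Runs.compare ?_ ?_ (Runs.branch (K₁ := 2) (K₂ := 1) ?_
          (fun h => Runs.assign ?_ ?_) fun h => Runs.skip ?_))) ?_
        · simp [RExpr.Fits, Expr.Fits, Expr.eval, l4, l7, l3]
          omega
        · simp [RExpr.Fits, Expr.Fits, Expr.eval, l4, h15, l3]
          omega
        · simp [Expr.Fits]
        · simp [Expr.Fits]
        · rw [ec, ek] at h
          have hle : g c ≤ g ⟨k, hk⟩ := by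
            by_contra hc
            simp [Expr.eval, hc] at h
          refine ⟨by simp [h15], by simpa using l1, by simp [l2], by simp [l3], by simp [l4],
            by simp [l5], by simp [l6], ⟨k, hk⟩, by simp [Expr.eval, h15], fun c' hc' => ?_⟩
          rcases Nat.lt_succ_iff_lt_or_eq.1 hc' with h' | h'
          · exact (l8 c' h').trans hle
          · exact le_of_eq (congrArg g (Fin.ext h'))
        · rw [ec, ek] at h
          have hle : g ⟨k, hk⟩ ≤ g c := by
            by_contra hc
            simp [Expr.eval, (not_le.1 hc).le] at h
          refine ⟨by simp [h15], by simpa using l1, by simp [l2], by simp [l3], by simp [l4],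
            by simp [l5], by simp [l6], c, by simp [l7], fun c' hc' => ?_⟩
          rcases Nat.lt_succ_iff_lt_or_eq.1 hc' with h' | h'
          · exact l8 c' h'
          · exact (le_of_eq (congrArg g (Fin.ext h'))).trans hle
        · simp [Expr.cost, RExpr.cost]
      · rintro u - ⟨l1, l2, l3, l4, l5, l6, c, l7, l8⟩
        refine Runs.mono (Runs.store ?_ ?_ ?_ ?_) ?_
        · simp [Expr.Fits]
        · simp [Expr.Fits]
        · simp [Expr.eval, l2]
          omega
        · refine ⟨by simpa using l1, by simp [l6], fun y hy => ?_, c, fun v => ?_,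
            fun c' => l8 c' c'.2⟩
          · simp [Expr.eval, l2, l5, k2']
            rw [if_neg (by omega), if_neg (by omega)]
          · simp [Expr.eval, l2, l7, l5, k2', Fin.val_inj, Function.update_apply, hx]
            split_ifs <;> simp
        · simp [Expr.cost]
      · simp only [Expr.cost, labelsE]
        omega
    · simp only [Expr.cost, bagElemE]
      omega
  · omega

end NAGL

/-! ### Extraction of an optimal labeling from the stored tables. -/

namespace NAGL

open RAM

variable {n L m : ℕ} [NeZero L] {N : NAGL (Fin n) (Fin L)}
  {D : NiceTreeDecomposition N.graph.square (Fin m)} {S W : ℕ} {s : State}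

/-- Choose the label for the vertex that is forgotten at the node in register 8, if there is one. -/
def chooseIfForgetCmd : Cmd :=
  .branch (childCountE 8)
    (.seq (.assign 5 (.read .child (.reg 8) (.const 0)))
      (.branch (.lt (bagCountE 8) (bagCountE 5)) chooseCmd .skip))
    .skip

/-- One step of the extraction of a labeling: pop a node, choose the label of the vertex that is
forgotten there, and push the children. -/
def labelCmd : Cmd :=
  .seq (.assign 3 (.sub (.reg 3) (.const 1))) <|
    .seq (.assign 8 (.load (.add (.reg 1) (.reg 3)))) <|
      .seq chooseIfForgetCmd <|
        .forLoop 9 (childCountE 8) <|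
          .seq (.store (.add (.reg 1) (.reg 3)) (.read .child (.reg 8) (.reg 9)))
            (.assign 3 (.add (.reg 3) (.const 1)))

theorem runs_chooseIfForget (hr : N.Room D S W n (slot D true)) {β : Fin n → Fin m}
    (hβ : N.IsAssignment D β) {i : Fin m} {x : Fin n → Fin L} {P : Set (Fin m)}
    (h0 : s.reg 0 = L ^ (D.width + 1)) (h8 : s.reg 8 = i) (hx : ∀ v : Fin n, s.mem v = x v)
    (htab : ∀ j, Holds D true s j (N.table D β j)) (hf : N.FollowsOn D β P x)
    (hP : ∀ k ∈ P, k ∈ D.desc i → k = i) :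
    Runs (N.environment D S W) chooseIfForgetCmd s (100 * (D.width + 2) + 50 * L + 50) fun s' =>
      State.Agree 5 s s' ∧ s'.reg 8 = i ∧ s'.rmem = s.rmem ∧ (∀ y ≥ n, s'.mem y = s.mem y) ∧
        ∃ x' : Fin n → Fin L, (∀ v : Fin n, s'.mem v = x' v) ∧
          N.FollowsOn D β (insert i P) x' := by
  have hnot : (∀ j a, ¬ D.IsForget D.root i j a) → N.FollowsOn D β (insert i P) x :=
    FollowsOn.insert_of_not_isForget N D β hf
  refine Runs.mono (Runs.branch (K₁ := 100 * (D.width + 2) + 50 * L + 45) (K₂ := 1) ?_ (fun h => ?_)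
    fun h => Runs.skip ?_) ?_
  · simp [Expr.Fits, childCountE]
  · simp [Expr.eval, childCountE, h8, -Finset.card_eq_zero] at h
    obtain ⟨j, hj, h1, -⟩ := Finset.exists_entry_eq (Nat.pos_of_ne_zero h)
    refine Runs.mono (Runs.seq (Runs.assign ?_ (Runs.branch (K₁ := 100 * (D.width + 2) + 50 * L + 30)
      (K₂ := 1) ?_ (fun h => ?_) fun h => Runs.skip ?_))) ?_
    · simp [Expr.Fits]
    · simp [Expr.Fits, bagCountE]
    · simp [Expr.eval, bagCountE, h8, h1] at h
      obtain ⟨p, Q, R, hl⟩ := exists_isLink (N := N) hj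
      obtain ⟨a, ha, -⟩ := hl.isForget h
      refine (runs_choose (x := x) hr hβ ha ?_ ?_ ?_ ?_ ?_).conseq ?_
      · simp [h0]
      · simp [Expr.eval, h8, h1]
      · simp [h8]
      · simp [hx]
      · exact htab j
      · rintro t - ⟨i1, i2, i3, c, i4, i5⟩
        refine ⟨State.Agree.trans (by simp) (i1.mono (by omega)), ?_, by simp [i2],
          fun y hy => by simp [i3 y hy], _, i4, ?_⟩
        · rw [i1 8 (by omega)]
          simp [h8]
        · convert FollowsOn.insert_update N D β hβ hf ha hP (c := c) ?_
          intro c'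
          convert i5 c'
    · simp [Expr.eval, bagCountE, h8, h1] at h
      refine ⟨by simp, by simp [h8], by simp, by simp, x, by simp [hx], hnot fun j' a hf => ?_⟩
      have := hf.1
      rw [this, Finset.mem_singleton] at hj
      subst hj
      have := D.card_lt_of_isForget hf
      omega
    · simp only [Expr.cost, bagCountE]
      omega
  · refine ⟨by simp, h8, rfl, fun _ _ => rfl, x, hx, hnot fun j a hf => ?_⟩
    simp [Expr.eval, childCountE, h8, hf.1] at h
  · simp only [Expr.cost, childCountE]
    omega

/-- The condition `q ≤ D.depth i` bounds the stack, which lies behind the labeling: `i` is replaced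
by at most two children, so at most one more node lies below a child than below `i`, while the depth
grows by one. -/
theorem runs_label (hr : N.Room D S W n (slot D true)) {β : Fin n → Fin m}
    (hβ : N.IsAssignment D β) {i : Fin m} {x : Fin n → Fin L} {P : Set (Fin m)} {q : ℕ}
    (h0 : s.reg 0 = L ^ (D.width + 1)) (h1 : s.reg 1 = n) (h3 : s.reg 3 = q + 1)
    (hq : q ≤ D.depth i) (hm : s.mem (n + q) = i) (hx : ∀ v : Fin n, s.mem v = x v)
    (htab : ∀ j, Holds D true s j (N.table D β j)) (hf : N.FollowsOn D β P x)
    (hP : ∀ k ∈ P, k ∈ D.desc i → k = i) :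
    Runs (N.environment D S W) labelCmd s (100 * (D.width + 2) + 50 * L + 200) fun s' =>
      State.Agree 3 s s' ∧ s'.reg 3 = q + (D.children D.root i).card ∧ s'.rmem = s.rmem ∧
        (∀ y ≥ n, y < n + q → s'.mem y = s.mem y) ∧
        (∀ k < (D.children D.root i).card, s'.mem (n + q + k) = (D.children D.root i).entry k) ∧
        ∃ x' : Fin n → Fin L, (∀ v : Fin n, s'.mem v = x' v) ∧
          N.FollowsOn D β (insert i P) x' := by
  obtain ⟨hS, hW, hfr, hW4, hw, hL⟩ := hr.bounds
  have hh := D.depth_le_height i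
  have h2 := D.card_children_le i
  refine Runs.mono (Runs.seq (Runs.assign ?_ (Runs.seq (Runs.assign ?_ (Runs.seq (K₂ := 70)
    ((runs_chooseIfForget (i := i) (x := x) (P := P) hr hβ ?_ ?_ ?_ ?_ hf hP).conseq ?_)))))) ?_
  · simp [Expr.Fits]
  · simp [Expr.Fits, Expr.eval, h1, h3]
    omega
  · simp [h0]
  · simp [Expr.eval, h1, h3, hm]
  · simp [hx]
  · exact htab
  · rintro t - ⟨i1, i2, i3, i4, x', i5, i6⟩
    refine Runs.mono (Runs.forLoop 12 (b := (D.children D.root i).card) (Inv := fun k u =>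
      State.Agree 3 s u ∧ u.reg 8 = i ∧ u.reg 3 = q + k ∧ u.rmem = s.rmem ∧
      (∀ y < n + q, u.mem y = t.mem y) ∧
      ∀ k' < k, u.mem (n + q + k') = (D.children D.root i).entry k') ?_ ?_ ?_ ?_) ?_
    · refine ⟨?_, by simp [i2], ?_, by simp [i3], by simp, by simp⟩
      · refine State.Agree.trans (State.Agree.trans ?_ (i1.mono (by omega))) ?_ <;> simp
      · rw [State.setReg_reg, if_neg (by omega), i1 3 (by omega)]
        simp [Expr.eval, h3]
    · rintro k u ⟨-, j2, -⟩
      simp [Expr.Fits, Expr.eval, childCountE, j2]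
    · rintro k u hk h9 ⟨j1, j2, j3, j4, j5, j6⟩
      have e1 : u.reg 1 = n := by rw [j1 1 (by omega), h1]
      refine Runs.mono (Runs.seq (Runs.store ?_ ?_ ?_ (Runs.assign ?_ ?_))) ?_
      · simp [Expr.Fits, Expr.eval, e1, j3]
        omega
      · simp [Expr.Fits]
      · simp [Expr.eval, e1, j3]
        omega
      · simp [Expr.Fits, Expr.eval, j3]
        omega
      · simp [Expr.eval, e1, j1, j2, j3, j4, h9, ← add_assoc]
        refine ⟨fun y hy => ?_, fun k' hk' => ?_⟩
        · rw [if_neg (by omega), j5 y hy]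
        · rcases Nat.lt_or_eq_of_le hk' with h | rfl
          · rw [if_neg (by omega), j6 k' h]
          · simp
      · simp [Expr.cost]
    · rintro u - ⟨j1, j2, j3, j4, j5, j6⟩
      refine ⟨j1, j3, j4, fun y hy hy' => ?_, j6, x', fun v => ?_, i6⟩
      · rw [j5 y hy', i4 y hy]
        simp
      · rw [j5 v (by omega), i5 v]
    · simp only [Expr.cost, childCountE]
      omega
  · simp only [Expr.cost]
    omega

theorem FollowsOn.mono {β : Fin n → Fin m} {P Q : Set (Fin m)} {x : Fin n → Fin L}
    (h : N.FollowsOn D β Q x) (hPQ : P ⊆ Q) : N.FollowsOn D β P x := fun i hi => h i (hPQ hi)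

/-- The nodes of the subtree of `i` are processed before those below `i` on the stack. -/
theorem iterates_label (hr : N.Room D S W n (slot D true)) {β : Fin n → Fin m}
    (hβ : N.IsAssignment D β) (i : Fin m) {x : Fin n → Fin L} {P : Set (Fin m)} {q : ℕ}
    (h0 : s.reg 0 = L ^ (D.width + 1)) (h1 : s.reg 1 = n) (h3 : s.reg 3 = q + 1)
    (hq : q ≤ D.depth i) (hm : s.mem (n + q) = i) (hx : ∀ v : Fin n, s.mem v = x v)
    (htab : ∀ j, Holds D true s j (N.table D β j)) (hf : N.FollowsOn D β P x)
    (hP : ∀ k ∈ P, k ∉ D.desc i) :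
    Iterates (N.environment D S W) (.reg 3) labelCmd s
      (∑ _k ∈ D.desc i, (100 * (D.width + 2) + 50 * L + 202)) fun s' =>
      State.Agree 3 s s' ∧ s'.reg 3 = q ∧ s'.rmem = s.rmem ∧
        (∀ y ≥ n, y < n + q → s'.mem y = s.mem y) ∧
        ∃ x' : Fin n → Fin L, (∀ v : Fin n, s'.mem v = x' v) ∧
          N.FollowsOn D β (P ∪ D.desc i) x' := by
  classical
  induction i using D.children_induction generalizing s x P q with
  | _ i ih =>
    set ch := D.children D.root i with hch
    have h2 : ch.card ≤ 2 := D.card_children_le i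
    -- Here `c` is the number of children still on the stack. They are popped from the last to the
    -- first, and `P'` collects the nodes already processed.
    have key : ∀ c ≤ ch.card, ∀ {t : State} {y : Fin n → Fin L} {P' : Set (Fin m)},
        t.reg 0 = L ^ (D.width + 1) → t.reg 1 = n → t.reg 3 = q + c →
        (∀ k < c, t.mem (n + q + k) = ch.entry k) → (∀ v : Fin n, t.mem v = y v) →
        (∀ j, Holds D true t j (N.table D β j)) → N.FollowsOn D β P' y →
        (∀ k ∈ P', ∀ j ∈ ch, ch.position j < c → k ∉ D.desc j) →
        Iterates (N.environment D S W) (.reg 3) labelCmd t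
          (∑ j ∈ ch.filter (fun j => ch.position j < c),
            ∑ _k ∈ D.desc j, (100 * (D.width + 2) + 50 * L + 202)) fun s' =>
          State.Agree 3 t s' ∧ s'.reg 3 = q ∧ s'.rmem = t.rmem ∧
            (∀ y ≥ n, y < n + q → s'.mem y = t.mem y) ∧
            ∃ x' : Fin n → Fin L, (∀ v : Fin n, s'.mem v = x' v) ∧
              N.FollowsOn D β (P' ∪ {k | ∃ j ∈ ch, ch.position j < c ∧ k ∈ D.desc j}) x' := by
      intro c
      induction c with
      | zero =>
        intro _ t y P' _ _ t3 _ ty _ tf _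
        refine (Iterates.refl ?_).mono (Nat.zero_le _)
        exact ⟨by simp, t3, rfl, fun _ _ _ => rfl, y, ty, tf.mono (by simp)⟩
      | succ c ihc =>
        intro hc t y P' t0 t1 t3 tc ty ttab tf tP
        obtain ⟨j, hj, hj1, hj2⟩ := Finset.exists_entry_eq (X := ch) (k := c) (by omega)
        have hiff : ∀ k ∈ ch, (ch.position k < c + 1 ↔ ch.position k < c ∨ k = j) := fun k hk => by
          rw [← hj2]; exact Finset.position_lt_succ_iff hk hj
        have hset : ch.filter (fun j => ch.position j < c + 1) =
            insert j (ch.filter fun j => ch.position j < c) := by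
          ext k
          simp only [Finset.mem_filter, Finset.mem_insert]
          constructor
          · rintro ⟨h1, h2⟩
            rcases (hiff k h1).1 h2 with h | h
            · exact .inr ⟨h1, h⟩
            · exact .inl h
          · rintro (rfl | ⟨h1, h2⟩)
            · exact ⟨hj, by omega⟩
            · exact ⟨h1, by omega⟩
        have hdj := D.depth_child hj
        rw [hset, Finset.sum_insert (by simp [hj2])]
        refine ((ih j hj (q := q + c) t0 t1 (by omega) (by omega)
          (by rw [← add_assoc, tc c (by omega), hj1]) ty ttab tf
          fun k hk => tP k hk j hj (by omega)).conseq ?_).bind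
        rintro u - ⟨u1, u2, u3, u4, y', u5, u6⟩
        refine (ihc (by omega) (t := u) (y := y') (by rw [u1 0 (by omega), t0])
          (by rw [u1 1 (by omega), t1]) u2 (fun k hk => ?_) u5 (fun j idx hidx => ?_) u6
          ?_).conseq ?_
        · rw [u4 _ (by omega) (by omega), tc k (by omega)]
        · rw [u3]
          exact ttab j idx hidx
        · rintro k (hk | hk) j' hj' hlt
          · exact tP k hk j' hj' (by omega)
          · have hne : j ≠ j' := by rintro rfl; omega
            exact Finset.disjoint_left.1 (D.desc_disjoint hj hj' hne) hk
        · rintro v - ⟨v1, v2, v3, v4, x', v5, v6⟩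
          refine ⟨u1.trans v1, v2, v3.trans u3, fun z hz hz' => ?_, x', v5, v6.mono ?_⟩
          · rw [v4 z hz hz', u4 z hz (by omega)]
          · rintro k (hk | ⟨j', hj', hlt, hk⟩)
            · exact .inl (.inl hk)
            · rcases (hiff j' hj').1 hlt with h | rfl
              · exact .inr ⟨j', hj', h, hk⟩
              · exact .inl (.inr hk)
    have hall : ch.filter (fun j => ch.position j < ch.card) = ch :=
      Finset.filter_true_of_mem fun j hj => Finset.position_lt_card hj
    rw [D.sum_desc]
    refine Iterates.mono (Iterates.bind (Iterates.conseq (Iterates.step (by simp [Expr.Fits])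
      (by simp [Expr.eval, h3]) (runs_label hr hβ h0 h1 h3 hq hm hx htab hf
        fun k hk hk' => absurd hk' (hP k hk))) (Q := fun t => Iterates _ _ _ t
          (∑ j ∈ ch, ∑ _k ∈ D.desc j, (100 * (D.width + 2) + 50 * L + 202)) _) ?_)) ?_
    · rintro t - ⟨t1, t2, t3, t4, t5, y, t6, t7⟩
      have := key ch.card le_rfl (t := t) (y := y) (by rw [t1 0 (by omega), h0])
        (by rw [t1 1 (by omega), h1]) t2 t5 t6 (fun j idx hidx => by rw [t3]; exact htab j idx hidx)
        t7 ?_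
      · rw [hall] at this
        refine this.conseq ?_
        rintro v - ⟨v1, v2, v3, v4, x', v5, v6⟩
        refine ⟨t1.trans v1, v2, v3.trans t3, fun z hz hz' => by rw [v4 z hz hz', t4 z hz hz'],
          x', v5, v6.mono ?_⟩
        rintro k (hk | hk)
        · exact .inl (.inr hk)
        · rcases D.mem_desc_iff.1 (Finset.mem_coe.1 hk) with rfl | ⟨j, hj, hk⟩
          · exact .inl (.inl rfl)
          · exact .inr ⟨j, hj, Finset.position_lt_card hj, hk⟩
      · rintro k (rfl | hk) j hj -
        · exact D.not_mem_desc_child hj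
        · exact fun h => hP k hk (D.desc_trans (D.child_mem_desc hj) h)
    · simp only [Expr.cost, ← hch]
      omega

end NAGL

/-! ### The two programs and their resource bounds. -/

namespace NAGL

open RAM

/-- The program that computes an optimal labeling. -/
def labelProgram : Cmd :=
  .branch (.lt (.const 1) labelsE)
    (.seq (tableCmd true) <|
      .seq (.assign 3 (.const 1)) <|
        .seq (.store (.reg 1) (.read .rootNode (.const 0) (.const 0))) <|
          .loop (.reg 3) labelCmd)
    .skip

/-- The program that computes the optimal value. -/
def valueProgram : Cmd :=
  .branch (.lt (.const 1) labelsE)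
    -- With slots by depth the root has slot 1, so its only entry is at the address `L^(t+1)`, which
    -- is the content of register 0.
    (.seq (tableCmd false) (.rassign 0 (.load (.reg 0))))
    (.forLoop 0 (.read .numVertices (.const 0) (.const 0)) <|
      .seq (.query 1 (.reg 0) (.const 0) (nbrCountE 0)) (.rassign 0 (.add (.reg 0) (.reg 1))))

section Cost

/-- This absorbs the cubic cost of the scope tests into `L^(t+1)` when there are at least two
labels. -/
theorem succ_pow_three_le_two_pow (k : ℕ) : (k + 1) ^ 3 ≤ 8 * 2 ^ k := by
  rcases Nat.lt_or_ge k 3 with h | h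
  · interval_cases k <;> norm_num
  · induction k, h using Nat.le_induction with
    | base => norm_num
    | succ k hk ih =>
      rw [pow_succ 2]
      nlinarith [pow_pos (show 0 < k by omega) 3, pow_pos (show 0 < k by omega) 2]

variable {n L m : ℕ} {N : NAGL (Fin n) (Fin L)} (D : NiceTreeDecomposition N.graph.square (Fin m))

theorem sum_load (β : Fin n → Fin m) : ∑ i, load β i = n := by
  classical
  simp only [load]
  rw [← Finset.card_eq_sum_card_fiberwise fun _ _ => Finset.mem_coe.2 (Finset.mem_univ _)]
  simp

/-- The loads add up to `n`, which gives the second term. In the first, 2770 is 2400 from the cubic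
part, 220 from clearing and merging tables, and 150 from the constant. -/
theorem sum_nodeCost_le (hL : 2 ≤ L) (β : Fin n → Fin m) :
    ∑ i, nodeCost D β i ≤ 2770 * (m * L ^ (D.width + 1)) +
      300 * (n * max D.width 1 * L ^ (D.width + 1)) := by
  have h1 : 2 ^ (D.width + 1) ≤ L ^ (D.width + 1) := Nat.pow_le_pow_left hL _
  have h2 : (D.width + 2) ^ 3 ≤ 8 * 2 ^ (D.width + 1) := succ_pow_three_le_two_pow (D.width + 1)
  have h3 : D.width + 2 ≤ 3 * max D.width 1 := by omega
  simp only [nodeCost, Finset.sum_add_distrib, ← Finset.mul_sum, sum_load, Finset.sum_const,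
    Finset.card_univ, Fintype.card_fin, smul_eq_mul]
  have h4 : m * (300 * (D.width + 2) ^ 3) ≤ m * (2400 * L ^ (D.width + 1)) :=
    Nat.mul_le_mul_left _ (by omega)
  have h5 : m * 150 ≤ m * (150 * L ^ (D.width + 1)) :=
    Nat.mul_le_mul_left _ (by have : 0 < L ^ (D.width + 1) := by positivity
                              omega)
  have h6 : (D.width + 2) * (n * L ^ (D.width + 1)) ≤
      3 * max D.width 1 * (n * L ^ (D.width + 1)) := Nat.mul_le_mul_right _ h3
  nlinarith

end Cost

section Bounds

theorem row_length_le {p q : ℕ} (A : Fin p → Finset (Fin q)) (i : ℕ) : (row A i).length ≤ q := by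
  unfold row
  split_ifs with h
  · simpa using Finset.card_le_univ (A ⟨i, h⟩)
  · simp

theorem row_getD_le {p q : ℕ} (A : Fin p → Finset (Fin q)) (i k : ℕ) : (row A i).getD k 0 ≤ q := by
  rcases Nat.lt_or_ge k (row A i).length with hk | hk
  · rw [List.getD_eq_getElem _ _ hk]
    have := List.getElem_mem hk
    unfold row at this ⊢
    split_ifs at this ⊢ with h
    · obtain ⟨v, -, hv⟩ := List.mem_map.1 this
      omega
    · exact absurd hk (by simp [row, h])
  · rw [List.getD_eq_default _ _ hk]
    exact Nat.zero_le q

variable {n L m : ℕ} {N : NAGL (Fin n) (Fin L)} (D : NiceTreeDecomposition N.graph.square (Fin m))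

theorem inputTable_le (tab : Table) (i j : ℕ) : N.inputTable D tab i j ≤ max n (max L m) := by
  cases tab <;> simp only [inputTable]
  case nbrCount => exact (row_length_le _ _).trans (by omega)
  case bagCount => exact (row_length_le _ _).trans (by omega)
  case childCount => exact (row_length_le _ _).trans (by omega)
  case nbr => exact (row_getD_le _ _ _).trans (by omega)
  case bagElem => exact (row_getD_le _ _ _).trans (by omega)
  case child => exact (row_getD_le _ _ _).trans (by omega)
  all_goals omega

theorem bounds (hn : 0 < n) (hL : 0 < L) : n ≤ m ∧ D.width + 1 ≤ D.height D.root ∧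
    D.height D.root < m ∧ 0 < L ^ (D.width + 1) ∧ L ≤ L ^ (D.width + 1) := by
  have : Nonempty (Fin n) := ⟨⟨0, hn⟩⟩
  have h1 := D.card_vertices_le
  have h2 := D.height_lt_card
  simp only [Fintype.card_fin] at h1 h2
  exact ⟨h1, D.width_lt_height, h2, by positivity, Nat.le_self_pow (by omega) L⟩

/-- It ensures that every address of a memory of `C * M` cells is a word below `M ^ C`. -/
theorem mul_le_pow_self {M C : ℕ} (hM : 2 ≤ M) (hC : 0 < C) : C * M ≤ M ^ C := by
  obtain ⟨C, rfl⟩ := Nat.exists_eq_succ_of_ne_zero hC.ne'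
  rw [pow_succ]
  exact Nat.mul_le_mul_right _ (Nat.lt_two_pow_self.trans_le (Nat.pow_le_pow_left hM C))

variable {C : ℕ}

theorem wordBound_bounds (hn : 0 < n) (hL : 0 < L) (hC : 5000 ≤ C) :
    C * (m * L ^ (D.width + 1)) ≤ (m * L ^ (D.width + 1)) ^ C ∧ 2 ≤ m * L ^ (D.width + 1) ∧
      max n (max L m) ≤ m * L ^ (D.width + 1) ∧ 4 < (m * L ^ (D.width + 1)) ^ C ∧
      m * L ^ (D.width + 1) < (m * L ^ (D.width + 1)) ^ C := by
  obtain ⟨h1, h2, h3, h4, h5⟩ := bounds D hn hL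
  have h6 : m ≤ m * L ^ (D.width + 1) := Nat.le_mul_of_pos_right _ h4
  have h7 : L ^ (D.width + 1) ≤ m * L ^ (D.width + 1) := Nat.le_mul_of_pos_left _ (by omega)
  have h8 := mul_le_pow_self (M := m * L ^ (D.width + 1)) (C := C) (by omega) (by omega)
  have h9 : 5000 * (m * L ^ (D.width + 1)) ≤ C * (m * L ^ (D.width + 1)) :=
    Nat.mul_le_mul_right _ hC
  exact ⟨h8, by omega, by omega, by omega, by omega⟩

theorem bounded_init (hn : 0 < n) (hL : 0 < L) (hC : 5000 ≤ C) (S : ℕ) :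
    Bounded (N.environment D S ((m * L ^ (D.width + 1)) ^ C)) State.init := by
  obtain ⟨h1, h2, h3, h4, h5⟩ := wordBound_bounds D hn hL hC
  refine ⟨h4, fun tab i j => ?_, fun _ => ?_, fun _ => ?_⟩
  · exact ((inputTable_le D tab i j).trans h3).trans_lt h5
  · exact (Nat.zero_le 4).trans_lt h4
  · exact (Nat.zero_le 4).trans_lt h4

theorem room_label (hn : 0 < n) (hL : 2 ≤ L) (hC : 5000 ≤ C) :
    N.Room D (C * (m * L ^ (D.width + 1))) ((m * L ^ (D.width + 1)) ^ C) n (slot D true) := by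
  obtain ⟨h1, h2, h3, h4, h5⟩ := wordBound_bounds D hn (by omega) hC
  obtain ⟨h6, h7, h8, h9, h10⟩ := bounds D hn (by omega)
  have h11 : m ≤ m * L ^ (D.width + 1) := Nat.le_mul_of_pos_right _ h9
  have h12 : L ^ (D.width + 1) ≤ m * L ^ (D.width + 1) := Nat.le_mul_of_pos_left _ (by omega)
  have h13 : 5000 * (m * L ^ (D.width + 1)) ≤ C * (m * L ^ (D.width + 1)) :=
    Nat.mul_le_mul_right _ hC
  refine ⟨hL, hn, h4, h1, by omega, by omega, fun i => ?_⟩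
  have : (slot D true i + 1) * L ^ (D.width + 1) ≤ m * L ^ (D.width + 1) :=
    Nat.mul_le_mul_right _ (by simp [slot])
  omega

/-- Slots are numbered from 1 to `h + 1` and slot 0 stays empty, so `h + 2 ≤ 3 h` slots are enough.
-/
theorem room_value (hn : 0 < n) (hL : 2 ≤ L) (hC : 5000 ≤ C) :
    N.Room D (C * (D.height D.root * L ^ (D.width + 1))) ((m * L ^ (D.width + 1)) ^ C) 0
      (slot D false) := by
  obtain ⟨h1, h2, h3, h4, h5⟩ := wordBound_bounds D hn (by omega) hC
  obtain ⟨h6, h7, h8, h9, h10⟩ := bounds D hn (by omega)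
  have h11 : m ≤ m * L ^ (D.width + 1) := Nat.le_mul_of_pos_right _ h9
  set h := D.height D.root with hh
  have h12 : L ^ (D.width + 1) ≤ h * L ^ (D.width + 1) := Nat.le_mul_of_pos_left _ (by omega)
  have h13 : 5000 * (h * L ^ (D.width + 1)) ≤ C * (h * L ^ (D.width + 1)) :=
    Nat.mul_le_mul_right _ hC
  have h14 : h ≤ h * L ^ (D.width + 1) := Nat.le_mul_of_pos_right _ h9
  have h15 : C * (h * L ^ (D.width + 1)) ≤ C * (m * L ^ (D.width + 1)) :=
    Nat.mul_le_mul_left _ (Nat.mul_le_mul_right _ h8.le)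
  refine ⟨hL, hn, h4, by omega, by omega, by omega, fun i => ?_⟩
  have : (slot D false i + 1) * L ^ (D.width + 1) ≤ (3 * h) * L ^ (D.width + 1) :=
    Nat.mul_le_mul_right _ (by have := D.depth_le_height i; simp [slot]; omega)
  rw [mul_assoc] at this
  omega

end Bounds

variable {n L m : ℕ} {N : NAGL (Fin n) (Fin L)} {D : NiceTreeDecomposition N.graph.square (Fin m)}
  {S W : ℕ}

theorem runs_labelProgram [NeZero L] (hr : N.Room D S W n (slot D true)) {β : Fin n → Fin m}
    (hβ : N.IsForgetAssignment D β) :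
    Runs (N.environment D S W) labelProgram State.init
      (∑ i, nodeCost D β i + m * (100 * (D.width + 2) + 50 * L + 202) + 30 * m +
        20 * (D.width + 2) + 30) fun s =>
      ∃ x : Fin n → Fin L, (∀ v : Fin n, s.mem v = x v) ∧ N.IsOptimal x := by
  obtain ⟨hS, hW, hfr, hW4, hw, hL⟩ := hr.bounds
  refine Runs.mono (Runs.branch (K₂ := 0) ?_ (fun _ => Runs.seq (K₂ := 10 +
    m * (100 * (D.width + 2) + 50 * L + 202)) ((runs_table hr hβ rfl).conseq ?_)) fun h => ?_) ?_
  · simp [Expr.Fits, labelsE]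
  · rintro t - ⟨i1, i2, i3, -, i5⟩
    have := iterates_label (s := (t.setReg 3 1).setMem n D.root) (x := fun _ => 0) (P := ∅) (q := 0)
      hr hβ.1 D.root (by simp [i1]) (by simp [i2]) (by simp) (Nat.zero_le _) (by simp)
      (fun v => by simp [i3 v v.2, v.2.ne]) (fun j idx hidx => i5 rfl j idx hidx)
      (fun _ h => by simp at h) (by simp)
    refine Runs.mono (Runs.seq (Runs.assign ?_ (Runs.seq (Runs.store ?_ ?_ ?_
      (Iterates.runs_loop (Iterates.conseq (P := fun s' => s'.reg 3 = 0 ∧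
        ∃ x : Fin n → Fin L, (∀ v : Fin n, s'.mem v = x v) ∧ N.IsOptimal x)
        (K := m * (100 * (D.width + 2) + 50 * L + 202)) ?_ ?_)))))) ?_
    · simp [Expr.Fits]
    · simp [Expr.Fits]
    · simp [Expr.Fits]
    · simp [Expr.eval, i2]
      omega
    · simp only [Expr.eval, State.setReg_reg, i2]
      refine (Iterates.conseq this ?_).mono (by simp [D.desc_root])
      rintro u - ⟨-, j2, -, -, x, j5, j6⟩
      exact ⟨j2, x, j5, N.isOptimal_of_followsOn D β hβ.1 (j6.mono (by simp [D.desc_root]))⟩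
    · rintro u - ⟨j1, j2⟩
      exact ⟨by simp [Expr.Fits], by simp [Expr.eval, j1], j2⟩
    · simp only [Expr.cost]
      omega
  · simp [Expr.eval, labelsE] at h
    omega
  · simp only [Expr.cost, labelsE]
    omega

theorem runs_valueProgram [NeZero L] (hr : N.Room D S W 0 (slot D false)) {β : Fin n → Fin m}
    (hβ : N.IsForgetAssignment D β) :
    Runs (N.environment D S W) valueProgram State.init
      (∑ i, nodeCost D β i + 30 * m + 20 * (D.width + 2) + 30) fun s =>
      N.IsOptimalValue (s.rreg 0) := by
  obtain ⟨hS, hW, hfr, hW4, hw, hL⟩ := hr.bounds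
  refine Runs.mono (Runs.branch (K₂ := 0) ?_ (fun _ => Runs.seq (K₂ := 3)
    ((runs_table hr hβ rfl).conseq ?_)) fun h => ?_) ?_
  · simp [Expr.Fits, labelsE]
  · rintro t - ⟨i1, -, -, i4, -⟩
    refine Runs.rassign ?_ ?_
    · simp [RExpr.Fits, Expr.Fits, Expr.eval, i1, hS]
    · have := i4 0 (by simp [D.bag_root])
      simp only [slot, D.depth_root, cond_false, zero_add, one_mul, add_zero] at this
      simp only [RExpr.eval, Expr.eval, i1, this, State.setRReg_rreg, if_true]
      exact N.isOptimalValue_table_root D β hβ.1 _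
  · simp [Expr.eval, labelsE] at h
    omega
  · simp only [Expr.cost, labelsE]
    omega

/-- With one label the initial memory, all zero, is already the only labeling. -/
theorem runs_labelProgram_one {N : NAGL (Fin n) (Fin 1)}
    {D : NiceTreeDecomposition N.graph.square (Fin m)} :
    Runs (N.environment D S W) labelProgram State.init 10 fun s =>
      ∃ x : Fin n → Fin 1, (∀ v : Fin n, s.mem v = x v) ∧ N.IsOptimal x := by
  refine Runs.mono (Runs.branch (K₁ := 0) (K₂ := 1) ?_ (fun h => ?_) fun h => Runs.skip ?_) ?_
  · simp [Expr.Fits, labelsE]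
  · simp [Expr.eval, labelsE] at h
  · exact ⟨fun _ => 0, fun v => by simp [State.init], fun y => by
      rw [Subsingleton.elim y fun _ => 0]⟩
  · simp [Expr.cost, labelsE]

/-- The untouched zero cells serve as the arguments of every query, so only `t + 1` cells have to
exist, and the values are summed in a register. -/
theorem runs_valueProgram_one {N : NAGL (Fin n) (Fin 1)}
    {D : NiceTreeDecomposition N.graph.square (Fin m)} {β : Fin n → Fin m}
    (hβ : N.IsAssignment D β) (hS : D.width + 1 ≤ S) :
    Runs (N.environment D S W) valueProgram State.init (n * (30 + D.width) + 20) fun s =>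
      N.IsOptimalValue (s.rreg 0) := by
  set x : Fin n → Fin 1 := fun _ => 0
  set f : ℕ → ℝ := fun k => ∑ v ∈ Finset.univ.filter (fun v : Fin n => (v : ℕ) < k),
    N.reward v ((N.graph.closedNbhd v).restrict x) with hf
  have hfn : f n = N.objective x := by
    simp only [hf, objective]
    rw [Finset.filter_true_of_mem fun v _ => v.2]
  have hfs : ∀ v : Fin n, f (v + 1) = f v + N.reward v ((N.graph.closedNbhd v).restrict x) := by
    intro v
    have : (Finset.univ.filter fun k : Fin n => (k : ℕ) < v + 1) =
        insert v (Finset.univ.filter fun k : Fin n => (k : ℕ) < v) := by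
      ext k
      simp only [Finset.mem_filter, Finset.mem_univ, true_and, Finset.mem_insert, Fin.ext_iff]
      omega
    simp only [hf, this]
    rw [Finset.sum_insert (by simp), add_comm]
  refine Runs.mono (Runs.branch (K₁ := 0) ?_ (fun h => ?_) fun h => Runs.forLoop (D.width + 15)
    (b := n) (Inv := fun k s => s.mem = State.init.mem ∧ s.rreg 0 = f k) ?_ ?_ ?_ ?_) ?_
  · simp [Expr.Fits, labelsE]
  · simp [Expr.eval, labelsE] at h
  · simp [hf, State.init]
  · intro k s _
    simp [Expr.Fits, Expr.eval]
  · rintro k s hk h0 ⟨i1, i2⟩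
    obtain ⟨v, rfl⟩ : ∃ v : Fin n, (v : ℕ) = k := ⟨⟨k, hk⟩, rfl⟩
    have hcard : (N.graph.closedNbhd v).card ≤ D.width + 1 :=
      (Finset.card_le_card (hβ v)).trans (D.card_bag_le_width _)
    have he : (nbrCountE 0).eval (N.environment D S W) s = (N.graph.closedNbhd v).card := by
      simp [Expr.eval, nbrCountE, h0]
    refine Runs.mono (Runs.seq (Runs.query (b := D.width + 1) ?_ ?_ ?_ ?_
      (r := N.reward v ((N.graph.closedNbhd v).restrict x)) ?_ ?_ (Runs.rassign ?_ ?_))) ?_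
    · simp [Expr.Fits]
    · simp [Expr.Fits]
    · simp [Expr.Fits, nbrCountE]
    · rw [he]
      intro k hk
      simp [Expr.eval]
      omega
    · rw [he]
      simp only [environment_oracle, Expr.eval, h0]
      exact oracle_of_forall fun u _ => by simp [i1, State.init, x]
    · rw [he]
      exact hcard
    · simp [RExpr.Fits]
    · simp [RExpr.eval, h0, i1, i2, hfs]
    · simp only [Expr.cost, RExpr.cost, nbrCountE]
      omega
  · rintro s - ⟨-, i2⟩
    rw [i2, hfn]
    refine ⟨⟨x, rfl⟩, ?_⟩
    rintro _ ⟨y, rfl⟩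
    rw [Subsingleton.elim y x]
  · simp only [Expr.cost, labelsE]
    have : n * (1 + 1 + 1 + 7 + (D.width + 15)) ≤ n * (30 + D.width) :=
      Nat.mul_le_mul_left _ (by omega)
    omega

end NAGL

/-! ### Assembly of the main theorem. -/

theorem mainTheorem1 :
    ∃ (labelProgram valueProgram : RAM.Cmd) (C : ℕ),
      ∀ (n L m : ℕ) (N : NAGL (Fin n) (Fin L))
        (D : NiceTreeDecomposition N.graph.square (Fin m)) (t h : ℕ),
        0 < n → 0 < L → t = D.width → h = D.height D.root →
        -- the dynamic program over the nodes of the decomposition is correct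
        ((∃ β : Fin n → Fin m, N.IsAssignment D β) ∧
          ∀ β : Fin n → Fin m, N.IsAssignment D β →
            ∃ DP : (i : Fin m) → (D.bag i → Fin L) → ℝ,
              N.IsTable D β DP ∧
              (∀ DP' : (i : Fin m) → (D.bag i → Fin L) → ℝ, N.IsTable D β DP' → DP' = DP) ∧
              (∀ ℓ : D.bag D.root → Fin L, N.IsOptimalValue (DP D.root ℓ)) ∧
              (∃ x : Fin n → Fin L, N.FollowsBackpointers D DP x) ∧
              (∀ x : Fin n → Fin L, N.FollowsBackpointers D DP x → N.IsOptimal x)) ∧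
        -- an optimal labeling is computed in time `O(n t L^(t+1))` and space `O(|I| L^(t+1))`
        (∃ (s : RAM.State) (k : ℕ) (x : Fin n → Fin L),
          RAM.Exec (N.environment D (C * (m * L ^ (t + 1))) ((m * L ^ (t + 1)) ^ C))
            labelProgram RAM.State.init s k ∧
          (∀ v : Fin n, s.mem v = x v) ∧ N.IsOptimal x ∧
          ∀ c : ℕ, m ≤ c * (n * max t 1) → k ≤ C * c * (n * max t 1 * L ^ (t + 1))) ∧
        -- the optimal value is computed in the same time and space `O(h L^(t+1))`
        (∃ (s : RAM.State) (k : ℕ),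
          RAM.Exec (N.environment D (C * (h * L ^ (t + 1))) ((m * L ^ (t + 1)) ^ C))
            valueProgram RAM.State.init s k ∧
          N.IsOptimalValue (s.rreg 0) ∧
          ∀ c : ℕ, m ≤ c * (n * max t 1) → k ≤ C * c * (n * max t 1 * L ^ (t + 1))) := by
  -- The value 5000 is the sum of the constants 4000 and 1000 in `key`; only the inequality is used.
  obtain ⟨C, hC⟩ : ∃ C, 5000 ≤ C := ⟨_, le_rfl⟩
  refine ⟨NAGL.labelProgram, NAGL.valueProgram, C, ?_⟩
  rintro n L m N D _ _ hn hL rfl rfl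
  have : NeZero L := ⟨hL.ne'⟩
  obtain ⟨β, hβ⟩ := N.exists_isForgetAssignment D
  refine ⟨⟨⟨β, hβ.1⟩, fun β hβ => N.dynamicProgram_correct D β hβ⟩, ?_⟩
  obtain ⟨-, hw, hh, hB, hLB⟩ := NAGL.bounds D hn hL
  have hb := NAGL.bounded_init (C := C) D hn hL hC
  have hnB : 0 < n * max D.width 1 * L ^ (D.width + 1) := by positivity
  -- every bound on the number of steps that occurs below is of this form
  have key : ∀ k, k ≤ 4000 * (m * L ^ (D.width + 1)) + 1000 * (n * max D.width 1 *
      L ^ (D.width + 1)) → ∀ c, m ≤ c * (n * max D.width 1) →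
      k ≤ C * c * (n * max D.width 1 * L ^ (D.width + 1)) := fun k hk c hc => by
    have hc1 : 1 ≤ c := by
      rcases Nat.eq_zero_or_pos c with rfl | h
      · omega
      · exact h
    have h1 : m * L ^ (D.width + 1) ≤ c * (n * max D.width 1 * L ^ (D.width + 1)) := by
      rw [← mul_assoc c]
      exact Nat.mul_le_mul_right _ hc
    have h2 : n * max D.width 1 * L ^ (D.width + 1) ≤
        c * (n * max D.width 1 * L ^ (D.width + 1)) := Nat.le_mul_of_pos_left _ hc1
    have h3 : 5000 * (c * (n * max D.width 1 * L ^ (D.width + 1))) ≤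
        C * (c * (n * max D.width 1 * L ^ (D.width + 1))) := Nat.mul_le_mul_right _ hC
    rw [mul_assoc]
    omega
  have hnw : D.width + 2 ≤ 3 * (n * max D.width 1 * L ^ (D.width + 1)) := by
    have : max D.width 1 ≤ n * max D.width 1 * L ^ (D.width + 1) :=
      (Nat.le_mul_of_pos_left _ hn).trans (Nat.le_mul_of_pos_right _ hB)
    omega
  have hmB : m ≤ m * L ^ (D.width + 1) := Nat.le_mul_of_pos_right _ hB
  -- For `L = 1` the power `L^(t+1)` is 1 and does not dominate a cubic term in `t`, so this case
  -- has its own bounds.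
  rcases Nat.lt_or_ge 1 L with hL2 | hL1
  · have hcost := NAGL.sum_nodeCost_le D hL2 β
    obtain ⟨s, k, h1, h2, -, x, h3, h4⟩ :=
      NAGL.runs_labelProgram (NAGL.room_label D hn hL2 hC) hβ (hb _)
    obtain ⟨s', k', h1', h2', -, h3'⟩ :=
      NAGL.runs_valueProgram (NAGL.room_value D hn hL2 hC) hβ (hb _)
    refine ⟨⟨s, k, x, h1, h3, h4, key k (h2.trans ?_)⟩, s', k', h1', h3', key k' (h2'.trans ?_)⟩
    · have hwB : D.width + 2 ≤ 2 * L ^ (D.width + 1) := by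
        have := Nat.lt_pow_self (n := D.width + 1) hL2
        omega
      have : m * (100 * (D.width + 2) + 50 * L + 202) ≤ m * (452 * L ^ (D.width + 1)) :=
        Nat.mul_le_mul_left _ (by omega)
      rw [Nat.mul_left_comm] at this
      omega
    · omega
  · obtain rfl : L = 1 := by omega
    obtain ⟨s, k, h1, h2, -, x, h3, h4⟩ := NAGL.runs_labelProgram_one (hb _)
    -- The arguments of a query fit into the working space because `t + 1 ≤ h`.
    obtain ⟨s', k', h1', h2', -, h3'⟩ := NAGL.runs_valueProgram_one hβ.1 (hw.trans (by
      rw [← mul_assoc, mul_right_comm]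
      exact Nat.le_mul_of_pos_left _ (by positivity))) (hb (C * (D.height D.root * 1 ^ (D.width + 1))))
    refine ⟨⟨s, k, x, h1, h3, h4, key k (h2.trans ?_)⟩, s', k', h1', h3', key k' (h2'.trans ?_)⟩
    · omega
    · have : n * (30 + D.width) ≤ n * (31 * max D.width 1) := Nat.mul_le_mul_left _ (by omega)
      rw [Nat.mul_left_comm] at this
      simp only [one_pow, mul_one] at hnB ⊢
      omega
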